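/- Let $k,x_0,\gamma,n,p,t_0$ be real constants with $0<x_0<k$, $\gamma>0$, $n>0$, $0<p<1+\frac1n$; put $A_n=(k/x_0)^n-1$, $\alpha=e^{-\gamma n}$, assume $A_n^{1-p}+n\gamma(1-p)t_0>0$, and put, for $p\neq1$, $$\eta=[A_n^{1-p}+n\gamma(1-p)t_0]^{1/(p-1)},\qquad g(t)=\bigl\{\eta+[1+\eta^{1-p}(\ln\alpha)(1-p)t]^{1/(1-p)}\bigr\}^{1/n};$$ for $p=1$ take the limits as $p\to1$, that is $\eta=e^{-n\gamma t_0}/A_n$ and $g(t)=(\eta+\alpha^t)^{1/n}$. Let $T>t_0$ be such that $g$ is well defined and positive on $[t_0,T]$: for every $t$ there, the number in braces is positive and, when $p\ne1$ and $1/(1-p)$ is not a natural number, the number in square brackets is nonnegative. Let $h=-g'/g$ on $[t_0,T]$. Then for $t_0\le\tau\le t\le T$ $$\int_\tau^t h(u)\,du=\ln\frac{g(\tau)}{g(t)},$$ and the deterministic growth curve $$x(t)=\frac{k}{\bigl\{1+[\gamma n(p-1)(t-t_0)+A_n^{1-p}]^{1/(1-p)}\bigr\}^{1/n}}$$ (for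 $p=1$: $x(t)=k\,(1+A_ne^{-\gamma n(t-t_0)})^{-1/n}$) satisfies $x(t)=x_0\,g(t_0)/g(t)$ on $[t_0,T]$. Let $\sigma>0$ and let $W$ be a standard Wiener process with respect to a filtration. For a starting time $s\ge t_0$ let $X_L$ and $X_G$ be adapted, a.s. continuous solutions on $[s,T]$ of the Itô equations $$dX_L=h(t)X_L\,dt+\sigma X_L\,dW(t),\qquad dX_G=h(t)X_G\,dt+\sigma\,dW(t),$$ with deterministic initial values $X_L(s)>0$ and $X_G(s)\in\mathbb R$. Then for $s\le\tau<t\le T$ the following hold. 1. $X_L(\tau)>0$ a.s., and given $X_L(\tau)=y>0$ the variable $X_L(t)$ has the lognormal density $$f_L(x,t|y,\tau)=\frac{1}{x\sqrt{2\pi\sigma^2(t-\tau)}}\exp\Bigl\{-\frac{[\ln x-M_L(t|\ln y,\tau)]^2}{2\sigma^2(t-\tau)}\Bigr\},\quad x>0,$$ $$M_L(t|\ln y,\tau)=\ln y+\ln\frac{g(\tau)}{g(t)}-\frac{\sigma^2}{2}(t-\tau).$$ Moreover $X_L(t)$ is square integrable, $\mathbb E[X_L(t)|X_L(\tau)=y]=y\frac{g(\tau)}{g(t)}$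 and $\operatorname{Var}[X_L(t)|X_L(\tau)=y]=\bigl[y\frac{g(\tau)}{g(t)}\bigr]^2\bigl(e^{\sigma^2(t-\tau)}-1\bigr)$. For the process started from $y>0$ at time $s$, the law, mean and variance of $X_L(t)$ are given by these formulas with $\tau=s$, and, for every integer $m\ge0$, $\mathbb E[X_L(t)^m]=\exp\{mM_L(t|\ln y,s)+\frac{m^2}{2}\sigma^2(t-s)\}$ (in particular this moment is finite). 2. Given $X_G(\tau)=y\in\mathbb R$ the variable $X_G(t)$ has the Gaussian density $$f_G(x,t|y,\tau)=\frac{1}{\sqrt{2\pi V_G(t|\tau)}}\exp\Bigl\{-\frac{[x-M_G(t|y,\tau)]^2}{2V_G(t|\tau)}\Bigr\},$$ $$M_G(t|y,\tau)=y\,\frac{g(\tau)}{g(t)},\qquad V_G(t|\tau)=\sigma^2\int_\tau^t\Bigl[\frac{g(\vartheta)}{g(t)}\Bigr]^2d\vartheta>0.$$ Moreover $X_G(t)$ is square integrable, with conditional mean $M_G(t|y,\tau)$ and conditional variance $V_G(t|\tau)$ given $X_G(\tau)=y$. For the process started from $y$ at time $s$, the law, mean and variance of $X_G(t)$ are given by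 these formulas with $\tau=s$. 3. If $s=t_0$ and the initial value is $x_0$, then $\mathbb E[X_L(t)]=\mathbb E[X_G(t)]=x(t)$ for all $t\in[t_0,T]$: both processes have the deterministic growth curve as mean. -/

import Mathlib

open MeasureTheory ProbabilityTheory Set
open scoped NNReal ENNReal

/-- The constants of the growth model: carrying capacity `k`, initial size `x₀` at the initial
time `t₀`, and shape parameters `γ`, `n`, `p`. -/
structure GrowthParams where
  k : ℝ
  x₀ : ℝ
  γ : ℝ
  n : ℝ
  p : ℝ
  t₀ : ℝ

namespace GrowthParams

variable (G : GrowthParams)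

/-- `A_n = (k / x₀) ^ n - 1`. -/
noncomputable def A : ℝ := (G.k / G.x₀) ^ G.n - 1

/-- `α = exp (-γ n)`. -/
noncomputable def α : ℝ := Real.exp (-(G.γ * G.n))

/-- The base `A_n ^ (1 - p) + n γ (1 - p) t₀` of the power that defines `η`. -/
noncomputable def etaBase : ℝ := G.A ^ (1 - G.p) + G.n * G.γ * (1 - G.p) * G.t₀

/-- `η = (A_n ^ (1 - p) + n γ (1 - p) t₀) ^ (1 / (p - 1))`, and its limit
`exp (-n γ t₀) / A_n` as `p → 1` when `p = 1`. -/
noncomputable def η : ℝ :=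
  if G.p = 1 then Real.exp (-(G.n * G.γ * G.t₀)) / G.A
  else G.etaBase ^ (1 / (G.p - 1))

/-- The bracket `1 + η ^ (1 - p) (ln α) (1 - p) t`. -/
noncomputable def bracket (t : ℝ) : ℝ :=
  1 + G.η ^ (1 - G.p) * Real.log G.α * (1 - G.p) * t

/-- The expression `η + [1 + η ^ (1 - p) (ln α) (1 - p) t] ^ (1 / (1 - p))`, and its limit
`η + α ^ t` as `p → 1` when `p = 1`. -/
noncomputable def gBase (t : ℝ) : ℝ :=
  if G.p = 1 then G.η + G.α ^ t
  else G.η + G.bracket t ^ (1 / (1 - G.p))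

/-- The function `g`. -/
noncomputable def g (t : ℝ) : ℝ := G.gBase t ^ (1 / G.n)

/-- The growth rate `h = -g' / g`. -/
noncomputable def h (t : ℝ) : ℝ := -deriv G.g t / G.g t

/-- The deterministic growth curve
`x(t) = k / {1 + [γ n (p - 1) (t - t₀) + A_n ^ (1 - p)] ^ (1 / (1 - p))} ^ (1 / n)`,
and its limit `k / {1 + A_n exp (-γ n (t - t₀))} ^ (1 / n)` as `p → 1` when `p = 1`. -/
noncomputable def curve (t : ℝ) : ℝ :=
  if G.p = 1 then G.k / (1 + G.A * Real.exp (-(G.γ * G.n * (t - G.t₀)))) ^ (1 / G.n)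
  else G.k / (1 + (G.γ * G.n * (G.p - 1) * (t - G.t₀) + G.A ^ (1 - G.p)) ^ (1 / (1 - G.p)))
    ^ (1 / G.n)

/-- The admissible constants. The last field says that `η` is a well-defined real power. -/
structure Valid : Prop where
  x₀_pos : 0 < G.x₀
  x₀_lt : G.x₀ < G.k
  γ_pos : 0 < G.γ
  n_pos : 0 < G.n
  p_pos : 0 < G.p
  p_lt : G.p < 1 + 1 / G.n
  etaBase_pos : 0 < G.etaBase

/-- `g` is a well-defined positive number at time `t`: the base of the power with exponent
`1 / (1 - p)` is nonnegative unless `p = 1` or that exponent is a natural number, and the base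
of the power with exponent `1 / n` is positive. -/
def DefinedAt (t : ℝ) : Prop :=
  (G.p = 1 ∨ 0 ≤ G.bracket t ∨ ∃ m : ℕ, 1 / (1 - G.p) = m) ∧ 0 < G.gBase t

/-- The log-mean `M_L(t | ln y, τ)`. -/
noncomputable def ML (σ t y τ : ℝ) : ℝ :=
  Real.log y + Real.log (G.g τ / G.g t) - σ ^ 2 / 2 * (t - τ)

/-- The lognormal density `f_L(x, t | y, τ)`, extended by zero to `x ≤ 0`. -/
noncomputable def fL (σ x t y τ : ℝ) : ℝ :=
  if 0 < x then
    1 / (x * √(2 * Real.pi * (σ ^ 2 * (t - τ)))) *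
      Real.exp (-(Real.log x - G.ML σ t y τ) ^ 2 / (2 * (σ ^ 2 * (t - τ))))
  else 0

/-- The conditional mean `M_G(t | y, τ) = y g(τ) / g(t)`. -/
noncomputable def MG (t y τ : ℝ) : ℝ := y * (G.g τ / G.g t)

/-- The conditional variance `V_G(t | τ) = σ² ∫_τ^t (g(θ) / g(t))² dθ`. -/
noncomputable def VG (σ t τ : ℝ) : ℝ := σ ^ 2 * ∫ θ in τ..t, (G.g θ / G.g t) ^ 2

/-- The Gaussian density `f_G(x, t | y, τ)`. -/
noncomputable def fG (σ x t y τ : ℝ) : ℝ :=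
  1 / √(2 * Real.pi * G.VG σ t τ) *
    Real.exp (-(x - G.MG t y τ) ^ 2 / (2 * G.VG σ t τ))

end GrowthParams

section Sde

variable {Ω : Type*} {mΩ : MeasurableSpace Ω}

/-- `W` is, from time `t₀` on, a Wiener process with respect to the filtration `𝓕`. -/
structure IsWienerFrom (P : Measure Ω) (𝓕 : Filtration ℝ mΩ) (t₀ : ℝ) (W : ℝ → Ω → ℝ) :
    Prop where
  adapted : ∀ t, t₀ ≤ t → Measurable[𝓕 t] (W t)
  brownian : IsBrownianReal (fun (u : ℝ≥0) ω => W (t₀ + u) ω - W t₀ ω) P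
  indep : ∀ s t, t₀ ≤ s → s ≤ t →
    Indep (𝓕 s) (MeasurableSpace.comap (fun ω => W t ω - W s ω) inferInstance) P

/-- The left-endpoint sum `∑_{i < N} H(u_i) (W(u_{i+1}) - W(u_i))`. -/
def leftSum (H W : ℝ → Ω → ℝ) (u : ℕ → ℝ) (N : ℕ) (ω : Ω) : ℝ :=
  ∑ i ∈ Finset.range N, H (u i) ω * (W (u (i + 1)) ω - W (u i) ω)

/-- `I = ∫_s^t H dW` in the sense of Itô, for an adapted integrand `H` with almost surely
continuous paths: `I` is the limit in probability of the left-endpoint sums over the partitions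
`s = u_0 ≤ u_1 ≤ ⋯ ≤ u_N = t` as the mesh tends to zero. -/
def IsItoIntegral (P : Measure Ω) (H W : ℝ → Ω → ℝ) (s t : ℝ) (I : Ω → ℝ) : Prop :=
  ∀ ε : ℝ, 0 < ε → ∃ δ : ℝ, 0 < δ ∧ ∀ (N : ℕ) (u : ℕ → ℝ), Monotone u → u 0 = s → u N = t →
    (∀ i < N, u (i + 1) - u i ≤ δ) →
      P {ω | ε ≤ |leftSum H W u N ω - I ω|} ≤ ENNReal.ofReal ε

/-- `X` is a solution on `[s, T]` of `dX = b(t, X) dt + c(t, X) dW`, `X(s) = y`, where `b` and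
`c` are continuous along the paths of `X`: it is adapted with almost surely continuous paths and
`X(t) - y - ∫_s^t b(u, X(u)) du = ∫_s^t c(u, X(u)) dW(u)` almost surely for every
`t` in `[s, T]`. -/
structure IsItoSolution (P : Measure Ω) (𝓕 : Filtration ℝ mΩ) (W : ℝ → Ω → ℝ)
    (b c : ℝ → ℝ → ℝ) (s T y : ℝ) (X : ℝ → Ω → ℝ) : Prop where
  adapted : ∀ t ∈ Icc s T, Measurable[𝓕 t] (X t)
  continuous : ∀ᵐ ω ∂P, ContinuousOn (fun t => X t ω) (Icc s T)
  initial : ∀ᵐ ω ∂P, X s ω = y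
  equation : ∀ t ∈ Icc s T,
    IsItoIntegral P (fun u ω => c u (X u ω)) W s t
      (fun ω => X t ω - y - ∫ u in s..t, b u (X u ω))

/-- The solutions `X_L` of `dX = h(t) X dt + σ X dW`, `X(s) = y`. -/
def IsLognormalProcess (G : GrowthParams) (σ : ℝ) (P : Measure Ω) (𝓕 : Filtration ℝ mΩ)
    (W : ℝ → Ω → ℝ) (s T y : ℝ) (X : ℝ → Ω → ℝ) : Prop :=
  IsItoSolution P 𝓕 W (fun t x => G.h t * x) (fun _ x => σ * x) s T y X

/-- The solutions `X_G` of `dX = h(t) X dt + σ dW`, `X(s) = y`. -/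
def IsGaussianProcessOU (G : GrowthParams) (σ : ℝ) (P : Measure Ω) (𝓕 : Filtration ℝ mΩ)
    (W : ℝ → Ω → ℝ) (s T y : ℝ) (X : ℝ → Ω → ℝ) : Prop :=
  IsItoSolution P 𝓕 W (fun t x => G.h t * x) (fun _ _ => σ) s T y X

/-- `f x y` is a transition density of `X` from time `τ` to time `t`: the conditional
distribution of `X t` given `X τ = y` is `f x y dx`. -/
def HasTransitionDensity (P : Measure Ω) (X : ℝ → Ω → ℝ) (τ t : ℝ) (f : ℝ → ℝ → ℝ) : Prop :=
  Measurable (fun q : ℝ × ℝ => f q.2 q.1) ∧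
    HasCondDistrib (X t) (X τ)
      (Kernel.withDensity (Kernel.const ℝ (volume : Measure ℝ))
        (fun y x => ENNReal.ofReal (f x y))) P

end Sde

/-! The function `g` is an integrating factor for the drift: by definition of `h`, `g' = -h g`. The
integral of `h` is therefore a logarithm of a ratio of values of `g`. The growth curve is a multiple
of `1 / g` because `gBase` is `η` times the inner expression of the curve (`gBase_eq`). For additive
noise, `g X` has only noise increments, `d(g X) = σ g dW`. Over a grid cell the increment of `g X`
is `g` times the increment of the noise part, plus a defect that is of smaller order than the mesh,
uniformly in the cell (`eventually_abs_driftDefect_le`). Hence `g(t) X(t) - g(τ) X(τ)` is an almost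
sure limit of sums of `σ g ΔW`. Characteristic functions show that such a limit is Gaussian and
independent of the state at time `τ` (`hasLaw_and_indepFun_of_tendsto_sum_increments`). For
multiplicative noise, the claim is that `g X Z` is constant in time, where `Z = exp(-σ (W - W(s)) +
σ² (u - s) / 2)` is `discount`. The Itô formula is replaced by a direct telescoping of `g X Z` over
a grid. Each increment is a sum of four terms: the error of replacing the stochastic integral over a
cell by `σ X ΔW`, the product `Δg ΔW`, the defect of the exponential factor (mean and variance of
order `d²` on a cell of length `d`), and the drift defect. All four sums vanish in probability
(`mul_discount_eq_of_linear`). The first and third are controlled by the orthogonality of martingale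
increments after truncation (`integral_sq_sum_mul_le`), the other two path by path. In both cases
`X(t) = Φ(X(τ), ξ)` with `ξ` independent of `X(τ)` and of known law, so the conditional law given
`X(τ) = y` is the image of the law of `ξ` under `Φ(y, ·)`. Densities, conditional moments and means
follow. -/

namespace GrowthParams

/-! ### The function `g`, its differential equation and the deterministic curve -/

variable {G : GrowthParams}

theorem Valid.A_add_one (hG : G.Valid) : 1 < (G.k / G.x₀) ^ G.n :=
  Real.one_lt_rpow ((one_lt_div hG.x₀_pos).2 hG.x₀_lt) hG.n_pos

theorem Valid.A_pos (hG : G.Valid) : 0 < G.A := sub_pos.2 hG.A_add_one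

theorem Valid.η_pos (hG : G.Valid) : 0 < G.η := by
  unfold η
  split_ifs
  · exact div_pos (Real.exp_pos _) hG.A_pos
  · exact Real.rpow_pos_of_pos hG.etaBase_pos _

/-- Since `η ^ (1 - p)` is the inverse of `etaBase`, the product clears it, and the `t₀` term of
`etaBase` shifts `t` to `t - t₀`. This links the bracket in `g` with the one in the growth curve. -/
theorem etaBase_mul_bracket (hG : G.Valid) (hp : G.p ≠ 1) (t : ℝ) :
    G.etaBase * G.bracket t =
      G.γ * G.n * (G.p - 1) * (t - G.t₀) + G.A ^ (1 - G.p) := by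
  have h1 : G.p - 1 ≠ 0 := sub_ne_zero.2 hp
  have h : G.η ^ (1 - G.p) = G.etaBase⁻¹ := by
    rw [η, if_neg hp, ← Real.rpow_mul hG.etaBase_pos.le, ← Real.rpow_neg_one]
    congr 1
    field_simp
    ring
  rw [bracket, h, α, Real.log_exp, mul_add, mul_one]
  have : G.etaBase ≠ 0 := hG.etaBase_pos.ne'
  have e : G.etaBase * (G.etaBase⁻¹ * -(G.γ * G.n) * (1 - G.p) * t)
      = -(G.γ * G.n) * (1 - G.p) * t := by field_simp
  rw [e, etaBase]
  ring

theorem bracket_pos (hG : G.Valid) (hp : 1 < G.p) {t : ℝ} (ht : G.t₀ ≤ t) :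
    0 < G.bracket t := by
  have h := etaBase_mul_bracket hG hp.ne' t
  have h2 : 0 < G.etaBase * G.bracket t := by
    rw [h]
    have := Real.rpow_pos_of_pos hG.A_pos (1 - G.p)
    have := mul_nonneg (mul_nonneg (mul_nonneg hG.γ_pos.le hG.n_pos.le) (sub_nonneg.2 hp.le))
      (sub_nonneg.2 ht)
    linarith
  exact pos_of_mul_pos_right h2 hG.etaBase_pos.le

theorem continuousAt_and_hasDerivAt_gBase (hG : G.Valid) : ∃ d : ℝ → ℝ, ∀ t, G.t₀ ≤ t →
    ContinuousAt d t ∧ HasDerivAt G.gBase (d t) t := by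
  by_cases hp : G.p = 1
  · refine ⟨fun t => Real.log G.α * G.α ^ t, fun t _ => ?_⟩
    have hα : 0 < G.α := Real.exp_pos _
    have h : HasDerivAt (fun t : ℝ => G.α ^ t) (Real.log G.α * G.α ^ t) t := by
      simpa using (hasDerivAt_id t).const_rpow hα
    refine ⟨continuousAt_const.mul h.continuousAt, ?_⟩
    have e : G.gBase = fun t => G.η + G.α ^ t := by ext t; simp [gBase, hp]
    rw [e]
    exact h.const_add _
  · set c := G.η ^ (1 - G.p) * Real.log G.α * (1 - G.p) with hc
    set q := 1 / (1 - G.p) with hq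
    have hb : ∀ t, HasDerivAt G.bracket c t := fun t => by
      have h := ((hasDerivAt_id t).const_mul c).const_add 1
      rw [mul_one] at h
      exact h
    have e : G.gBase = fun t => G.η + G.bracket t ^ q := by ext t; simp [gBase, hp, hq]
    -- The power is continuously differentiable for two different reasons: for `0 < p < 1` the
    -- exponent is at least `1`, so the bracket may vanish or be negative; for `p > 1` the exponent
    -- is negative, but the bracket is positive from `t₀` on.
    have key : ∀ t, G.t₀ ≤ t → G.bracket t ≠ 0 ∨ 1 ≤ q := fun t ht => by
      rcases lt_or_gt_of_ne hp with h | h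
      · right
        rw [hq, le_div_iff₀ (by linarith)]
        linarith [hG.p_pos]
      · exact .inl (bracket_pos hG h ht).ne'
    refine ⟨fun t => c * q * G.bracket t ^ (q - 1), fun t ht => ⟨?_, ?_⟩⟩
    · refine continuousAt_const.mul ((hb t).continuousAt.rpow_const ?_)
      exact (key t ht).imp_right fun h => by linarith
    · rw [e]
      exact ((hb t).rpow_const (key t ht)).const_add _

theorem g_pos {t : ℝ} (ht : G.DefinedAt t) : 0 < G.g t := Real.rpow_pos_of_pos ht.2 _

theorem hasDerivAt_g (hG : G.Valid) {t : ℝ} (h₀ : G.t₀ ≤ t) (ht : G.DefinedAt t) :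
    HasDerivAt G.g (-(G.h t * G.g t)) t := by
  obtain ⟨d, hd⟩ := continuousAt_and_hasDerivAt_gBase hG
  have h := (hd t h₀).2.rpow_const (p := 1 / G.n) (.inl ht.2.ne')
  have h' : HasDerivAt G.g _ t := h
  convert h' using 1
  rw [GrowthParams.h, h'.deriv, div_mul_cancel₀ _ (g_pos ht).ne', neg_neg]

theorem continuousOn_h (hG : G.Valid) {T : ℝ} (hg : ∀ t ∈ Icc G.t₀ T, G.DefinedAt t) :
    ContinuousOn G.h (Icc G.t₀ T) := by
  obtain ⟨d, hd⟩ := continuousAt_and_hasDerivAt_gBase hG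
  have hf : ContinuousOn
      (fun t => -(d t * (1 / G.n) * G.gBase t ^ (1 / G.n - 1)) / G.g t) (Icc G.t₀ T) := by
    intro t ht
    refine ContinuousAt.continuousWithinAt ?_
    have h := (hd t ht.1).2.continuousAt
    refine ContinuousAt.div ?_ (hasDerivAt_g hG ht.1 (hg t ht)).continuousAt (g_pos (hg t ht)).ne'
    exact (((hd t ht.1).1.mul continuousAt_const).mul
      (h.rpow_const (.inl (hg t ht).2.ne'))).neg
  refine hf.congr fun t ht => ?_
  have h : HasDerivAt G.g _ t :=
    (hd t ht.1).2.rpow_const (p := 1 / G.n) (.inl (hg t ht).2.ne')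
  rw [GrowthParams.h, h.deriv]

theorem integral_h (hG : G.Valid) {T : ℝ} (hg : ∀ t ∈ Icc G.t₀ T, G.DefinedAt t) {τ t : ℝ}
    (hτ : G.t₀ ≤ τ) (hτt : τ ≤ t) (ht : t ≤ T) :
    IntervalIntegrable G.h volume τ t ∧
      ∫ u in τ..t, G.h u = Real.log (G.g τ / G.g t) := by
  have hsub : uIcc τ t ⊆ Icc G.t₀ T := by
    rw [uIcc_of_le hτt]; exact Icc_subset_Icc hτ ht
  have hi : IntervalIntegrable G.h volume τ t :=
    ((continuousOn_h hG hg).mono hsub).intervalIntegrable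
  refine ⟨hi, ?_⟩
  have hd : ∀ u ∈ uIcc τ t, HasDerivAt (fun u => -Real.log (G.g u)) (G.h u) u := fun u hu => by
    have hu' := hsub hu
    have hp := g_pos (hg u hu')
    refine ((hasDerivAt_g hG hu'.1 (hg u hu')).log hp.ne').neg.congr_deriv ?_
    rw [neg_div, neg_neg, mul_div_cancel_right₀ _ hp.ne']
  rw [intervalIntegral.integral_eq_sub_of_hasDerivAt hd hi,
    Real.log_div (g_pos (hg τ (hsub left_mem_uIcc))).ne' (g_pos (hg t (hsub right_mem_uIcc))).ne']
  ring

theorem gBase_eq (hG : G.Valid) {t : ℝ} (ht : G.DefinedAt t) :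
    G.gBase t = G.η * (if G.p = 1 then 1 + G.A * Real.exp (-(G.γ * G.n * (t - G.t₀)))
      else 1 + (G.γ * G.n * (G.p - 1) * (t - G.t₀) + G.A ^ (1 - G.p)) ^ (1 / (1 - G.p))) := by
  split_ifs with hp
  · have hA := hG.A_pos.ne'
    simp only [gBase, η, hp, if_true, α, ← Real.exp_mul]
    field_simp
    rw [mul_add, mul_one, mul_left_comm, ← Real.exp_add]
    congr 3
    ring
  · simp only [gBase, if_neg hp]
    rw [mul_add, mul_one, ← etaBase_mul_bracket hG hp]
    -- Splitting the real power of a product needs a nonnegative bracket or a natural exponent,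
    -- which is what `DefinedAt` provides.
    have hE : (G.etaBase * G.bracket t) ^ (1 / (1 - G.p))
        = G.etaBase ^ (1 / (1 - G.p)) * G.bracket t ^ (1 / (1 - G.p)) := by
      rcases ht.1 with h | h | ⟨m, hm⟩
      · exact absurd h hp
      · exact Real.mul_rpow hG.etaBase_pos.le h
      · rw [hm]; simp only [Real.rpow_natCast, mul_pow]
    have h1 : G.η * G.etaBase ^ (1 / (1 - G.p)) = 1 := by
      rw [η, if_neg hp, ← Real.rpow_add hG.etaBase_pos]
      have : 1 / (G.p - 1) + 1 / (1 - G.p) = 0 := by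
        rw [← neg_sub 1 G.p, one_div_neg_eq_neg_one_div, neg_add_cancel]
      rw [this, Real.rpow_zero]
    rw [hE, ← mul_assoc, h1, one_mul]

theorem curve_eq (hG : G.Valid) (h₀ : G.DefinedAt G.t₀) {t : ℝ} (ht : G.DefinedAt t) :
    G.curve t = G.x₀ * (G.g G.t₀ / G.g t) := by
  have hη := hG.η_pos
  have h1 := gBase_eq hG ht
  set D := (if G.p = 1 then 1 + G.A * Real.exp (-(G.γ * G.n * (t - G.t₀)))
      else 1 + (G.γ * G.n * (G.p - 1) * (t - G.t₀) + G.A ^ (1 - G.p)) ^ (1 / (1 - G.p))) with hD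
  have hDpos : 0 < D := pos_of_mul_pos_right (h1 ▸ ht.2) hη.le
  have hc : G.curve t = G.k / D ^ (1 / G.n) := by
    rw [curve, hD]; split_ifs <;> rfl
  -- At `t₀` the inner expression is `1 + A = (k / x₀) ^ n`; its `n`-th root produces the factor `k
  -- / x₀`, and `η ^ (1 / n)` cancels in the ratio.
  have hg0 : G.gBase G.t₀ = G.η * (G.k / G.x₀) ^ G.n := by
    rw [gBase_eq hG h₀]
    congr 1
    have hA : 1 + G.A = (G.k / G.x₀) ^ G.n := by rw [A]; ring
    split_ifs with hp
    · simpa using hA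
    · rw [sub_self, mul_zero, zero_add, ← Real.rpow_mul hG.A_pos.le,
        mul_one_div_cancel (sub_ne_zero.2 (Ne.symm hp)), Real.rpow_one, hA]
  have hkx : 0 < G.k / G.x₀ := div_pos (hG.x₀_pos.trans hG.x₀_lt) hG.x₀_pos
  rw [hc, g, g, h1, hg0, Real.mul_rpow hη.le (Real.rpow_nonneg hkx.le _),
    Real.mul_rpow hη.le hDpos.le, ← Real.rpow_mul hkx.le, mul_one_div_cancel hG.n_pos.ne',
    Real.rpow_one]
  have := hG.x₀_pos.ne'
  have := (Real.rpow_pos_of_pos hη (1 / G.n)).ne'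
  have := (Real.rpow_pos_of_pos hDpos (1 / G.n)).ne'
  field_simp

end GrowthParams

/-! ### Convergence to zero in probability -/

section InProbability

open Filter Topology

variable {Ω : Type*} {mΩ : MeasurableSpace Ω} {P : Measure Ω}

/-- The sequence `f` tends to zero in probability. -/
def TendsToZeroInProb (P : Measure Ω) (f : ℕ → Ω → ℝ) : Prop :=
  ∀ ε : ℝ, 0 < ε → Tendsto (fun N => P {ω | ε ≤ |f N ω|}) atTop (𝓝 0)

namespace TendsToZeroInProb

theorem add {f f' : ℕ → Ω → ℝ} (hf : TendsToZeroInProb P f) (hf' : TendsToZeroInProb P f') :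
    TendsToZeroInProb P (fun N ω => f N ω + f' N ω) := by
  intro ε hε
  have h := (hf (ε / 2) (half_pos hε)).add (hf' (ε / 2) (half_pos hε))
  rw [add_zero] at h
  refine tendsto_of_tendsto_of_tendsto_of_le_of_le tendsto_const_nhds h (fun _ => zero_le)
    fun N => (measure_mono fun ω hω => ?_).trans (measure_union_le _ _)
  by_contra hn
  simp only [mem_union, mem_ofPred_eq, not_or, not_le] at hn hω
  have := abs_add_le (f N ω) (f' N ω)
  linarith [hn.1, hn.2]

theorem of_ae_tendsto [IsFiniteMeasure P] {f : ℕ → Ω → ℝ} (hf : ∀ N, AEMeasurable (f N) P)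
    (h : ∀ᵐ ω ∂P, Tendsto (fun N => f N ω) atTop (𝓝 0)) : TendsToZeroInProb P f := by
  have := tendstoInMeasure_of_tendsto_ae (fun N => (hf N).aestronglyMeasurable) h
  intro ε hε
  simpa using (tendstoInMeasure_iff_norm.1 this) ε hε

theorem ae_eq_zero {F : Ω → ℝ} (h : TendsToZeroInProb P (fun _ => F)) : F =ᵐ[P] 0 := by
  have h1 : ∀ n : ℕ, ∀ᵐ ω ∂P, ¬ (1 / ((n : ℝ) + 1) ≤ |F ω|) := fun n => by
    have := tendsto_nhds_unique (h (1 / ((n : ℝ) + 1)) (by positivity)) tendsto_const_nhds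
    rw [ae_iff]
    simpa using this.symm
  filter_upwards [ae_all_iff.2 h1] with ω hω
  by_contra h0
  obtain ⟨n, hn⟩ := exists_nat_one_div_lt (abs_pos.2 h0)
  exact hω n hn.le

theorem congr {f f' : ℕ → Ω → ℝ} (hf : TendsToZeroInProb P f) (h : ∀ N, f N =ᵐ[P] f' N) :
    TendsToZeroInProb P f' := fun ε hε => by
  refine (hf ε hε).congr fun N => measure_congr ?_
  filter_upwards [h N] with ω hω
  exact congrArg (fun x : ℝ => ε ≤ |x|) hω

/-- A sequence that agrees, off sets of small probability, with sequences of arbitrarily small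
first absolute moment. -/
theorem of_forall_exists [IsFiniteMeasure P] {f : ℕ → Ω → ℝ}
    (h : ∀ c : ℝ, 0 < c → ∃ (A : ℕ → Set Ω) (F : ℕ → Ω → ℝ),
      Tendsto (fun N => P (A N)) atTop (𝓝 0) ∧
      (∀ᶠ N in atTop, Integrable (F N) P ∧ ∫ ω, |F N ω| ∂P ≤ c) ∧ ∀ N, ∀ ω ∉ A N, f N ω = F N ω) :
    TendsToZeroInProb P f := by
  intro ε hε
  rw [ENNReal.tendsto_nhds_zero]
  intro η hη
  obtain ⟨r, -, hrpos, hr⟩ : ∃ r : ℝ, 0 ≤ r ∧ 0 < ENNReal.ofReal r ∧ ENNReal.ofReal r < η :=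
    ENNReal.lt_iff_exists_real_btwn.1 hη
  have hr0 : 0 < r := ENNReal.ofReal_pos.1 hrpos
  -- With first moment at most `ε r / 2`, Markov's inequality at level `ε` gives probability at most
  -- `r / 2`; the exceptional set takes the other half.
  obtain ⟨A, F, hA, hFc, hAF⟩ := h (ε * (r / 2)) (by positivity)
  have hA' := ENNReal.tendsto_nhds_zero.1 hA (ENNReal.ofReal (r / 2))
    (ENNReal.ofReal_pos.2 (half_pos hr0))
  filter_upwards [hA', hFc] with N h1 ⟨hF, h2⟩
  have h3 := mul_meas_ge_le_integral_of_nonneg (μ := P) (f := fun ω => |F N ω|)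
    (ae_of_all _ fun ω => abs_nonneg _) hF.abs ε
  have h4 : P.real {ω | ε ≤ |F N ω|} ≤ r / 2 := le_of_mul_le_mul_left (h3.trans h2) hε
  have h5 : P {ω | ε ≤ |F N ω|} ≤ ENNReal.ofReal (r / 2) := by
    rw [← ENNReal.ofReal_toReal (measure_ne_top P {ω | ε ≤ |F N ω|})]
    exact ENNReal.ofReal_le_ofReal h4
  calc P {ω | ε ≤ |f N ω|} ≤ P (A N ∪ {ω | ε ≤ |F N ω|}) := by
        refine measure_mono fun ω hω => ?_
        by_cases hm : ω ∈ A N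
        · exact .inl hm
        · right
          rw [mem_ofPred_eq, ← hAF N ω hm]
          exact hω
    _ ≤ ENNReal.ofReal (r / 2) + ENNReal.ofReal (r / 2) :=
        (measure_union_le _ _).trans (add_le_add h1 h5)
    _ = ENNReal.ofReal r := by
        rw [← ENNReal.ofReal_add (by positivity) (by positivity), add_halves]
    _ ≤ η := hr.le

end TendsToZeroInProb

/-- The indicators tend to zero almost surely, hence in probability. This discards truncation
events: the index from which a path obeys the bound may depend on the path. -/
theorem tendsto_measure_zero_of_ae_eventually_notMem [IsFiniteMeasure P] {A : ℕ → Set Ω}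
    (hA : ∀ N, MeasurableSet (A N)) (h : ∀ᵐ ω ∂P, ∀ᶠ N in atTop, ω ∉ A N) :
    Tendsto (fun N => P (A N)) atTop (𝓝 0) := by
  have h1 : TendsToZeroInProb P (fun N => (A N).indicator (fun _ => (1 : ℝ))) := by
    refine .of_ae_tendsto (fun N => (measurable_const.indicator (hA N)).aemeasurable) ?_
    filter_upwards [h] with ω hω
    refine tendsto_const_nhds.congr' ?_
    filter_upwards [hω] with N hN
    simp [hN]
  refine (h1 1 one_pos).congr fun N => ?_
  congr 1
  ext ω
  by_cases hω : ω ∈ A N <;> simp [hω]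

end InProbability

/-! ### Second moments of martingale transforms -/

section MartingaleTransform

variable {Ω : Type*} {mΩ : MeasurableSpace Ω} {P : Measure Ω}

/-- Orthogonality of increments: the partial sum times the next coefficient is known to the past,
hence independent of the next centred increment, and the cross term vanishes. The bound on the
coefficients makes every product square integrable; measurability and integrability travel along in
the induction. -/
theorem integral_sq_sum_mul_le {𝓖 : ℕ → MeasurableSpace Ω} (hmono : Monotone 𝓖)
    (hle : ∀ k, 𝓖 k ≤ mΩ) {H ξ : ℕ → Ω → ℝ} {C : ℝ} {v : ℕ → ℝ} (n : ℕ)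
    (hH : ∀ k < n, Measurable[𝓖 k] (H k)) (hC : ∀ k < n, ∀ ω, |H k ω| ≤ C)
    (hξ : ∀ k < n, Measurable[𝓖 (k + 1)] (ξ k)) (hL : ∀ k < n, MemLp (ξ k) 2 P)
    (h0 : ∀ k < n, ∫ ω, ξ k ω ∂P = 0) (hv : ∀ k < n, ∫ ω, ξ k ω ^ 2 ∂P ≤ v k)
    (hind : ∀ k < n, Indep (𝓖 k) (MeasurableSpace.comap (ξ k) inferInstance) P) :
    Measurable[𝓖 n] (fun ω => ∑ k ∈ Finset.range n, H k ω * ξ k ω) ∧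
    MemLp (fun ω => ∑ k ∈ Finset.range n, H k ω * ξ k ω) 2 P ∧
    ∫ ω, (∑ k ∈ Finset.range n, H k ω * ξ k ω) ^ 2 ∂P ≤ C ^ 2 * ∑ k ∈ Finset.range n, v k := by
  induction n with
  | zero => simp
  | succ n ih =>
    obtain ⟨hm, hS, hb⟩ := ih (fun k hk => hH k (by omega)) (fun k hk => hC k (by omega))
      (fun k hk => hξ k (by omega)) (fun k hk => hL k (by omega)) (fun k hk => h0 k (by omega))
      (fun k hk => hv k (by omega)) (fun k hk => hind k (by omega))
    have hn := n.lt_succ_self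
    set S : Ω → ℝ := fun ω => ∑ k ∈ Finset.range n, H k ω * ξ k ω with hSdef
    have hHm : Measurable (H n) := (hH n hn).mono (hle n) le_rfl
    have hHξ : MemLp (fun ω => H n ω * ξ n ω) 2 P := by
      refine ((hL n hn).const_mul C).of_le
        (hHm.aestronglyMeasurable.mul (hL n hn).aestronglyMeasurable) (ae_of_all _ fun ω => ?_)
      have := (hC n hn ω).trans (le_abs_self C)
      simp only [Real.norm_eq_abs, abs_mul]
      gcongr
    have hSH : MemLp (fun ω => S ω * H n ω) 2 P := by
      refine (hS.const_mul C).of_le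
        (hS.aestronglyMeasurable.mul hHm.aestronglyMeasurable) (ae_of_all _ fun ω => ?_)
      have := (hC n hn ω).trans (le_abs_self C)
      simp only [Real.norm_eq_abs, abs_mul]
      rw [mul_comm]
      gcongr
    have hSHm : Measurable[𝓖 n] (fun ω => S ω * H n ω) := by
      let _ := 𝓖 n
      exact hm.mul (hH n hn)
    have hindf : IndepFun (fun ω => S ω * H n ω) (ξ n) P := by
      rw [IndepFun_iff_Indep]
      exact indep_of_indep_of_le_left (hind n hn) hSHm.comap_le
    have hcross : ∫ ω, S ω * H n ω * ξ n ω ∂P = 0 := by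
      rw [hindf.integral_fun_mul_eq_mul_integral hSH.aestronglyMeasurable
        (hL n hn).aestronglyMeasurable, h0 n hn, mul_zero]
    have hdiag : ∫ ω, (H n ω * ξ n ω) ^ 2 ∂P ≤ C ^ 2 * v n := by
      calc ∫ ω, (H n ω * ξ n ω) ^ 2 ∂P ≤ ∫ ω, C ^ 2 * ξ n ω ^ 2 ∂P := by
            refine integral_mono hHξ.integrable_sq ((hL n hn).integrable_sq.const_mul _) fun ω => ?_
            have := sq_le_sq.2 ((hC n hn ω).trans (le_abs_self C))
            simp only [mul_pow]
            gcongr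
        _ = C ^ 2 * ∫ ω, ξ n ω ^ 2 ∂P := integral_const_mul _ _
        _ ≤ C ^ 2 * v n := mul_le_mul_of_nonneg_left (hv n hn) (sq_nonneg _)
    refine ⟨?_, ?_, ?_⟩
    · simp only [Finset.sum_range_succ]
      have h1 : Measurable[𝓖 (n + 1)] S := hm.mono (hmono (Nat.le_succ n)) le_rfl
      have h2 : Measurable[𝓖 (n + 1)] (H n) := (hH n hn).mono (hmono (Nat.le_succ n)) le_rfl
      have h3 := hξ n hn
      let _ := 𝓖 (n + 1)
      exact h1.add (h2.mul h3)
    · simp only [Finset.sum_range_succ]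
      exact hS.add hHξ
    · have hi1 := hS.integrable_sq
      have hi2 := hHξ.integrable_sq
      have hi12 : Integrable (fun ω => S ω ^ 2 + (H n ω * ξ n ω) ^ 2) P := hi1.add hi2
      have hi3 : Integrable (fun ω => S ω * H n ω * ξ n ω) P := hSH.integrable_mul (hL n hn)
      have e : ∀ ω, (∑ k ∈ Finset.range (n + 1), H k ω * ξ k ω) ^ 2
          = S ω ^ 2 + (H n ω * ξ n ω) ^ 2 + 2 * (S ω * H n ω * ξ n ω) := fun ω => by
        rw [Finset.sum_range_succ]; ring
      simp only [e]
      rw [integral_add hi12 (hi3.const_mul 2), integral_add hi1 hi2, integral_const_mul,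
        hcross, Finset.sum_range_succ, mul_add]
      linarith

end MartingaleTransform

theorem MeasureTheory.Integrable.fun_sub {α : Type*} {_ : MeasurableSpace α} {μ : Measure α}
    {f g : α → ℝ} (hf : Integrable f μ) (hg : Integrable g μ) :
    Integrable (fun x => f x - g x) μ := hf.sub hg

/-! ### Exponential moments of centred Gaussian laws -/

section GaussianMoments

variable (v : ℝ≥0) (c : ℝ)

theorem mem_interior_integrableExpSet_gaussianReal (m : ℝ) :
    c ∈ interior (integrableExpSet id (gaussianReal m v)) := by
  simp [integrableExpSet_id_gaussianReal]

theorem integrable_pow_mul_exp_gaussianReal (n : ℕ) :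
    Integrable (fun x : ℝ => x ^ n * Real.exp (c * x)) (gaussianReal 0 v) :=
  integrable_pow_mul_exp_of_mem_interior_integrableExpSet
    (mem_interior_integrableExpSet_gaussianReal v c 0) n

theorem integral_exp_gaussianReal :
    ∫ x, Real.exp (c * x) ∂gaussianReal 0 v = Real.exp (v * c ^ 2 / 2) := by
  have := congrFun (mgf_id_gaussianReal (μ := 0) (v := v)) c
  simpa [mgf] using this

/-- Differentiation of the moment generating function under the integral sign; one more derivative
gives the quadratic moment. -/
theorem integral_mul_exp_gaussianReal :
    ∫ x, x * Real.exp (c * x) ∂gaussianReal 0 v = v * c * Real.exp (v * c ^ 2 / 2) := by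
  have h := hasDerivAt_integral_pow_mul_exp_real
    (mem_interior_integrableExpSet_gaussianReal v c 0) 0
  simp only [id, pow_zero, one_mul, zero_add, pow_one, integral_exp_gaussianReal] at h
  have h' : HasDerivAt (fun c : ℝ => Real.exp (v * c ^ 2 / 2)) _ c :=
    ((((hasDerivAt_id c).pow 2).const_mul (v : ℝ)).div_const 2).exp
  rw [h.unique h']
  simp
  ring

theorem integral_sq_mul_exp_gaussianReal :
    ∫ x, x ^ 2 * Real.exp (c * x) ∂gaussianReal 0 v
      = (v + (v * c) ^ 2) * Real.exp (v * c ^ 2 / 2) := by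
  have h := hasDerivAt_integral_pow_mul_exp_real
    (mem_interior_integrableExpSet_gaussianReal v c 0) 1
  simp only [id, pow_one, integral_mul_exp_gaussianReal, one_add_one_eq_two] at h
  have h' : HasDerivAt (fun c : ℝ => v * c * Real.exp (v * c ^ 2 / 2)) _ c :=
    ((hasDerivAt_id c).const_mul (v : ℝ)).mul
      ((((hasDerivAt_id c).pow 2).const_mul (v : ℝ)).div_const 2).exp
  rw [h.unique h']
  simp
  ring

end GaussianMoments

/-! ### Moments of the exponential factor over one cell -/

section ExponentialNoise

/-- `exp (-σ w + σ² d / 2)`, for an increment `w` of the Wiener process over a time `d`. -/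
noncomputable def expFactor (σ d w : ℝ) : ℝ := Real.exp (-σ * w + σ ^ 2 * d / 2)

/-- `exp (-σ w + σ² d / 2) (1 + σ w) - 1`, which is of the order of `w² - d` for small `w`. -/
noncomputable def expDefect (σ d w : ℝ) : ℝ := expFactor σ d w * (1 + σ * w) - 1

theorem measurable_expFactor (σ d : ℝ) : Measurable (expFactor σ d) := by
  unfold expFactor; fun_prop

theorem measurable_expDefect (σ d : ℝ) : Measurable (expDefect σ d) := by
  have := measurable_expFactor σ d
  unfold expDefect; fun_prop

variable (σ : ℝ) {d : ℝ≥0}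

/-- This and the next two expansions reduce to terms `w ^ n * exp (c w)`, whose Gaussian integrals
are known; `w ^ 0` is kept so that one integrability lemma covers all of them. -/
theorem sq_expFactor_sub_one (w : ℝ) :
    (expFactor σ d w - 1) ^ 2 = Real.exp (σ ^ 2 * d) * (w ^ 0 * Real.exp (-2 * σ * w))
      - 2 * Real.exp (σ ^ 2 * d / 2) * (w ^ 0 * Real.exp (-σ * w)) + 1 := by
  have e : Real.exp (σ ^ 2 * d) * Real.exp (-2 * σ * w) = expFactor σ d w ^ 2 := by
    rw [expFactor, ← Real.exp_add, ← Real.exp_nat_mul]; congr 1; push_cast; ring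
  have e' : Real.exp (σ ^ 2 * d / 2) * Real.exp (-σ * w) = expFactor σ d w := by
    rw [expFactor, ← Real.exp_add, add_comm]
  rw [pow_zero, one_mul, one_mul, e, mul_assoc, e']
  ring

theorem expDefect_eq (w : ℝ) :
    expDefect σ d w = Real.exp (σ ^ 2 * d / 2) * (w ^ 0 * Real.exp (-σ * w))
      + σ * Real.exp (σ ^ 2 * d / 2) * (w ^ 1 * Real.exp (-σ * w)) - 1 := by
  have e' : Real.exp (σ ^ 2 * d / 2) * Real.exp (-σ * w) = expFactor σ d w := by
    rw [expFactor, ← Real.exp_add, add_comm]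
  rw [expDefect, ← e']
  ring

theorem sq_expDefect (w : ℝ) :
    expDefect σ d w ^ 2 = Real.exp (σ ^ 2 * d) * (w ^ 0 * Real.exp (-2 * σ * w))
      + 2 * σ * Real.exp (σ ^ 2 * d) * (w ^ 1 * Real.exp (-2 * σ * w))
      + σ ^ 2 * Real.exp (σ ^ 2 * d) * (w ^ 2 * Real.exp (-2 * σ * w))
      - 2 * expDefect σ d w - 1 := by
  have e : Real.exp (σ ^ 2 * d) * Real.exp (-2 * σ * w) = expFactor σ d w ^ 2 := by
    rw [expFactor, ← Real.exp_add, ← Real.exp_nat_mul]; congr 1; push_cast; ring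
  have : expDefect σ d w ^ 2 =
      (Real.exp (σ ^ 2 * d) * Real.exp (-2 * σ * w)) * (1 + σ * w) ^ 2
        - 2 * expDefect σ d w - 1 := by
    rw [e, expDefect]; ring
  rw [this]
  ring

theorem integrable_expDefect : Integrable (expDefect σ d) (gaussianReal 0 d) := by
  have h := fun n => integrable_pow_mul_exp_gaussianReal d (-σ) n
  exact ((((h 0).const_mul _).add ((h 1).const_mul _)).sub (integrable_const (1 : ℝ))).congr
    (ae_of_all _ fun w => (expDefect_eq σ w).symm)

theorem memLp_expFactor_sub_one :
    MemLp (fun w => expFactor σ d w - 1) 2 (gaussianReal 0 d) := by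
  rw [memLp_two_iff_integrable_sq
    ((measurable_expFactor σ d).sub_const 1).aestronglyMeasurable]
  exact ((((integrable_pow_mul_exp_gaussianReal d (-2 * σ) 0).const_mul _).sub
    ((integrable_pow_mul_exp_gaussianReal d (-σ) 0).const_mul _)).add
    (integrable_const (1 : ℝ))).congr (ae_of_all _ fun w => (sq_expFactor_sub_one σ w).symm)

theorem memLp_expDefect : MemLp (expDefect σ d) 2 (gaussianReal 0 d) := by
  rw [memLp_two_iff_integrable_sq (measurable_expDefect σ d).aestronglyMeasurable]
  have h := fun n => integrable_pow_mul_exp_gaussianReal d (-2 * σ) n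
  exact ((((((h 0).const_mul _).add ((h 1).const_mul _)).add ((h 2).const_mul _)).sub
    ((integrable_expDefect σ).const_mul 2)).sub (integrable_const (1 : ℝ))).congr
    (ae_of_all _ fun w => (sq_expDefect σ w).symm)

theorem integral_sq_expFactor_sub_one :
    ∫ w, (expFactor σ d w - 1) ^ 2 ∂gaussianReal 0 d
      = Real.exp (3 * (σ ^ 2 * d)) - 2 * Real.exp (σ ^ 2 * d) + 1 := by
  have h2 := (integrable_pow_mul_exp_gaussianReal d (-2 * σ) 0).const_mul (Real.exp (σ ^ 2 * d))
  have h1 := (integrable_pow_mul_exp_gaussianReal d (-σ) 0).const_mul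
    (2 * Real.exp (σ ^ 2 * d / 2))
  simp only [sq_expFactor_sub_one]
  rw [integral_add (h2.fun_sub h1) (integrable_const _), integral_sub h2 h1, integral_const_mul,
    integral_const_mul]
  simp only [pow_zero, one_mul, integral_exp_gaussianReal, integral_const, probReal_univ,
    smul_eq_mul, mul_one]
  rw [← Real.exp_add, mul_assoc, ← Real.exp_add]
  ring_nf

theorem integral_expDefect :
    ∫ w, expDefect σ d w ∂gaussianReal 0 d = Real.exp (σ ^ 2 * d) * (1 - σ ^ 2 * d) - 1 := by
  have h0 := (integrable_pow_mul_exp_gaussianReal d (-σ) 0).const_mul (Real.exp (σ ^ 2 * d / 2))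
  have h1 := (integrable_pow_mul_exp_gaussianReal d (-σ) 1).const_mul
    (σ * Real.exp (σ ^ 2 * d / 2))
  simp only [expDefect_eq]
  rw [integral_sub (h0.fun_add h1) (integrable_const _), integral_add h0 h1, integral_const_mul,
    integral_const_mul]
  simp only [pow_zero, one_mul, pow_one, integral_exp_gaussianReal, integral_mul_exp_gaussianReal,
    integral_const, probReal_univ, smul_eq_mul, mul_one]
  have e : Real.exp (σ ^ 2 * d) = Real.exp (σ ^ 2 * d / 2) * Real.exp (d * (-σ) ^ 2 / 2) := by
    rw [← Real.exp_add]; ring_nf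
  rw [e]
  ring

theorem integral_sq_expDefect :
    ∫ w, expDefect σ d w ^ 2 ∂gaussianReal 0 d
      = Real.exp (3 * (σ ^ 2 * d)) * (1 - 3 * (σ ^ 2 * d) + 4 * (σ ^ 2 * d) ^ 2)
        - 2 * Real.exp (σ ^ 2 * d) * (1 - σ ^ 2 * d) + 1 := by
  have h0 := (integrable_pow_mul_exp_gaussianReal d (-2 * σ) 0).const_mul (Real.exp (σ ^ 2 * d))
  have h1 := (integrable_pow_mul_exp_gaussianReal d (-2 * σ) 1).const_mul
    (2 * σ * Real.exp (σ ^ 2 * d))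
  have h2 := (integrable_pow_mul_exp_gaussianReal d (-2 * σ) 2).const_mul
    (σ ^ 2 * Real.exp (σ ^ 2 * d))
  have h3 := (integrable_expDefect σ (d := d)).const_mul 2
  simp only [sq_expDefect]
  rw [integral_sub (((h0.fun_add h1).fun_add h2).fun_sub h3) (integrable_const _),
    integral_sub ((h0.fun_add h1).fun_add h2) h3, integral_add (h0.fun_add h1) h2, integral_add h0 h1,
    integral_const_mul, integral_const_mul, integral_const_mul, integral_const_mul,
    integral_expDefect]
  simp only [pow_zero, one_mul, pow_one, integral_exp_gaussianReal, integral_mul_exp_gaussianReal,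
    integral_sq_mul_exp_gaussianReal, integral_const, probReal_univ, smul_eq_mul, mul_one]
  have e : Real.exp (3 * (σ ^ 2 * d))
      = Real.exp (σ ^ 2 * d) * Real.exp (d * (-2 * σ) ^ 2 / 2) := by
    rw [← Real.exp_add]; ring_nf
  rw [e]
  ring

variable {σ}

/-- The threshold `1 / 3` keeps `3 v` in the range where the quadratic remainder estimate for `exp`
holds. -/
theorem exp_bounds_of_le {v : ℝ} (h0 : 0 ≤ v) (h1 : v ≤ 1 / 3) :
    |Real.exp v - 1 - v| ≤ v ^ 2 ∧ |Real.exp (3 * v) - 1 - 3 * v| ≤ 9 * v ^ 2 := by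
  refine ⟨Real.abs_exp_sub_one_sub_id_le (abs_le.2 ⟨by linarith, by linarith⟩), ?_⟩
  have := Real.abs_exp_sub_one_sub_id_le (x := 3 * v) (abs_le.2 ⟨by linarith, by linarith⟩)
  linarith [this, mul_pow 3 v 2]

theorem integral_sq_expFactor_sub_one_le (h : σ ^ 2 * d ≤ 1 / 3) :
    ∫ w, (expFactor σ d w - 1) ^ 2 ∂gaussianReal 0 d ≤ 5 * (σ ^ 2 * d) := by
  have h0 : 0 ≤ σ ^ 2 * d := by positivity
  rw [integral_sq_expFactor_sub_one]
  obtain ⟨ha, hb⟩ := exp_bounds_of_le h0 h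
  generalize σ ^ 2 * (d : ℝ) = v at *
  rw [abs_le] at ha hb
  -- The integral is at most `v + 9 v² + 2 v²`, and `11 v² ≤ 4 v` because `v ≤ 1 / 3`.
  nlinarith

/-- The first-order terms cancel: with `exp v = 1 + v + a`, the mean is `a (1 - v) - v²`. This
cancellation is the role of the Itô correction `σ² d / 2` in the exponent. -/
theorem abs_integral_expDefect_le (h : σ ^ 2 * d ≤ 1 / 3) :
    |∫ w, expDefect σ d w ∂gaussianReal 0 d| ≤ 2 * (σ ^ 2 * d) ^ 2 := by
  have h0 : 0 ≤ σ ^ 2 * d := by positivity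
  rw [integral_expDefect]
  obtain ⟨ha, -⟩ := exp_bounds_of_le h0 h
  generalize σ ^ 2 * (d : ℝ) = v at *
  obtain ⟨a, hav⟩ : ∃ a, Real.exp v = 1 + v + a := ⟨Real.exp v - 1 - v, by ring⟩
  rw [hav] at ha ⊢
  rw [abs_le] at ha ⊢
  constructor <;> nlinarith

theorem integral_sq_expDefect_sub_integral_le (h : σ ^ 2 * d ≤ 1 / 3) :
    ∫ w, (expDefect σ d w - ∫ w, expDefect σ d w ∂gaussianReal 0 d) ^ 2 ∂gaussianReal 0 d
      ≤ 12 * (σ ^ 2 * d) ^ 2 := by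
  have h0 : 0 ≤ σ ^ 2 * d := by positivity
  have h1 : ∫ w, (expDefect σ d w - ∫ w, expDefect σ d w ∂gaussianReal 0 d) ^ 2 ∂gaussianReal 0 d
      ≤ ∫ w, expDefect σ d w ^ 2 ∂gaussianReal 0 d := by
    rw [← variance_eq_integral (measurable_expDefect σ d).aemeasurable]
    exact variance_le_expectation_sq (measurable_expDefect σ d).aestronglyMeasurable
  refine h1.trans ?_
  rw [integral_sq_expDefect]
  obtain ⟨ha, hb⟩ := exp_bounds_of_le h0 h
  generalize σ ^ 2 * (d : ℝ) = v at *
  obtain ⟨a, hav⟩ : ∃ a, Real.exp v = 1 + v + a := ⟨Real.exp v - 1 - v, by ring⟩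
  obtain ⟨b, hbv⟩ : ∃ b, Real.exp (3 * v) = 1 + 3 * v + b :=
    ⟨Real.exp (3 * v) - 1 - 3 * v, by ring⟩
  rw [hav] at ha ⊢
  rw [hbv] at hb ⊢
  rw [abs_le] at ha hb
  have hb1 : b * (1 - 3 * v + 4 * v ^ 2) ≤ 9 * v ^ 2 := by
    have : 0 ≤ 1 - 3 * v + 4 * v ^ 2 := by nlinarith
    nlinarith [mul_nonneg h0 (sub_nonneg.2 h), mul_nonneg (sq_nonneg v) h0]
  have ha1 : -(a * (1 - v)) ≤ v ^ 2 := by nlinarith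
  -- The second moment equals `-3 v² + 12 v³ + b (1 - 3 v + 4 v²) - 2 a (1 - v)`, which is at most
  -- `8 v² + 12 v³ ≤ 12 v²`.
  nlinarith [mul_nonneg (sq_nonneg v) (sub_nonneg.2 h)]

end ExponentialNoise

/-! ### Increments and paths of the Wiener process -/

namespace IsWienerFrom

variable {Ω : Type*} {mΩ : MeasurableSpace Ω} {P : Measure Ω} {𝓕 : Filtration ℝ mΩ} {t₀ : ℝ}
  {W : ℝ → Ω → ℝ}

theorem measurable_sub (hW : IsWienerFrom P 𝓕 t₀ W) {a b : ℝ} (ha : t₀ ≤ a) (hab : a ≤ b) :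
    Measurable[𝓕 b] (fun ω => W b ω - W a ω) := by
  have h1 := hW.adapted b (ha.trans hab)
  have h2 := (hW.adapted a ha).mono (𝓕.mono hab) le_rfl
  let _ := 𝓕 b
  exact h1.sub h2

theorem hasLaw_sub (hW : IsWienerFrom P 𝓕 t₀ W) {a b : ℝ} (ha : t₀ ≤ a) (hab : a ≤ b) :
    HasLaw (fun ω => W b ω - W a ω) (gaussianReal 0 (b - a).toNNReal) P := by
  have h := hW.brownian.hasLaw_sub (b - t₀).toNNReal (a - t₀).toNNReal
  have e : nndist ((b - t₀).toNNReal : ℝ) ((a - t₀).toNNReal : ℝ) = (b - a).toNNReal := by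
    rw [Real.coe_toNNReal _ (by linarith), Real.coe_toNNReal _ (by linarith)]
    ext
    rw [coe_nndist, Real.dist_eq, Real.coe_toNNReal _ (by linarith), sub_sub_sub_cancel_right,
      abs_of_nonneg (by linarith)]
  rw [← e]
  refine h.congr (ae_of_all _ fun ω => ?_)
  simp only [Pi.sub_apply]
  rw [Real.coe_toNNReal _ (by linarith), Real.coe_toNNReal _ (by linarith)]
  simp

theorem continuousOn (hW : IsWienerFrom P 𝓕 t₀ W) :
    ∀ᵐ ω ∂P, ContinuousOn (fun t => W t ω) (Ici t₀) := by
  filter_upwards [hW.brownian.cont] with ω hω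
  have h : Continuous fun t : ℝ => W (t₀ + (t - t₀).toNNReal) ω - W t₀ ω + W t₀ ω :=
    (hω.comp (by fun_prop : Continuous fun t : ℝ => (t - t₀).toNNReal)).add continuous_const
  refine h.continuousOn.congr fun t ht => ?_
  have ht' : t₀ ≤ t := ht
  simp only [Real.coe_toNNReal _ (sub_nonneg.2 ht')]
  simp

end IsWienerFrom

/-! ### Uniform grids, Riemann sums and drift defects -/

section Grid

open Filter Topology

/-- The `k`-th point of the uniform partition of `[a, b]` into `n` intervals. -/
noncomputable def grid (a b : ℝ) (n k : ℕ) : ℝ := a + k * ((b - a) / n)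

variable {a b : ℝ}

@[simp] theorem grid_zero (a b : ℝ) (n : ℕ) : grid a b n 0 = a := by simp [grid]

theorem grid_self (a b : ℝ) {n : ℕ} (hn : n ≠ 0) : grid a b n n = b := by
  have : (n : ℝ) ≠ 0 := Nat.cast_ne_zero.2 hn
  rw [grid]; field_simp; ring

theorem grid_succ_sub (a b : ℝ) (n k : ℕ) : grid a b n (k + 1) - grid a b n k = (b - a) / n := by
  simp only [grid]; push_cast; ring

theorem grid_mono (hab : a ≤ b) (n : ℕ) : Monotone (grid a b n) :=
  monotone_nat_of_le_succ fun k => by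
    have := grid_succ_sub a b n k
    have : 0 ≤ (b - a) / n := div_nonneg (sub_nonneg.2 hab) n.cast_nonneg
    linarith

theorem le_grid (hab : a ≤ b) (n k : ℕ) : a ≤ grid a b n k := by
  simpa using grid_mono hab n k.zero_le

theorem grid_le (hab : a ≤ b) {n k : ℕ} (hn : n ≠ 0) (hk : k ≤ n) : grid a b n k ≤ b := by
  simpa only [grid_self a b hn] using grid_mono hab n hk

theorem grid_mem (hab : a ≤ b) {n k : ℕ} (hn : n ≠ 0) (hk : k ≤ n) : grid a b n k ∈ Icc a b :=
  ⟨le_grid hab n k, grid_le hab hn hk⟩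

theorem Icc_grid_subset (hab : a ≤ b) {n k : ℕ} (hk : k < n) :
    Icc (grid a b n k) (grid a b n (k + 1)) ⊆ Icc a b :=
  Icc_subset_Icc (le_grid hab n k) (grid_le hab (by omega) (by omega))

/-- Used to pass between a coarse grid and its refinement. For `n = 0` both steps are zero by the
convention for division. -/
theorem grid_mul (a b : ℝ) (n : ℕ) {m : ℕ} (hm : m ≠ 0) (i : ℕ) :
    grid a b (n * m) (i * m) = grid a b n i := by
  have : (m : ℝ) ≠ 0 := Nat.cast_ne_zero.2 hm
  simp only [grid]; push_cast
  rcases eq_or_ne (n : ℝ) 0 with h | h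
  · simp [h]
  · field_simp

theorem eventually_abs_sub_le_of_continuousOn {f : ℝ → ℝ}
    (hf : ContinuousOn f (Icc a b)) {ε : ℝ} (hε : 0 < ε) :
    ∀ᶠ n : ℕ in atTop, ∀ u ∈ Icc a b, ∀ w ∈ Icc a b, |u - w| ≤ (b - a) / n → |f u - f w| ≤ ε := by
  have hu := isCompact_Icc.uniformContinuousOn_of_continuous hf
  obtain ⟨δ, hδ, h⟩ := Metric.uniformContinuousOn_iff.1 hu ε hε
  have ht : Tendsto (fun n : ℕ => (b - a) / n) atTop (𝓝 0) :=
    tendsto_const_div_atTop_nhds_zero_nat _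
  filter_upwards [ht.eventually_lt_const hδ] with n hn u hu w hw huw
  exact (h u hu w hw (huw.trans_lt hn)).le

theorem abs_sub_le_of_mem_Icc_grid {n i : ℕ} {u w : ℝ}
    (hu : u ∈ Icc (grid a b n i) (grid a b n (i + 1)))
    (hw : w ∈ Icc (grid a b n i) (grid a b n (i + 1))) : |u - w| ≤ (b - a) / n := by
  rw [← grid_succ_sub a b n i]
  exact abs_le.2 ⟨by linarith [hu.1, hw.2], by linarith [hu.2, hw.1]⟩

theorem intervalIntegrable_of_subset {f : ℝ → ℝ} (hf : ContinuousOn f (Icc a b)) {u w : ℝ}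
    (hu : u ∈ Icc a b) (hw : w ∈ Icc a b) : IntervalIntegrable f volume u w :=
  (hf.mono (by rw [← uIcc_of_le (hu.1.trans hu.2)] at *
               exact uIcc_subset_uIcc hu hw)).intervalIntegrable

theorem abs_intervalIntegral_le {f : ℝ → ℝ} {u w C : ℝ} (huw : u ≤ w)
    (h : ∀ r ∈ Icc u w, |f r| ≤ C) : |∫ r in u..w, f r| ≤ C * (w - u) := by
  have := intervalIntegral.norm_integral_le_of_norm_le_const (f := f) (a := u) (b := w) (C := C)
    fun r hr => h r (Ioc_subset_Icc_self (by rwa [uIoc_of_le huw] at hr))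
  rwa [abs_of_nonneg (sub_nonneg.2 huw)] at this

theorem tendsto_sum_grid_integral (hab : a ≤ b) {f : ℝ → ℝ} (hf : ContinuousOn f (Icc a b)) :
    Tendsto (fun n : ℕ => ∑ i ∈ Finset.range n, f (grid a b n (i + 1)) * ((b - a) / n)) atTop
      (𝓝 (∫ u in a..b, f u)) := by
  rw [Metric.tendsto_atTop']
  intro ε hε
  -- The summand `1` keeps the divisor positive when `a = b`.
  have hba : 0 < b - a + 1 := by linarith
  have h := (eventually_abs_sub_le_of_continuousOn hf
    (div_pos (half_pos hε) hba)).and (eventually_gt_atTop 0)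
  obtain ⟨N, hN⟩ := eventually_atTop.1 h
  refine ⟨N, fun n hn => ?_⟩
  obtain ⟨hmod, hn0⟩ := hN n hn.le
  have hn0' : n ≠ 0 := by omega
  have hnR : (n : ℝ) ≠ 0 := Nat.cast_ne_zero.2 hn0'
  have hsum : ∫ u in a..b, f u
      = ∑ i ∈ Finset.range n, ∫ u in grid a b n i..grid a b n (i + 1), f u := by
    rw [intervalIntegral.sum_integral_adjacent_intervals, grid_zero, grid_self _ _ hn0']
    intro k hk
    exact intervalIntegrable_of_subset hf (grid_mem hab hn0' (by omega))
      (grid_mem hab hn0' (by omega))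
  rw [hsum, Real.dist_eq, ← Finset.sum_sub_distrib]
  have hterm : ∀ i ∈ Finset.range n,
      |f (grid a b n (i + 1)) * ((b - a) / n)
        - ∫ u in grid a b n i..grid a b n (i + 1), f u| ≤ ε / 2 / (b - a + 1) * ((b - a) / n) := by
    intro i hi
    have hi' := Finset.mem_range.1 hi
    have hle := grid_mono hab n i.le_succ
    have hint : IntervalIntegrable f volume (grid a b n i) (grid a b n (i + 1)) :=
      intervalIntegrable_of_subset hf (grid_mem hab hn0' (by omega))
        (grid_mem hab hn0' (by omega))
    have e : f (grid a b n (i + 1)) * ((b - a) / n)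
        - ∫ u in grid a b n i..grid a b n (i + 1), f u
        = ∫ u in grid a b n i..grid a b n (i + 1), (f (grid a b n (i + 1)) - f u) := by
      rw [intervalIntegral.integral_sub intervalIntegrable_const hint,
        intervalIntegral.integral_const, grid_succ_sub, smul_eq_mul, mul_comm]
    rw [e, ← grid_succ_sub a b n i]
    refine abs_intervalIntegral_le hle fun u hu' => ?_
    exact hmod _ (grid_mem hab hn0' (by omega)) _ (Icc_grid_subset hab hi' hu')
      (abs_sub_le_of_mem_Icc_grid (right_mem_Icc.2 hle) hu')
  calc _ ≤ ∑ i ∈ Finset.range n, ε / 2 / (b - a + 1) * ((b - a) / n) :=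
        (Finset.abs_sum_le_sum_abs _ _).trans (Finset.sum_le_sum hterm)
    _ = ε / 2 * ((b - a) / (b - a + 1)) := by
        rw [Finset.sum_const, Finset.card_range, nsmul_eq_mul]; field_simp
    _ ≤ ε / 2 * 1 := by
        gcongr
        rw [div_le_one hba]; linarith
    _ < ε := by linarith

/-- The difference between the increment of `g x` over an interval `[u, w]` and
`g w` times the increment over `[u, w]` of `x - ∫ h x`. -/
noncomputable def driftDefect (g h x : ℝ → ℝ) (u w : ℝ) : ℝ :=
  g w * (∫ r in u..w, h r * x r) + (g w - g u) * x u

/-- Because `g' = -h g`, the defect is the integral over `[u, w]` of `h(r) (g(w) x(r) - g(r) x(u))`.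
Uniform continuity of `g` and `x` makes this integrand uniformly small, so the defect is of smaller
order than the mesh. -/
theorem eventually_abs_driftDefect_le (hab : a ≤ b) {g h x : ℝ → ℝ}
    (hg : ∀ u ∈ Icc a b, HasDerivAt g (-(h u * g u)) u) (hh : ContinuousOn h (Icc a b))
    (hx : ContinuousOn x (Icc a b)) {ε : ℝ} (hε : 0 < ε) :
    ∀ᶠ n : ℕ in atTop, ∀ i < n,
      |driftDefect g h x (grid a b n i) (grid a b n (i + 1))| ≤ ε * ((b - a) / n) := by
  have hgc : ContinuousOn g (Icc a b) := fun u hu => (hg u hu).continuousAt.continuousWithinAt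
  obtain ⟨Kh, hKh⟩ := isCompact_Icc.exists_bound_of_continuousOn hh
  obtain ⟨Kg, hKg⟩ := isCompact_Icc.exists_bound_of_continuousOn hgc
  obtain ⟨Kx, hKx⟩ := isCompact_Icc.exists_bound_of_continuousOn hx
  set K := |Kh| + |Kg| + |Kx| + 1 with hK
  have hKpos : 0 < K := by positivity
  have hKh' : ∀ u ∈ Icc a b, |h u| ≤ K := fun u hu =>
    (hKh u hu).trans (by rw [hK]; linarith [le_abs_self Kh, abs_nonneg Kg, abs_nonneg Kx])
  have hKg' : ∀ u ∈ Icc a b, |g u| ≤ K := fun u hu =>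
    (hKg u hu).trans (by rw [hK]; linarith [le_abs_self Kg, abs_nonneg Kh, abs_nonneg Kx])
  have hKx' : ∀ u ∈ Icc a b, |x u| ≤ K := fun u hu =>
    (hKx u hu).trans (by rw [hK]; linarith [le_abs_self Kx, abs_nonneg Kg, abs_nonneg Kh])
  -- The integrand is bounded by `K (K e + e K) = 2 K² e`.
  set e := ε / (2 * K ^ 2) with he
  have hepos : 0 < e := by positivity
  filter_upwards [eventually_abs_sub_le_of_continuousOn hgc hepos,
    eventually_abs_sub_le_of_continuousOn hx hepos] with n h1 h2 i hi
  have hn0 : n ≠ 0 := by omega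
  have hle := grid_mono hab n i.le_succ
  have hmi := grid_mem hab hn0 (by omega : i ≤ n)
  have hmi' := grid_mem hab hn0 (by omega : i + 1 ≤ n)
  set u := grid a b n i with hu
  set w := grid a b n (i + 1) with hw
  have hsub : Icc u w ⊆ Icc a b := Icc_grid_subset hab hi
  have hhg : ContinuousOn (fun r => -(h r * g r)) (Icc a b) := (hh.mul hgc).neg
  have i1 : IntervalIntegrable (fun r => h r * x r) volume u w :=
    intervalIntegrable_of_subset (hh.mul hx) hmi hmi'
  have i2 := intervalIntegrable_of_subset hhg hmi hmi'
  have hftc : g w - g u = ∫ r in u..w, -(h r * g r) := by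
    rw [intervalIntegral.integral_eq_sub_of_hasDerivAt (fun r hr => hg r (hsub ?_)) i2]
    rwa [uIcc_of_le hle] at hr
  have e1 : driftDefect g h x u w = ∫ r in u..w, h r * (g w * x r - g r * x u) := by
    rw [driftDefect, hftc, ← intervalIntegral.integral_const_mul,
      ← intervalIntegral.integral_mul_const, ← intervalIntegral.integral_add
        (i1.const_mul _) (i2.mul_const _)]
    refine intervalIntegral.integral_congr fun r _ => ?_
    ring
  rw [e1, ← grid_succ_sub a b n i, ← hu, ← hw]
  refine abs_intervalIntegral_le hle fun r hr' => ?_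
  have hra := hsub hr'
  have hx1 : |x r - x u| ≤ e :=
    h2 r hra u hmi (abs_sub_le_of_mem_Icc_grid hr' (left_mem_Icc.2 hle))
  have hg1 : |g w - g r| ≤ e :=
    h1 w hmi' r hra (abs_sub_le_of_mem_Icc_grid (right_mem_Icc.2 hle) hr')
  have e2 : h r * (g w * x r - g r * x u) = h r * (g w * (x r - x u) + (g w - g r) * x u) := by
    ring
  rw [e2, abs_mul]
  calc |h r| * |g w * (x r - x u) + (g w - g r) * x u| ≤ K * (K * e + e * K) := by
        refine mul_le_mul (hKh' r hra) ?_ (abs_nonneg _) hKpos.le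
        refine (abs_add_le _ _).trans (add_le_add ?_ ?_)
        · rw [abs_mul]; exact mul_le_mul (hKg' w hmi') hx1 (abs_nonneg _) hKpos.le
        · rw [abs_mul]; exact mul_le_mul hg1 (hKx' u hmi) (abs_nonneg _) hepos.le
    _ = ε := by rw [he]; field_simp; norm_num

/-- Sums of drift defects with bounded weights tend to zero. -/
theorem tendsto_sum_mul_driftDefect (hab : a ≤ b) {g h x : ℝ → ℝ}
    (hg : ∀ u ∈ Icc a b, HasDerivAt g (-(h u * g u)) u) (hh : ContinuousOn h (Icc a b))
    (hx : ContinuousOn x (Icc a b)) {z : ℝ → ℝ} (hz : ContinuousOn z (Icc a b)) :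
    Tendsto (fun n : ℕ => ∑ i ∈ Finset.range n, z (grid a b n (i + 1)) *
      driftDefect g h x (grid a b n i) (grid a b n (i + 1))) atTop (𝓝 0) := by
  obtain ⟨K, hK⟩ := isCompact_Icc.exists_bound_of_continuousOn hz
  rw [Metric.tendsto_atTop']
  intro ε hε
  have hc : 0 < ε / (2 * (|K| + 1) * (b - a + 1)) := by
    have : 0 < b - a + 1 := by linarith
    positivity
  have hba : 0 < b - a + 1 := by linarith
  obtain ⟨N, hN⟩ := eventually_atTop.1
    ((eventually_abs_driftDefect_le hab hg hh hx hc).and (eventually_gt_atTop 0))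
  refine ⟨N, fun n hn => ?_⟩
  obtain ⟨hd, hn0⟩ := hN n hn.le
  have hnR : (n : ℝ) ≠ 0 := Nat.cast_ne_zero.2 (by omega)
  rw [Real.dist_eq, sub_zero]
  calc _ ≤ ∑ i ∈ Finset.range n,
          (|K| + 1) * (ε / (2 * (|K| + 1) * (b - a + 1)) * ((b - a) / n)) := by
        refine (Finset.abs_sum_le_sum_abs _ _).trans (Finset.sum_le_sum fun i hi => ?_)
        have hi' := Finset.mem_range.1 hi
        rw [abs_mul]
        refine mul_le_mul ?_ (hd i hi') (abs_nonneg _) (by positivity)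
        exact (hK _ (grid_mem hab (by omega) (by omega))).trans
          ((le_abs_self K).trans (by linarith))
    _ = ε / 2 * ((b - a) / (b - a + 1)) := by
        rw [Finset.sum_const, Finset.card_range, nsmul_eq_mul]; field_simp
    _ ≤ ε / 2 * 1 := by
        gcongr
        rw [div_le_one hba]; linarith
    _ < ε := by linarith

end Grid

/-! ### Wiener integrals of deterministic functions -/

section GaussianNoise

open Filter Topology

variable {Ω : Type*} {mΩ : MeasurableSpace Ω} {P : Measure Ω}
  {𝓕 : Filtration ℝ mΩ} {t₀ : ℝ} {W : ℝ → Ω → ℝ}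

/-- Each new increment is independent of everything before it, so the characteristic function
acquires one Gaussian factor per step. The variable `Y` of the past is carried along so that the
same computation later yields independence. -/
theorem integral_cexp_sum_increments (hW : IsWienerFrom P 𝓕 t₀ W) {u : ℕ → ℝ} (hu : Monotone u)
    (hu0 : t₀ ≤ u 0) {Y : Ω → ℝ} (hY : Measurable[𝓕 (u 0)] Y) (c : ℕ → ℝ) (n : ℕ) :
    Measurable[𝓕 (u n)] (fun ω => Y ω + ∑ k ∈ Finset.range n, c k * (W (u (k + 1)) ω - W (u k) ω)) ∧
    ∫ ω, Complex.exp (((Y ω + ∑ k ∈ Finset.range n, c k * (W (u (k + 1)) ω - W (u k) ω) : ℝ) : ℂ)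
        * Complex.I) ∂P
      = (∫ ω, Complex.exp ((Y ω : ℂ) * Complex.I) ∂P) *
        Complex.exp ((-(∑ k ∈ Finset.range n, c k ^ 2 * (u (k + 1) - u k)) / 2 : ℝ) : ℂ) := by
  induction n with
  | zero => simpa using hY
  | succ n ih =>
    obtain ⟨hm, hi⟩ := ih
    set S : Ω → ℝ := fun ω => Y ω + ∑ k ∈ Finset.range n, c k * (W (u (k + 1)) ω - W (u k) ω)
    set w : Ω → ℝ := fun ω => W (u (n + 1)) ω - W (u n) ω with hw
    have hn0 : t₀ ≤ u n := hu0.trans (hu n.zero_le)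
    have hle := hu n.le_succ
    have hwm : Measurable[𝓕 (u (n + 1))] w := hW.measurable_sub hn0 hle
    have hwm' : Measurable w := hwm.mono (𝓕.le _) le_rfl
    have hind : IndepFun S w P := by
      rw [IndepFun_iff_Indep]
      exact indep_of_indep_of_le_left (hW.indep _ _ hn0 hle) hm.comap_le
    have hSm : Measurable S := hm.mono (𝓕.le _) le_rfl
    have hlaw := hW.hasLaw_sub hn0 hle
    have hφ : Measurable fun x : ℝ => Complex.exp ((x : ℂ) * Complex.I) := by fun_prop
    have hψ : Measurable fun x : ℝ => Complex.exp (((c n * x : ℝ) : ℂ) * Complex.I) := by fun_prop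
    have e : ∀ ω, Complex.exp (((Y ω + ∑ k ∈ Finset.range (n + 1),
        c k * (W (u (k + 1)) ω - W (u k) ω) : ℝ) : ℂ) * Complex.I)
        = Complex.exp ((S ω : ℂ) * Complex.I) * Complex.exp (((c n * w ω : ℝ) : ℂ) * Complex.I) := by
      intro ω
      rw [Finset.sum_range_succ, ← add_assoc, ← Complex.exp_add, ← add_mul, ← Complex.ofReal_add]
    have hcf : ∫ ω, Complex.exp (((c n * w ω : ℝ) : ℂ) * Complex.I) ∂P
        = Complex.exp ((-(c n ^ 2 * (u (n + 1) - u n)) / 2 : ℝ) : ℂ) := by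
      have h1 := hlaw.integral_comp (f := fun x : ℝ => Complex.exp (((c n * x : ℝ) : ℂ) * Complex.I))
        hψ.aestronglyMeasurable
      have h2 := charFun_gaussianReal (μ := 0) (v := (u (n + 1) - u n).toNNReal) (c n)
      rw [charFun_apply_real] at h2
      simp only [Function.comp_def] at h1
      rw [h1]
      simp only [Complex.ofReal_mul]
      rw [h2, Real.coe_toNNReal _ (sub_nonneg.2 hle)]
      congr 1
      push_cast
      ring
    refine ⟨?_, ?_⟩
    · simp only [Finset.sum_range_succ, ← add_assoc]
      have h1 : Measurable[𝓕 (u (n + 1))] S := hm.mono (𝓕.mono hle) le_rfl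
      let _ := 𝓕 (u (n + 1))
      exact h1.add (hwm.const_mul _)
    · simp only [e]
      have hmul : ∫ ω, Complex.exp ((S ω : ℂ) * Complex.I) *
          Complex.exp (((c n * w ω : ℝ) : ℂ) * Complex.I) ∂P
          = (∫ ω, Complex.exp ((S ω : ℂ) * Complex.I) ∂P) *
            ∫ ω, Complex.exp (((c n * w ω : ℝ) : ℂ) * Complex.I) ∂P :=
        (hind.comp hφ hψ).integral_fun_mul_eq_mul_integral
          (hφ.comp hSm).aestronglyMeasurable (hψ.comp hwm').aestronglyMeasurable
      rw [hmul, hi, hcf, mul_assoc, ← Complex.exp_add,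
        ← Complex.ofReal_add, Finset.sum_range_succ]
      congr 4
      ring

/-- An almost sure limit of Riemann sums `∑ f(v_{i+1}) (W(v_{i+1}) - W(v_i))` is Gaussian with
variance `∫ f²` and independent of the past. -/
theorem hasLaw_and_indepFun_of_tendsto_sum_increments [IsProbabilityMeasure P] (hW : IsWienerFrom P 𝓕 t₀ W) {a b : ℝ}
    (ha : t₀ ≤ a) (hab : a ≤ b) {f : ℝ → ℝ} (hf : ContinuousOn f (Icc a b)) {Y ξ : Ω → ℝ}
    (hY : Measurable[𝓕 a] Y) (hξ : Measurable ξ)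
    (hlim : ∀ᵐ ω ∂P, Tendsto (fun n : ℕ => ∑ i ∈ Finset.range n,
      f (grid a b n (i + 1)) * (W (grid a b n (i + 1)) ω - W (grid a b n i) ω)) atTop
      (𝓝 (ξ ω))) :
    HasLaw ξ (gaussianReal 0 (∫ u in a..b, f u ^ 2).toNNReal) P ∧ IndepFun Y ξ P := by
  have hYm : Measurable Y := hY.mono (𝓕.le _) le_rfl
  set V := ∫ u in a..b, f u ^ 2 with hV
  have hV0 : 0 ≤ V := intervalIntegral.integral_nonneg hab fun u _ => sq_nonneg _
  -- The joint characteristic function of `Y` and `ξ`: `p = 0` identifies the law of `ξ`, and the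
  -- factorisation for all `p`, `q` is independence.
  have key : ∀ p q : ℝ, ∫ ω, Complex.exp (((p * Y ω + q * ξ ω : ℝ) : ℂ) * Complex.I) ∂P
      = (∫ ω, Complex.exp (((p * Y ω : ℝ) : ℂ) * Complex.I) ∂P) *
        Complex.exp ((-(q ^ 2 * V) / 2 : ℝ) : ℂ) := by
    intro p q
    have hpY : Measurable[𝓕 a] (fun ω => p * Y ω) := by
      let _ := 𝓕 a
      exact hY.const_mul p
    have hstep := fun n : ℕ => integral_cexp_sum_increments hW (grid_mono hab n)
      (by simpa using ha) (Y := fun ω => p * Y ω) (by rw [grid_zero]; exact hpY)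
      (fun k => q * f (grid a b n (k + 1))) n
    have hR : Tendsto (fun n : ℕ => ∑ k ∈ Finset.range n, (q * f (grid a b n (k + 1))) ^ 2 *
        (grid a b n (k + 1) - grid a b n k)) atTop (𝓝 (q ^ 2 * V)) := by
      refine ((tendsto_sum_grid_integral hab (hf.pow 2)).const_mul (q ^ 2)).congr fun n => ?_
      rw [Finset.mul_sum]
      refine Finset.sum_congr rfl fun k _ => ?_
      rw [grid_succ_sub]
      simp only [Pi.pow_apply]
      ring
    have hR' : Tendsto (fun n : ℕ => (∫ ω, Complex.exp (((p * Y ω : ℝ) : ℂ) * Complex.I) ∂P) *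
        Complex.exp ((-(∑ k ∈ Finset.range n, (q * f (grid a b n (k + 1))) ^ 2 *
        (grid a b n (k + 1) - grid a b n k)) / 2 : ℝ) : ℂ)) atTop
        (𝓝 ((∫ ω, Complex.exp (((p * Y ω : ℝ) : ℂ) * Complex.I) ∂P) *
        Complex.exp ((-(q ^ 2 * V) / 2 : ℝ) : ℂ))) := by
      refine Tendsto.const_mul _ ?_
      have hc : Continuous fun x : ℝ => Complex.exp ((-x / 2 : ℝ) : ℂ) := by fun_prop
      exact (hc.tendsto _).comp hR
    have hL : Tendsto (fun n : ℕ => ∫ ω, Complex.exp (((p * Y ω + ∑ k ∈ Finset.range n,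
        q * f (grid a b n (k + 1)) * (W (grid a b n (k + 1)) ω - W (grid a b n k) ω) : ℝ) : ℂ)
          * Complex.I) ∂P) atTop
        (𝓝 (∫ ω, Complex.exp (((p * Y ω + q * ξ ω : ℝ) : ℂ) * Complex.I) ∂P)) := by
      refine tendsto_integral_of_dominated_convergence (fun _ => (1 : ℝ)) (fun n => ?_)
        (integrable_const _) (fun n => ae_of_all _ fun ω => ?_) ?_
      · have h1 := (hstep n).1.mono (𝓕.le _) le_rfl
        have hφ : Measurable fun x : ℝ => Complex.exp ((x : ℂ) * Complex.I) := by fun_prop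
        exact (hφ.comp h1).aestronglyMeasurable
      · rw [Complex.norm_exp_ofReal_mul_I]
      · filter_upwards [hlim] with ω hω
        have hc : Continuous fun x : ℝ => Complex.exp (((p * Y ω + q * x : ℝ) : ℂ) * Complex.I) := by
          fun_prop
        refine ((hc.tendsto _).comp hω).congr fun n => ?_
        simp only [Function.comp_def, Finset.mul_sum, mul_assoc]
    exact tendsto_nhds_unique hL (hR'.congr fun n => (hstep n).2.symm)
  have hchar : ∀ q : ℝ, charFun (P.map ξ) q = Complex.exp ((-(q ^ 2 * V) / 2 : ℝ) : ℂ) := by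
    intro q
    have h := key 0 q
    rw [charFun_apply_real, integral_map hξ.aemeasurable (by fun_prop)]
    simpa using h
  have hcharY : ∀ p : ℝ, charFun (P.map Y) p
      = ∫ ω, Complex.exp (((p * Y ω : ℝ) : ℂ) * Complex.I) ∂P := by
    intro p
    rw [charFun_apply_real, integral_map hYm.aemeasurable (by fun_prop)]
    simp
  refine ⟨⟨hξ.aemeasurable, ?_⟩, ?_⟩
  · have := Measure.isProbabilityMeasure_map hξ.aemeasurable (μ := P)
    refine Measure.ext_of_charFun (funext fun q => ?_)
    rw [hchar, charFun_gaussianReal, Real.coe_toNNReal _ hV0]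
    congr 1
    push_cast
    ring
  · rw [indepFun_iff_charFun_prod hYm.aemeasurable hξ.aemeasurable]
    intro t
    rw [hchar, hcharY, ← key, charFun_apply, integral_map (by fun_prop) (by fun_prop)]
    refine integral_congr_ae (ae_of_all _ fun ω => ?_)
    simp [WithLp.prod_inner_apply, mul_comm]

end GaussianNoise

/-! ### Noise part of a solution; additive noise -/

section Solutions

open Filter Topology

variable {Ω : Type*} {mΩ : MeasurableSpace Ω} {P : Measure Ω}
  {𝓕 : Filtration ℝ mΩ} {t₀ : ℝ} {W : ℝ → Ω → ℝ}

theorem IsItoIntegral.tendsToZeroInProb {H W : ℝ → Ω → ℝ} {s t : ℝ} {I : Ω → ℝ}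
    (h : IsItoIntegral P H W s t I) (hst : s ≤ t) :
    TendsToZeroInProb P
      (fun n ω => leftSum H W (grid s t (n + 1)) (n + 1) ω - I ω) := by
  intro ε hε
  rw [ENNReal.tendsto_nhds_zero]
  intro η hη
  obtain ⟨r, -, hrpos, hr⟩ : ∃ r : ℝ, 0 ≤ r ∧ 0 < ENNReal.ofReal r ∧ ENNReal.ofReal r < η :=
    ENNReal.lt_iff_exists_real_btwn.1 hη
  have hr0 : 0 < r := ENNReal.ofReal_pos.1 hrpos
  -- One number plays both roles in `IsItoIntegral`: it must be below `ε` as a deviation and below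
  -- `r` as a probability. The grids have `n + 1` cells because a grid with no cell does not end at
  -- `t` unless `s = t`.
  obtain ⟨δ, hδ, hI⟩ := h (min r ε) (lt_min hr0 hε)
  have ht : Tendsto (fun n : ℕ => (t - s) / (n + 1 : ℕ)) atTop (𝓝 0) :=
    (tendsto_const_div_atTop_nhds_zero_nat _).comp (tendsto_add_atTop_nat 1)
  filter_upwards [ht.eventually_lt_const hδ] with n hn
  refine (measure_mono fun ω hω => ?_).trans ((hI (n + 1) (grid s t (n + 1)) (grid_mono hst _)
    (grid_zero _ _ _) (grid_self _ _ n.succ_ne_zero) fun i _ => ?_).trans ?_)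
  · rw [mem_ofPred_eq] at hω ⊢
    exact (min_le_right _ _).trans hω
  · rw [grid_succ_sub]; exact hn.le
  · exact (ENNReal.ofReal_le_ofReal (min_le_left _ _)).trans hr.le

/-- For a constant integrand every left-endpoint sum telescopes to the same variable, and a constant
sequence that converges in probability equals its limit almost surely. -/
theorem IsItoIntegral.ae_eq_of_const {W : ℝ → Ω → ℝ} {σ s t : ℝ} {I : Ω → ℝ}
    (h : IsItoIntegral P (fun _ _ => σ) W s t I) (hst : s ≤ t) :
    ∀ᵐ ω ∂P, I ω = σ * (W t ω - W s ω) := by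
  have e : ∀ n ω, leftSum (fun _ _ => σ) W (grid s t (n + 1)) (n + 1) ω
      = σ * (W t ω - W s ω) := by
    intro n ω
    rw [leftSum, ← Finset.mul_sum, Finset.sum_range_sub (fun i => W (grid s t (n + 1) i) ω),
      grid_self _ _ n.succ_ne_zero, grid_zero]
  have h1 := h.tendsToZeroInProb hst
  simp only [e] at h1
  filter_upwards [h1.ae_eq_zero] with ω hω
  exact (sub_eq_zero.1 hω).symm

/-- The stochastic-integral part `X(t) - y - ∫_s^t h X` of a process with drift `h X`. -/
noncomputable def noisePart (h : ℝ → ℝ) (X : ℝ → Ω → ℝ) (s y u : ℝ) (ω : Ω) : ℝ :=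
  X u ω - y - ∫ r in s..u, h r * X r ω

theorem noisePart_sub {h : ℝ → ℝ} {X : ℝ → Ω → ℝ} {s T y u w : ℝ} {ω : Ω}
    (hh : ContinuousOn h (Icc s T)) (hX : ContinuousOn (fun r => X r ω) (Icc s T))
    (hu : u ∈ Icc s T) (hw : w ∈ Icc s T) :
    noisePart h X s y w ω - noisePart h X s y u ω
      = X w ω - X u ω - ∫ r in u..w, h r * X r ω := by
  have hc : ContinuousOn (fun r => h r * X r ω) (Icc s T) := hh.mul hX
  have hs : s ∈ Icc s T := left_mem_Icc.2 (hu.1.trans hu.2)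
  have := intervalIntegral.integral_interval_sub_left
    (intervalIntegrable_of_subset hc hs hw) (intervalIntegrable_of_subset hc hs hu)
  rw [noisePart, noisePart, ← this]
  ring

/-- An exact discrete product rule: all effects of the drift are collected in `driftDefect`. -/
theorem mul_sub_mul_eq_noisePart {g h : ℝ → ℝ} {X : ℝ → Ω → ℝ} {s T y u w : ℝ} {ω : Ω}
    (hh : ContinuousOn h (Icc s T)) (hX : ContinuousOn (fun r => X r ω) (Icc s T))
    (hu : u ∈ Icc s T) (hw : w ∈ Icc s T) :
    g w * X w ω - g u * X u ω
      = g w * (noisePart h X s y w ω - noisePart h X s y u ω)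
        + driftDefect g h (fun r => X r ω) u w := by
  rw [noisePart_sub hh hX hu hw, driftDefect]
  ring

/-- Only the individual `X r` are known to be measurable; almost sure continuity makes the integral
an almost sure limit of Riemann sums. -/
theorem aemeasurable_integral_mul {h : ℝ → ℝ} {X : ℝ → Ω → ℝ} {s T u w : ℝ}
    (hh : ContinuousOn h (Icc s T)) (hX : ∀ᵐ ω ∂P, ContinuousOn (fun r => X r ω) (Icc s T))
    (hXm : ∀ r ∈ Icc s T, Measurable (X r)) (hu : u ∈ Icc s T) (hw : w ∈ Icc s T) (huw : u ≤ w) :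
    AEMeasurable (fun ω => ∫ r in u..w, h r * X r ω) P := by
  have hsub : Icc u w ⊆ Icc s T := Icc_subset_Icc hu.1 hw.2
  refine aemeasurable_of_tendsto_metrizable_ae atTop
    (f := fun (n : ℕ) ω => ∑ i ∈ Finset.range n,
      h (grid u w n (i + 1)) * X (grid u w n (i + 1)) ω * ((w - u) / n)) (fun n => ?_) ?_
  · refine Measurable.aemeasurable (Finset.measurable_sum _ fun i hi => ?_)
    have hi' := Finset.mem_range.1 hi
    exact ((hXm _ (hsub (grid_mem huw (by omega) (by omega)))).const_mul _).mul_const _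
  · filter_upwards [hX] with ω hω
    exact tendsto_sum_grid_integral huw ((hh.mul hω).mono hsub)

theorem sum_grid_sub (f : ℝ → ℝ) (a b : ℝ) {n : ℕ} (hn : n ≠ 0) :
    ∑ i ∈ Finset.range n, (f (grid a b n (i + 1)) - f (grid a b n i)) = f b - f a := by
  rw [Finset.sum_range_sub (fun i => f (grid a b n i)), grid_self _ _ hn, grid_zero]

variable {g h : ℝ → ℝ} {σ s T y : ℝ} {X : ℝ → Ω → ℝ}

theorem tendsto_sum_increments_of_additive
    (hX : IsItoSolution P 𝓕 W (fun t x => h t * x) (fun _ _ => σ) s T y X)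
    (hg : ∀ u ∈ Icc s T, HasDerivAt g (-(h u * g u)) u) (hh : ContinuousOn h (Icc s T))
    {τ t : ℝ} (hτ : s ≤ τ) (hτt : τ ≤ t) (ht : t ≤ T) :
    ∀ᵐ ω ∂P, Tendsto (fun n : ℕ => ∑ i ∈ Finset.range n, σ * g (grid τ t n (i + 1)) *
      (W (grid τ t n (i + 1)) ω - W (grid τ t n i) ω)) atTop (𝓝 (g t * X t ω - g τ * X τ ω)) := by
  have hsub : Icc τ t ⊆ Icc s T := Icc_subset_Icc hτ ht
  have h1 : ∀ u ∈ Icc s T, ∀ᵐ ω ∂P, noisePart h X s y u ω = σ * (W u ω - W s ω) := fun u hu =>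
    (hX.equation u hu).ae_eq_of_const hu.1
  -- The exceptional null set of the equation depends on the time; all grids together have countably
  -- many points, so a single null set suffices.
  have h2 : ∀ᵐ ω ∂P, ∀ n i : ℕ, i ≤ n → n ≠ 0 →
      noisePart h X s y (grid τ t n i) ω = σ * (W (grid τ t n i) ω - W s ω) := by
    refine ae_all_iff.2 fun n => ae_all_iff.2 fun i => ?_
    by_cases hin : i ≤ n ∧ n ≠ 0
    · filter_upwards [h1 _ (hsub (grid_mem hτt hin.2 hin.1))] with ω hω _ _ using hω
    · exact ae_of_all _ fun ω h3 h4 => absurd ⟨h3, h4⟩ hin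
  filter_upwards [h2, hX.continuous] with ω h3 hc
  have h4 := tendsto_sum_mul_driftDefect hτt (fun u hu => hg u (hsub hu)) (hh.mono hsub)
    (hc.mono hsub) (z := fun _ => 1) continuousOn_const
  have h5 := h4.const_sub (g t * X t ω - g τ * X τ ω)
  rw [sub_zero] at h5
  refine h5.congr' ?_
  filter_upwards [eventually_gt_atTop 0] with n hn
  rw [← sum_grid_sub (fun r => g r * X r ω) τ t hn.ne', ← Finset.sum_sub_distrib]
  refine Finset.sum_congr rfl fun i hi => ?_
  have hi' := Finset.mem_range.1 hi
  rw [mul_sub_mul_eq_noisePart (y := y) hh hc (hsub (grid_mem hτt hn.ne' hi'.le))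
    (hsub (grid_mem hτt hn.ne' hi')), h3 n i hi'.le hn.ne', h3 n (i + 1) hi' hn.ne']
  ring

end Solutions

/-! ### Moments of functions of Wiener increments -/

section IncrementMoments

variable {Ω : Type*} {mΩ : MeasurableSpace Ω} {P : Measure Ω} {𝓕 : Filtration ℝ mΩ} {t₀ : ℝ}
  {W : ℝ → Ω → ℝ} {u w d σ : ℝ}

theorem ProbabilityTheory.HasLaw.memLp_comp {ξ : Ω → ℝ} {μ : Measure ℝ} (h : HasLaw ξ μ P)
    {f : ℝ → ℝ} {p : ℝ≥0∞} (hf : MemLp f p μ) : MemLp (fun ω => f (ξ ω)) p P := by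
  rw [← h.map_eq] at hf
  exact hf.comp_of_map h.aemeasurable

theorem ProbabilityTheory.HasLaw.integral_fun_comp {ξ : Ω → ℝ} {μ : Measure ℝ} (h : HasLaw ξ μ P)
    {f : ℝ → ℝ} (hf : Measurable f) : ∫ ω, f (ξ ω) ∂P = ∫ x, f x ∂μ :=
  h.integral_comp hf.aestronglyMeasurable

namespace IsWienerFrom

theorem indep_comp (hW : IsWienerFrom P 𝓕 t₀ W) (hu : t₀ ≤ u) (huw : u ≤ w) {f : ℝ → ℝ}
    (hf : Measurable f) :
    Indep (𝓕 u) (MeasurableSpace.comap (fun ω => f (W w ω - W u ω)) inferInstance) P := by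
  refine indep_of_indep_of_le_right (hW.indep u w hu huw) ?_
  exact (hf.comp (comap_measurable _)).comap_le

theorem hasLaw_sub' (hW : IsWienerFrom P 𝓕 t₀ W) (hu : t₀ ≤ u) (hd : w - u = d) (hd0 : 0 ≤ d) :
    HasLaw (fun ω => W w ω - W u ω) (gaussianReal 0 d.toNNReal) P := by
  rw [← hd]; exact hW.hasLaw_sub hu (by linarith)

theorem increment_moments (hW : IsWienerFrom P 𝓕 t₀ W) (hu : t₀ ≤ u) (hd : w - u = d)
    (hd0 : 0 ≤ d) :
    MemLp (fun ω => W w ω - W u ω) 2 P ∧ ∫ ω, W w ω - W u ω ∂P = 0 ∧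
      ∫ ω, (W w ω - W u ω) ^ 2 ∂P = d := by
  have h := hW.hasLaw_sub' hu hd hd0
  refine ⟨h.memLp_comp (memLp_id_gaussianReal' 2 (by simp)), ?_, ?_⟩
  · rw [h.integral_fun_comp (f := fun x => x) measurable_id, integral_id_gaussianReal]
  · rw [h.integral_fun_comp (f := fun x => x ^ 2) (by fun_prop)]
    have := integral_sq_mul_exp_gaussianReal d.toNNReal 0
    simpa [Real.coe_toNNReal _ hd0] using this

theorem expFactor_moments (hW : IsWienerFrom P 𝓕 t₀ W) (hu : t₀ ≤ u) (hd : w - u = d)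
    (hd0 : 0 ≤ d) (hσ : σ ^ 2 * d ≤ 1 / 3) :
    MemLp (fun ω => expFactor σ d (W w ω - W u ω) - 1) 2 P ∧
      ∫ ω, (expFactor σ d (W w ω - W u ω) - 1) ^ 2 ∂P ≤ 5 * (σ ^ 2 * d) := by
  have h := hW.hasLaw_sub' hu hd hd0
  lift d to ℝ≥0 using hd0
  rw [Real.toNNReal_coe] at h
  refine ⟨h.memLp_comp (memLp_expFactor_sub_one σ), ?_⟩
  have hm := measurable_expFactor σ d
  rw [h.integral_fun_comp (f := fun x => (expFactor σ d x - 1) ^ 2) (by fun_prop)]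
  exact integral_sq_expFactor_sub_one_le hσ

theorem expDefect_moments [IsProbabilityMeasure P] (hW : IsWienerFrom P 𝓕 t₀ W) (hu : t₀ ≤ u)
    (hd : w - u = d) (hd0 : 0 ≤ d) (hσ : σ ^ 2 * d ≤ 1 / 3) {m : ℝ}
    (hm : m = ∫ x, expDefect σ d x ∂gaussianReal 0 d.toNNReal) :
    MemLp (fun ω => expDefect σ d (W w ω - W u ω) - m) 2 P ∧
      ∫ ω, expDefect σ d (W w ω - W u ω) - m ∂P = 0 ∧
      ∫ ω, (expDefect σ d (W w ω - W u ω) - m) ^ 2 ∂P ≤ 12 * (σ ^ 2 * d) ^ 2 := by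
  have h := hW.hasLaw_sub' hu hd hd0
  lift d to ℝ≥0 using hd0
  rw [Real.toNNReal_coe] at h hm
  have hme := measurable_expDefect σ d
  have hL := h.memLp_comp (memLp_expDefect σ)
  refine ⟨hL.sub (memLp_const m), ?_, ?_⟩
  · rw [integral_sub (hL.integrable (by norm_num)) (integrable_const _), h.integral_fun_comp hme,
      ← hm]
    simp
  · rw [h.integral_fun_comp (f := fun x => (expDefect σ d x - m) ^ 2) (by fun_prop), hm]
    exact integral_sq_expDefect_sub_integral_le hσ

end IsWienerFrom

end IncrementMoments

/-! ### First moments of weighted block sums -/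

section BlockSums

open Filter Topology

variable {Ω : Type*} {mΩ : MeasurableSpace Ω} {P : Measure Ω}
  {𝓕 : Filtration ℝ mΩ} {t₀ : ℝ} {W : ℝ → Ω → ℝ}

theorem sum_range_mul (f : ℕ → ℝ) (n m : ℕ) :
    ∑ k ∈ Finset.range (n * m), f k
      = ∑ i ∈ Finset.range n, ∑ j ∈ Finset.range m, f (i * m + j) := by
  induction n with
  | zero => simp
  | succ n ih => rw [Nat.succ_mul, Finset.sum_range_add, ih, Finset.sum_range_succ]

theorem integral_abs_le_of_integral_sq_le [IsProbabilityMeasure P] {f : Ω → ℝ} (hf : MemLp f 2 P) {c D : ℝ} (hc : 0 < c)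
    (h : ∫ ω, f ω ^ 2 ∂P ≤ c ^ 2 * D) : ∫ ω, |f ω| ∂P ≤ c / 2 * (1 + D) := by
  calc ∫ ω, |f ω| ∂P ≤ ∫ ω, (c / 2 + f ω ^ 2 / (2 * c)) ∂P := by
        refine integral_mono (hf.integrable (by norm_num)).abs
          ((integrable_const _).add (hf.integrable_sq.div_const _)) fun ω => ?_
        have e : c / 2 + f ω ^ 2 / (2 * c) - |f ω| = (|f ω| - c) ^ 2 / (2 * c) := by
          rw [← sq_abs (f ω)]; field_simp; ring
        have : 0 ≤ (|f ω| - c) ^ 2 / (2 * c) := by positivity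
        simp only
        linarith
    _ = c / 2 + (∫ ω, f ω ^ 2 ∂P) / (2 * c) := by
        rw [integral_add (integrable_const _) (hf.integrable_sq.div_const _), integral_div (2 * c)]
        simp
    _ ≤ c / 2 + c ^ 2 * D / (2 * c) := by gcongr
    _ = c / 2 * (1 + D) := by field_simp

/-- Weighted arithmetic-geometric mean inequality. In the application `f` has second moment of order
`d` and `f'` of order `c² d`, so the weight `c` makes both terms of order `c d`. -/
theorem integral_abs_mul_le {f f' : Ω → ℝ} (hf : MemLp f 2 P) (hf' : MemLp f' 2 P) {c : ℝ}
    (hc : 0 < c) : ∫ ω, |f ω * f' ω| ∂P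
      ≤ c / 2 * ∫ ω, f ω ^ 2 ∂P + (∫ ω, f' ω ^ 2 ∂P) / (2 * c) := by
  rw [← integral_const_mul, ← integral_div, ← integral_add (hf.integrable_sq.const_mul _)
    (hf'.integrable_sq.div_const _)]
  refine integral_mono (hf.integrable_mul hf').abs
    ((hf.integrable_sq.const_mul _).add (hf'.integrable_sq.div_const _)) fun ω => ?_
  have e : c / 2 * f ω ^ 2 + f' ω ^ 2 / (2 * c) - |f ω| * |f' ω|
      = (c * |f ω| - |f' ω|) ^ 2 / (2 * c) := by
    rw [← sq_abs (f ω), ← sq_abs (f' ω)]; field_simp; ring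
  have : 0 ≤ (c * |f ω| - |f' ω|) ^ 2 / (2 * c) := by positivity
  simp only [abs_mul]
  linarith

/-- Sums of blocks of a bounded martingale transform of the Wiener increments on a grid with
`N M` intervals, each block multiplied by the factor `expFactor` of its own interval. -/
theorem integrable_and_integral_abs_blockSum_le [IsProbabilityMeasure P]
    (hW : IsWienerFrom P 𝓕 t₀ W) {a b c σ : ℝ}
    (ha : t₀ ≤ a) (hab : a ≤ b) (hc : 0 < c) {N M : ℕ} (hN : N ≠ 0) (hM : M ≠ 0)
    (hσ : σ ^ 2 * ((b - a) / N) ≤ 1 / 3) {K : ℕ → Ω → ℝ}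
    (hK : ∀ k < N * M, Measurable[𝓕 (grid a b (N * M) k)] (K k))
    (hKc : ∀ k < N * M, ∀ ω, |K k ω| ≤ c) :
    Integrable (fun ω => ∑ i ∈ Finset.range N,
      expFactor σ ((b - a) / N) (W (grid a b N (i + 1)) ω - W (grid a b N i) ω) *
      ∑ j ∈ Finset.range M, K (i * M + j) ω *
        (W (grid a b (N * M) (i * M + j + 1)) ω - W (grid a b (N * M) (i * M + j)) ω)) P ∧
    ∫ ω, |∑ i ∈ Finset.range N,
      expFactor σ ((b - a) / N) (W (grid a b N (i + 1)) ω - W (grid a b N i) ω) *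
      ∑ j ∈ Finset.range M, K (i * M + j) ω *
        (W (grid a b (N * M) (i * M + j + 1)) ω - W (grid a b (N * M) (i * M + j)) ω)| ∂P
      ≤ c / 2 * (1 + (b - a)) + c / 2 * ((5 * σ ^ 2 + 1) * (b - a)) := by
  have hmono := grid_mono hab (N * M)
  set p := grid a b (N * M) with hp
  set w : ℕ → Ω → ℝ := fun k ω => W (p (k + 1)) ω - W (p k) ω with hw
  have hpa : ∀ k, t₀ ≤ p k := fun k => ha.trans (le_grid hab _ k)
  have hNM : (N * M : ℕ) ≠ 0 := mul_ne_zero hN hM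
  have hNR : (N : ℝ) ≠ 0 := Nat.cast_ne_zero.2 hN
  have hMR : (M : ℝ) ≠ 0 := Nat.cast_ne_zero.2 hM
  have hdnn : 0 ≤ (b - a) / (N * M : ℕ) := div_nonneg (sub_nonneg.2 hab) (Nat.cast_nonneg _)
  have hmom := fun k => hW.increment_moments (hpa k) (grid_succ_sub a b (N * M) k) hdnn
  -- Stated for any run of consecutive fine cells: it serves a single block and the whole sum.
  have hgen : ∀ (q n : ℕ), q + n ≤ N * M →
      MemLp (fun ω => ∑ j ∈ Finset.range n, K (q + j) ω * w (q + j) ω) 2 P ∧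
      ∫ ω, (∑ j ∈ Finset.range n, K (q + j) ω * w (q + j) ω) ^ 2 ∂P
        ≤ c ^ 2 * (n * ((b - a) / (N * M : ℕ))) := by
    intro q n hqn
    have h := integral_sq_sum_mul_le (P := P) (𝓖 := fun j => 𝓕 (p (q + j)))
      (H := fun j => K (q + j)) (ξ := fun j => w (q + j)) (C := c)
      (v := fun _ => (b - a) / (N * M : ℕ))
      (fun i j hij => 𝓕.mono (hmono (by omega))) (fun j => 𝓕.le _) n
      (fun j hj => hK _ (by omega)) (fun j hj => hKc _ (by omega))
      (fun j _ => hW.measurable_sub (hpa _) (hmono (Nat.le_succ _)))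
      (fun j _ => (hmom _).1) (fun j _ => (hmom _).2.1) (fun j _ => (hmom _).2.2.le)
      (fun j _ => hW.indep _ _ (hpa _) (hmono (Nat.le_succ _)))
    refine ⟨h.2.1, h.2.2.trans_eq ?_⟩
    rw [Finset.sum_const, Finset.card_range, nsmul_eq_mul]
  set B : ℕ → Ω → ℝ := fun i ω => ∑ j ∈ Finset.range M, K (i * M + j) ω * w (i * M + j) ω with hB
  set R : ℕ → Ω → ℝ := fun i ω =>
    expFactor σ ((b - a) / N) (W (grid a b N (i + 1)) ω - W (grid a b N i) ω) - 1 with hR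
  have hblock : ∀ i < N, MemLp (B i) 2 P ∧ ∫ ω, B i ω ^ 2 ∂P ≤ c ^ 2 * ((b - a) / N) := by
    intro i hi
    have h := hgen (i * M) M (by nlinarith)
    refine ⟨h.1, h.2.trans_eq ?_⟩
    push_cast
    field_simp
  have hfac : ∀ i, MemLp (R i) 2 P ∧ ∫ ω, R i ω ^ 2 ∂P ≤ 5 * (σ ^ 2 * ((b - a) / N)) := fun i =>
    hW.expFactor_moments (ha.trans (le_grid hab _ i)) (grid_succ_sub a b N i)
      (div_nonneg (sub_nonneg.2 hab) N.cast_nonneg) hσ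
  have hall : MemLp (fun ω => ∑ k ∈ Finset.range (N * M), K k ω * w k ω) 2 P ∧
      ∫ ω, (∑ k ∈ Finset.range (N * M), K k ω * w k ω) ^ 2 ∂P ≤ c ^ 2 * (b - a) := by
    have h := hgen 0 (N * M) (by omega)
    simp only [zero_add] at h
    refine ⟨h.1, h.2.trans_eq ?_⟩
    push_cast
    field_simp
  -- A block factor looks ahead over its own cell, so the weighted sum is not a martingale
  -- transform. Writing the factor as `1 + R i` leaves one unweighted transform and `N` products,
  -- each with first absolute moment of order `c (b - a) / N`.
  have e : ∀ ω, ∑ i ∈ Finset.range N,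
      expFactor σ ((b - a) / N) (W (grid a b N (i + 1)) ω - W (grid a b N i) ω) *
      ∑ j ∈ Finset.range M, K (i * M + j) ω * (W (p (i * M + j + 1)) ω - W (p (i * M + j)) ω)
      = ∑ k ∈ Finset.range (N * M), K k ω * w k ω + ∑ i ∈ Finset.range N, R i ω * B i ω := by
    intro ω
    rw [sum_range_mul, ← Finset.sum_add_distrib]
    refine Finset.sum_congr rfl fun i _ => ?_
    simp only [hR, hB, hw]
    ring
  simp only [e]
  have hI1 : Integrable (fun ω => ∑ k ∈ Finset.range (N * M), K k ω * w k ω) P :=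
    hall.1.integrable (by norm_num)
  have hI2 : ∀ i ∈ Finset.range N, Integrable (fun ω => R i ω * B i ω) P := fun i hi =>
    (hfac i).1.integrable_mul (hblock i (Finset.mem_range.1 hi)).1
  have hI3 := integrable_finsetSum (Finset.range N) hI2
  refine ⟨hI1.add hI3, ?_⟩
  calc _ ≤ ∫ ω, (|∑ k ∈ Finset.range (N * M), K k ω * w k ω|
          + ∑ i ∈ Finset.range N, |R i ω * B i ω|) ∂P := by
        refine integral_mono (hI1.add hI3).abs
          (hI1.abs.add (integrable_finsetSum _ fun i hi => (hI2 i hi).abs)) fun ω => ?_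
        exact (abs_add_le _ _).trans (add_le_add le_rfl (Finset.abs_sum_le_sum_abs _ _))
    _ = ∫ ω, |∑ k ∈ Finset.range (N * M), K k ω * w k ω| ∂P
          + ∑ i ∈ Finset.range N, ∫ ω, |R i ω * B i ω| ∂P := by
        rw [integral_add hI1.abs (integrable_finsetSum _ fun i hi => (hI2 i hi).abs),
          integral_finsetSum _ fun i hi => (hI2 i hi).abs]
    _ ≤ c / 2 * (1 + (b - a))
          + ∑ i ∈ Finset.range N, c / 2 * ((5 * σ ^ 2 + 1) * ((b - a) / N)) := by
        refine add_le_add (integral_abs_le_of_integral_sq_le hall.1 hc hall.2)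
          (Finset.sum_le_sum fun i hi => ?_)
        have hb := hblock i (Finset.mem_range.1 hi)
        refine (integral_abs_mul_le (hfac i).1 hb.1 hc).trans ?_
        calc c / 2 * ∫ ω, R i ω ^ 2 ∂P + (∫ ω, B i ω ^ 2 ∂P) / (2 * c)
            ≤ c / 2 * (5 * (σ ^ 2 * ((b - a) / N))) + c ^ 2 * ((b - a) / N) / (2 * c) := by
              gcongr
              · exact (hfac i).2
              · exact hb.2
          _ = c / 2 * ((5 * σ ^ 2 + 1) * ((b - a) / N)) := by field_simp
    _ = _ := by
        rw [Finset.sum_const, Finset.card_range, nsmul_eq_mul]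
        field_simp

end BlockSums

/-! ### Multiplicative noise: discounting and refinement of grids -/

section LinearEquation

open Filter Topology

variable {Ω : Type*} {mΩ : MeasurableSpace Ω} {P : Measure Ω}
  {𝓕 : Filtration ℝ mΩ} {t₀ : ℝ} {W : ℝ → Ω → ℝ}

theorem TendsToZeroInProb.of_forall_notMem {f : ℕ → Ω → ℝ} {A : ℕ → Set Ω}
    (hA : Tendsto (fun N => P (A N)) atTop (𝓝 0))
    (h : ∀ ε : ℝ, 0 < ε → ∀ᶠ N in atTop, ∀ ω ∉ A N, |f N ω| < ε) : TendsToZeroInProb P f := by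
  intro ε hε
  refine tendsto_of_tendsto_of_tendsto_of_le_of_le' tendsto_const_nhds hA
    (Eventually.of_forall fun _ => zero_le) ?_
  filter_upwards [h ε hε] with N hN
  refine measure_mono fun ω hω => ?_
  by_contra hn
  exact absurd (hN ω hn) (not_lt.2 hω)

theorem TendsToZeroInProb.congr' {f f' : ℕ → Ω → ℝ} (hf : TendsToZeroInProb P f)
    (h : ∀ᶠ N in atTop, f N =ᵐ[P] f' N) : TendsToZeroInProb P f' := fun ε hε => by
  refine (hf ε hε).congr' ?_
  filter_upwards [h] with N hN
  refine measure_congr ?_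
  filter_upwards [hN] with ω hω
  exact congrArg (fun x : ℝ => ε ≤ |x|) hω

/-- `exp (-σ (W u - W s) + σ² (u - s) / 2)`, the inverse of the stochastic exponential of `σ W`
started at time `s`. -/
noncomputable def discount (σ : ℝ) (W : ℝ → Ω → ℝ) (s u : ℝ) (ω : Ω) : ℝ :=
  Real.exp (-σ * (W u ω - W s ω) + σ ^ 2 * (u - s) / 2)

theorem discount_mul_expFactor (σ : ℝ) (W : ℝ → Ω → ℝ) (s : ℝ) {u w d : ℝ} (hd : w - u = d)
    (ω : Ω) :
    discount σ W s u ω * expFactor σ d (W w ω - W u ω) = discount σ W s w ω := by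
  rw [discount, expFactor, discount, ← Real.exp_add, ← hd]
  congr 1
  ring

theorem measurable_discount (hW : IsWienerFrom P 𝓕 t₀ W) (σ : ℝ) {s u w : ℝ} (hs : t₀ ≤ s)
    (hu : s ≤ u) (huw : u ≤ w) : Measurable[𝓕 w] (discount σ W s u) := by
  have h := (hW.measurable_sub hs hu).mono (𝓕.mono huw) le_rfl
  let _ := 𝓕 w
  exact ((h.const_mul (-σ)).add_const _).exp

theorem continuousOn_discount (σ : ℝ) {s T : ℝ} {ω : Ω}
    (hc : ContinuousOn (fun u => W u ω) (Icc s T)) :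
    ContinuousOn (fun u => discount σ W s u ω) (Icc s T) := by
  unfold discount
  fun_prop

variable {σ s T t y : ℝ} {g h : ℝ → ℝ} {X : ℝ → Ω → ℝ}

/-- The sums over the sub-intervals are, in probability, close to the noise part, uniformly over
the points of a coarse grid. -/
theorem exists_refinement
    (hX : IsItoSolution P 𝓕 W (fun t x => h t * x) (fun _ x => σ * x) s T y X)
    (hst : s ≤ t) (htT : t ≤ T) {N : ℕ} (hN : N ≠ 0) {ε : ℝ} (hε : 0 < ε) :
    ∃ M : ℕ, M ≠ 0 ∧ ∀ i ∈ Finset.range (N + 1),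
      P {ω | ε ≤ |leftSum (fun u ω => σ * X u ω) W (grid s t (N * M)) (i * M) ω
        - noisePart h X s y (grid s t N i) ω|} ≤ ENNReal.ofReal ε := by
  have h1 : ∀ i ∈ Finset.range (N + 1), ∀ᶠ M : ℕ in atTop,
      P {ω | ε ≤ |leftSum (fun u ω => σ * X u ω) W (grid s t (N * M)) (i * M) ω
        - noisePart h X s y (grid s t N i) ω|} ≤ ENNReal.ofReal ε := by
    intro i hi
    have hi' := Finset.mem_range.1 hi
    have hm := grid_mem hst hN (by omega : i ≤ N)
    obtain ⟨δ, hδ, hI⟩ := hX.equation _ ⟨hm.1, hm.2.trans htT⟩ ε hε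
    have ht : Tendsto (fun M : ℕ => (t - s) / N / M) atTop (𝓝 0) :=
      tendsto_const_div_atTop_nhds_zero_nat _
    filter_upwards [ht.eventually_lt_const hδ, eventually_ne_atTop 0] with M hM hM0
    -- The first `i * M` cells of the fine grid partition the interval from `s` to the coarse point
    -- `i`. Only finitely many `i` occur, so one `M` works for all.
    refine hI (i * M) (grid s t (N * M)) (grid_mono hst _) (grid_zero _ _ _)
      (grid_mul _ _ _ hM0 _) fun j _ => ?_
    rw [grid_succ_sub, Nat.cast_mul, ← div_div]
    exact hM.le
  obtain ⟨M, hM, hM0⟩ := (((Finset.eventually_all _).2 h1).and (eventually_ne_atTop 0)).exists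
  exact ⟨M, hM0, hM⟩

/-- Over a coarse cell the stochastic integral is a fine left-endpoint sum up to approximation
errors at the two ends; subtracting the term with coefficient frozen at the left end leaves the
oscillation of `X` within the cell. -/
theorem noisePart_increment_eq (i N : ℕ) {M : ℕ} (hM : M ≠ 0) (ω : Ω) :
    noisePart h X s y (grid s t N (i + 1)) ω - noisePart h X s y (grid s t N i) ω
      - σ * X (grid s t N i) ω * (W (grid s t N (i + 1)) ω - W (grid s t N i) ω)
    = ∑ j ∈ Finset.range M, σ * (X (grid s t (N * M) (i * M + j)) ω - X (grid s t N i) ω) *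
        (W (grid s t (N * M) (i * M + j + 1)) ω - W (grid s t (N * M) (i * M + j)) ω)
      + ((leftSum (fun u ω => σ * X u ω) W (grid s t (N * M)) (i * M) ω
          - noisePart h X s y (grid s t N i) ω)
        - (leftSum (fun u ω => σ * X u ω) W (grid s t (N * M)) ((i + 1) * M) ω
          - noisePart h X s y (grid s t N (i + 1)) ω)) := by
  have h1 : leftSum (fun u ω => σ * X u ω) W (grid s t (N * M)) ((i + 1) * M) ω
      = leftSum (fun u ω => σ * X u ω) W (grid s t (N * M)) (i * M) ω
        + ∑ j ∈ Finset.range M, σ * X (grid s t (N * M) (i * M + j)) ω *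
        (W (grid s t (N * M) (i * M + j + 1)) ω - W (grid s t (N * M) (i * M + j)) ω) := by
    rw [leftSum, Nat.succ_mul, Finset.sum_range_add]; rfl
  have h2 : ∑ j ∈ Finset.range M,
      (W (grid s t (N * M) (i * M + j + 1)) ω - W (grid s t (N * M) (i * M + j)) ω)
      = W (grid s t N (i + 1)) ω - W (grid s t N i) ω := by
    have := Finset.sum_range_sub (fun j => W (grid s t (N * M) (i * M + j)) ω) M
    rw [add_zero, ← Nat.succ_mul, grid_mul _ _ _ hM, grid_mul _ _ _ hM] at this
    exact this
  have h3 : ∑ j ∈ Finset.range M, σ * (X (grid s t (N * M) (i * M + j)) ω - X (grid s t N i) ω) *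
        (W (grid s t (N * M) (i * M + j + 1)) ω - W (grid s t (N * M) (i * M + j)) ω)
      = ∑ j ∈ Finset.range M, σ * X (grid s t (N * M) (i * M + j)) ω *
        (W (grid s t (N * M) (i * M + j + 1)) ω - W (grid s t (N * M) (i * M + j)) ω)
        - σ * X (grid s t N i) ω * (W (grid s t N (i + 1)) ω - W (grid s t N i) ω) := by
    rw [← h2, Finset.mul_sum, ← Finset.sum_sub_distrib]
    exact Finset.sum_congr rfl fun j _ => by ring
  rw [h3, h1]
  ring

theorem measurableSet_exists_lt_abs {f : ℕ → Ω → ℝ} {n : ℕ} (hf : ∀ k < n, Measurable (f k))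
    (c : ℝ) : MeasurableSet {ω | ∃ k < n, c < |f k ω|} := by
  have e : {ω | ∃ k < n, c < |f k ω|} = ⋃ k ∈ Finset.range n, {ω | c < |f k ω|} := by
    ext ω; simp
  rw [e]
  exact Finset.measurableSet_biUnion _ fun k hk =>
    measurableSet_lt measurable_const (hf k (Finset.mem_range.1 hk)).abs

/-- The approximation errors of a sequence of refinements are negligible. -/
theorem tendsToZeroInProb_sum_refinement_error [IsProbabilityMeasure P] (hst : s ≤ t)
    {E : ℕ → ℕ → Ω → ℝ} {q : ℝ → Ω → ℝ} (hqm : ∀ u ∈ Icc s t, Measurable (q u))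
    (hq : ∀ᵐ ω ∂P, ContinuousOn (fun u => q u ω) (Icc s t))
    (hE : ∀ N : ℕ, N ≠ 0 → ∀ i ∈ Finset.range (N + 1),
      P {ω | 1 / ((N : ℝ) + 1) ^ 3 ≤ |E N i ω|} ≤ ENNReal.ofReal (1 / ((N : ℝ) + 1) ^ 3)) :
    TendsToZeroInProb P (fun N ω => ∑ i ∈ Finset.range N,
      q (grid s t N (i + 1)) ω * (E N i ω - E N (i + 1) ω)) := by
  -- The cube leaves room twice: the union of `N + 1` events has probability at most `1 / (N + 1)²`,
  -- and `N` terms with weight at most `N + 1` and error at most `2 / (N + 1)³` sum to at most `2 /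
  -- (N + 1)`.
  set A : ℕ → Set Ω := fun N => ⋃ i ∈ Finset.range (N + 1), {ω | 1 / ((N : ℝ) + 1) ^ 3 ≤ |E N i ω|}
  set B : ℕ → Set Ω := fun N => {ω | ∃ i < N, (N : ℝ) + 1 < |q (grid s t N (i + 1)) ω|}
  have hA : Tendsto (fun N => P (A N)) atTop (𝓝 0) := by
    have h1 : Tendsto (fun N : ℕ => ENNReal.ofReal (1 / ((N : ℝ) + 1))) atTop (𝓝 0) := by
      simpa using ENNReal.tendsto_ofReal (tendsto_one_div_add_atTop_nhds_zero_nat (𝕜 := ℝ))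
    refine tendsto_of_tendsto_of_tendsto_of_le_of_le' tendsto_const_nhds h1
      (Eventually.of_forall fun _ => zero_le) ?_
    filter_upwards [eventually_ne_atTop 0] with N hN
    refine (measure_biUnion_finset_le _ _).trans ((Finset.sum_le_sum (hE N hN)).trans ?_)
    rw [Finset.sum_const, Finset.card_range, nsmul_eq_mul, ← ENNReal.ofReal_natCast,
      ← ENNReal.ofReal_mul (Nat.cast_nonneg _)]
    refine ENNReal.ofReal_le_ofReal ?_
    push_cast
    have h1 : (1 : ℝ) ≤ (N : ℝ) + 1 := by linarith [(N.cast_nonneg : (0 : ℝ) ≤ N)]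
    rw [mul_one_div, div_le_div_iff₀ (by positivity) (by positivity)]
    nlinarith [mul_nonneg (sub_nonneg.2 h1) (sq_nonneg ((N : ℝ) + 1))]
  have hB : Tendsto (fun N => P (B N)) atTop (𝓝 0) := by
    refine tendsto_measure_zero_of_ae_eventually_notMem (fun N => ?_) ?_
    · exact measurableSet_exists_lt_abs
        (fun k hk => hqm _ (grid_mem hst (by omega) (by omega))) _
    · filter_upwards [hq] with ω hω
      obtain ⟨K, hK⟩ := isCompact_Icc.exists_bound_of_continuousOn hω
      filter_upwards [tendsto_natCast_atTop_atTop.eventually_ge_atTop K] with N hN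
      rintro ⟨i, hi, hlt⟩
      have := hK _ (grid_mem hst (by omega : N ≠ 0) (by omega : i + 1 ≤ N))
      rw [Real.norm_eq_abs] at this
      linarith
  have hAB : Tendsto (fun N => P (A N ∪ B N)) atTop (𝓝 0) := by
    have := hA.add hB
    rw [add_zero] at this
    exact tendsto_of_tendsto_of_tendsto_of_le_of_le tendsto_const_nhds this (fun _ => zero_le)
      fun N => measure_union_le _ _
  refine .of_forall_notMem hAB fun ε hε => ?_
  have h1 : Tendsto (fun N : ℕ => 2 * (1 / ((N : ℝ) + 1))) atTop (𝓝 0) := by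
    simpa using tendsto_one_div_add_atTop_nhds_zero_nat.const_mul (2 : ℝ)
  filter_upwards [h1.eventually_lt_const hε] with N hN ω hω
  simp only [A, B, mem_union, mem_iUnion, mem_ofPred_eq, not_or, not_exists, not_and, not_le,
    not_lt, Finset.mem_range] at hω
  refine lt_of_le_of_lt ?_ hN
  have hterm : ∀ i ∈ Finset.range N,
      |q (grid s t N (i + 1)) ω * (E N i ω - E N (i + 1) ω)|
        ≤ ((N : ℝ) + 1) * (2 * (1 / ((N : ℝ) + 1) ^ 3)) := by
    intro i hi
    have hi' := Finset.mem_range.1 hi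
    rw [abs_mul]
    refine mul_le_mul (hω.2 i hi') ?_ (abs_nonneg _) (by positivity)
    have h1 := hω.1 i (by omega)
    have h2 := hω.1 (i + 1) (by omega)
    have := abs_sub (E N i ω) (E N (i + 1) ω)
    linarith
  refine (Finset.abs_sum_le_sum_abs _ _).trans ((Finset.sum_le_sum hterm).trans ?_)
  rw [Finset.sum_const, Finset.card_range, nsmul_eq_mul]
  have e : (N : ℝ) * (((N : ℝ) + 1) * (2 * (1 / ((N : ℝ) + 1) ^ 3)))
      = 2 * (1 / ((N : ℝ) + 1)) * (N / ((N : ℝ) + 1)) := by field_simp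
  rw [e]
  refine mul_le_of_le_one_right (by positivity) ?_
  rw [div_le_one (by positivity)]
  linarith

end LinearEquation

/-! ### The error sums of the discrete product rule -/

section LinearEquationTerms

open Filter Topology

variable {Ω : Type*} {mΩ : MeasurableSpace Ω} {P : Measure Ω} [IsProbabilityMeasure P]
  {𝓕 : Filtration ℝ mΩ} {t₀ : ℝ} {W : ℝ → Ω → ℝ} {σ s t : ℝ} {g h : ℝ → ℝ} {X : ℝ → Ω → ℝ}

theorem eventually_sq_mul_div_le (σ d : ℝ) :
    ∀ᶠ N : ℕ in atTop, σ ^ 2 * (d / N) ≤ 1 / 3 := by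
  have : Tendsto (fun N : ℕ => σ ^ 2 * (d / N)) atTop (𝓝 0) := by
    simpa using (tendsto_const_div_atTop_nhds_zero_nat d).const_mul (σ ^ 2)
  exact (this.eventually_lt_const (by norm_num)).mono fun _ h => h.le

/-- The coefficients contain the oscillation of `X` over a coarse cell, which tends to zero
uniformly on almost every path. Truncating them at a small `c` therefore changes nothing outside an
event of vanishing probability, and the truncated sum has first moment of order `c`, whatever the
refinement `M`. -/
theorem tendsToZeroInProb_sum_blocks (hW : IsWienerFrom P 𝓕 t₀ W) (hs : t₀ ≤ s) (hst : s ≤ t)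
    (hXm : ∀ u ∈ Icc s t, Measurable[𝓕 u] (X u))
    (hXc : ∀ᵐ ω ∂P, ContinuousOn (fun u => X u ω) (Icc s t))
    (hg : ContinuousOn g (Icc s t)) {M : ℕ → ℕ} (hM : ∀ N, M N ≠ 0) :
    TendsToZeroInProb P (fun N ω => ∑ i ∈ Finset.range N,
      discount σ W s (grid s t N (i + 1)) ω * g (grid s t N (i + 1)) *
        ∑ j ∈ Finset.range (M N),
          σ * (X (grid s t (N * M N) (i * M N + j)) ω - X (grid s t N i) ω) *
            (W (grid s t (N * M N) (i * M N + j + 1)) ω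
              - W (grid s t (N * M N) (i * M N + j)) ω)) := by
  refine .of_forall_exists fun c₀ hc₀ => ?_
  have hd : 0 ≤ t - s := sub_nonneg.2 hst
  set C₀ := (1 + (t - s)) / 2 + (5 * σ ^ 2 + 1) * (t - s) / 2 with hC₀
  have hC₀pos : 0 < C₀ := by positivity
  set c := c₀ / C₀ with hc
  have hcpos : 0 < c := by positivity
  -- The quotient `k / M N` is the coarse cell of the fine index `k`. The discount is taken at the
  -- left end of that cell, which keeps the coefficient adapted; the missing `expFactor` is the
  -- block weight.
  set H : ℕ → ℕ → Ω → ℝ := fun N k ω => g (grid s t N (k / M N + 1)) *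
    (discount σ W s (grid s t N (k / M N)) ω *
      (σ * (X (grid s t (N * M N) k) ω - X (grid s t N (k / M N)) ω))) with hH
  set K : ℕ → ℕ → Ω → ℝ := fun N k ω => if |H N k ω| ≤ c then H N k ω else 0 with hK
  have hdiv : ∀ N k, k < N * M N → k / M N < N := fun N k hk =>
    Nat.div_lt_of_lt_mul (by rwa [mul_comm] at hk)
  have hcoarse_le : ∀ N k, grid s t N (k / M N) ≤ grid s t (N * M N) k := fun N k => by
    rw [← grid_mul s t N (hM N)]
    exact grid_mono hst _ (Nat.div_mul_le_self k _)
  have hle_coarse : ∀ N k, grid s t (N * M N) k ≤ grid s t N (k / M N + 1) := fun N k => by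
    rw [← grid_mul s t N (hM N) (k / M N + 1)]
    refine grid_mono hst _ ?_
    have := Nat.div_add_mod k (M N)
    have := Nat.mod_lt k (Nat.pos_of_ne_zero (hM N))
    nlinarith
  have hHm : ∀ N, ∀ k < N * M N, Measurable[𝓕 (grid s t (N * M N) k)] (H N k) := fun N k hk => by
    have hN : N ≠ 0 := by rintro rfl; simp at hk
    have h1 := measurable_discount hW σ hs (le_grid hst N (k / M N)) (hcoarse_le N k)
    have h2 := hXm _ (grid_mem hst (mul_ne_zero hN (hM N)) hk.le)
    have h3 := (hXm _ (grid_mem hst hN (hdiv N k hk).le)).mono (𝓕.mono (hcoarse_le N k)) le_rfl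
    let _ := 𝓕 (grid s t (N * M N) k)
    exact (h1.mul ((h2.sub h3).const_mul σ)).const_mul _
  have hKm : ∀ N, ∀ k < N * M N, Measurable[𝓕 (grid s t (N * M N) k)] (K N k) := fun N k hk => by
    have h1 := hHm N k hk
    let _ := 𝓕 (grid s t (N * M N) k)
    exact Measurable.ite (measurableSet_le h1.abs measurable_const) h1 measurable_const
  have hKc : ∀ N k ω, |K N k ω| ≤ c := fun N k ω => by
    simp only [hK]
    split_ifs with h1
    · exact h1
    · simpa using hcpos.le
  refine ⟨fun N => {ω | ∃ k < N * M N, c < |H N k ω|}, fun N ω => ∑ i ∈ Finset.range N,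
      expFactor σ ((t - s) / N) (W (grid s t N (i + 1)) ω - W (grid s t N i) ω) *
      ∑ j ∈ Finset.range (M N), K N (i * M N + j) ω *
        (W (grid s t (N * M N) (i * M N + j + 1)) ω - W (grid s t (N * M N) (i * M N + j)) ω),
    ?_, ?_, ?_⟩
  · refine tendsto_measure_zero_of_ae_eventually_notMem
      (fun N => measurableSet_exists_lt_abs (fun k hk => (hHm N k hk).mono (𝓕.le _) le_rfl) c) ?_
    obtain ⟨Kg, hKg⟩ := isCompact_Icc.exists_bound_of_continuousOn hg
    filter_upwards [hXc, hW.continuousOn] with ω hω hWc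
    have hZ := continuousOn_discount σ (hWc.mono fun u (hu : u ∈ Icc s t) => hs.trans hu.1)
    obtain ⟨Kz, hKz⟩ := isCompact_Icc.exists_bound_of_continuousOn hZ
    have he : 0 < c / ((|Kg| + 1) * ((|Kz| + 1) * (|σ| + 1))) := by positivity
    filter_upwards [eventually_abs_sub_le_of_continuousOn hω he] with N hN
    rintro ⟨k, hk, hlt⟩
    have hN0 : N ≠ 0 := by rintro rfl; simp at hk
    have hi := hdiv N k hk
    have b1 := hKg _ (grid_mem hst hN0 (by omega : k / M N + 1 ≤ N))
    have b2 := hKz _ (grid_mem hst hN0 hi.le)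
    have b3 := hN _ (grid_mem hst (mul_ne_zero hN0 (hM N)) hk.le) _ (grid_mem hst hN0 hi.le)
      (abs_sub_le_of_mem_Icc_grid ⟨hcoarse_le N k, hle_coarse N k⟩
        (left_mem_Icc.2 (grid_mono hst N (Nat.le_succ _))))
    rw [Real.norm_eq_abs] at b1 b2
    have : |H N k ω| ≤ (|Kg| + 1) * ((|Kz| + 1) * ((|σ| + 1) *
        (c / ((|Kg| + 1) * ((|Kz| + 1) * (|σ| + 1)))))) := by
      simp only [hH, abs_mul]
      gcongr
      · exact b1.trans ((le_abs_self _).trans (by linarith))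
      · exact b2.trans ((le_abs_self _).trans (by linarith))
      · linarith
    refine absurd this (not_le.2 (lt_of_eq_of_lt ?_ hlt))
    field_simp
  · filter_upwards [eventually_ne_atTop 0, eventually_sq_mul_div_le σ (t - s)] with N hN hσ
    have hb := integrable_and_integral_abs_blockSum_le hW hs hst hcpos hN (hM N) hσ (hKm N)
      (fun k _ => hKc N k)
    refine ⟨hb.1, hb.2.trans_eq ?_⟩
    have : c * C₀ = c₀ := by rw [hc]; field_simp
    rw [← this, hC₀]
    ring
  · intro N ω hω
    simp only [mem_ofPred_eq, not_exists, not_and, not_lt] at hω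
    refine Finset.sum_congr rfl fun i hi => ?_
    have hi' := Finset.mem_range.1 hi
    rw [← discount_mul_expFactor σ W s (grid_succ_sub s t N i) ω, Finset.mul_sum, Finset.mul_sum]
    refine Finset.sum_congr rfl fun j hj => ?_
    have hj' := Finset.mem_range.1 hj
    have hk : i * M N + j < N * M N := by nlinarith
    have hki : (i * M N + j) / M N = i := by
      rw [mul_comm, Nat.mul_add_div (Nat.pos_of_ne_zero (hM N)), Nat.div_eq_of_lt hj', add_zero]
    have hKH : K N (i * M N + j) ω = H N (i * M N + j) ω := if_pos (hω _ hk)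
    simp only [hKH, hH, hki]
    ring

/-- A pathwise estimate: `g` is Lipschitz, so the increments of `g` add up to a bounded total, and
each is multiplied by an increment of `W` that is uniformly small. -/
theorem tendsToZeroInProb_sum_coefficient_increment (hW : IsWienerFrom P 𝓕 t₀ W) (hs : t₀ ≤ s)
    (hst : s ≤ t) (hXm : ∀ u ∈ Icc s t, Measurable (X u))
    (hXc : ∀ᵐ ω ∂P, ContinuousOn (fun u => X u ω) (Icc s t))
    (hg : ∀ u ∈ Icc s t, HasDerivAt g (-(h u * g u)) u) (hh : ContinuousOn h (Icc s t)) :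
    TendsToZeroInProb P (fun N ω => ∑ i ∈ Finset.range N,
      discount σ W s (grid s t N (i + 1)) ω * (σ * X (grid s t N i) ω) *
        (g (grid s t N (i + 1)) - g (grid s t N i)) *
        (W (grid s t N (i + 1)) ω - W (grid s t N i) ω)) := by
  have hgc : ContinuousOn g (Icc s t) := fun u hu => (hg u hu).continuousAt.continuousWithinAt
  have hhg : ContinuousOn (fun r => -(h r * g r)) (Icc s t) := (hh.mul hgc).neg
  have hWm : ∀ u, s ≤ u → Measurable (W u) := fun u hu =>
    (hW.adapted u (hs.trans hu)).mono (𝓕.le _) le_rfl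
  refine .of_ae_tendsto (fun N => Measurable.aemeasurable
    (Finset.measurable_sum _ fun i hi => ?_)) ?_
  · have hi' := Finset.mem_range.1 hi
    have h1 : Measurable (discount σ W s (grid s t N (i + 1))) :=
      (measurable_discount hW σ hs (le_grid hst N (i + 1)) le_rfl).mono (𝓕.le _) le_rfl
    have h2 := hXm _ (grid_mem hst (by omega : N ≠ 0) hi'.le)
    have h3 := hWm _ (le_grid hst N (i + 1))
    have h4 := hWm _ (le_grid hst N i)
    fun_prop
  · obtain ⟨Kg, hKg⟩ := isCompact_Icc.exists_bound_of_continuousOn hhg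
    filter_upwards [hXc, hW.continuousOn] with ω hω hWc'
    have hWc := hWc'.mono fun u (hu : u ∈ Icc s t) => hs.trans hu.1
    have hZ := continuousOn_discount σ hWc
    obtain ⟨Kz, hKz⟩ := isCompact_Icc.exists_bound_of_continuousOn hZ
    obtain ⟨Kx, hKx⟩ := isCompact_Icc.exists_bound_of_continuousOn hω
    rw [Metric.tendsto_atTop']
    intro ε hε
    have hd : 0 ≤ t - s := sub_nonneg.2 hst
    set C := (|Kz| + 1) * (|σ| * (|Kx| + 1)) * (|Kg| + 1) * (t - s) + 1 with hC
    have hCpos : 0 < C := by positivity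
    obtain ⟨N₀, hN₀⟩ := eventually_atTop.1
      ((eventually_abs_sub_le_of_continuousOn hWc (div_pos (half_pos hε) hCpos)).and
        (eventually_ne_atTop 0))
    refine ⟨N₀, fun N hN => ?_⟩
    obtain ⟨hmod, hN0⟩ := hN₀ N hN.le
    have hNR : (N : ℝ) ≠ 0 := Nat.cast_ne_zero.2 hN0
    rw [Real.dist_eq, sub_zero]
    have hterm : ∀ i ∈ Finset.range N,
        |discount σ W s (grid s t N (i + 1)) ω * (σ * X (grid s t N i) ω) *
        (g (grid s t N (i + 1)) - g (grid s t N i)) *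
        (W (grid s t N (i + 1)) ω - W (grid s t N i) ω)| ≤
        (|Kz| + 1) * (|σ| * (|Kx| + 1)) * ((|Kg| + 1) * ((t - s) / N)) * (ε / 2 / C) := by
      intro i hi
      have hi' := Finset.mem_range.1 hi
      have hle := grid_mono hst N i.le_succ
      have hm := grid_mem hst hN0 hi'.le
      have hm' := grid_mem hst hN0 (by omega : i + 1 ≤ N)
      have hsub := Icc_grid_subset hst hi'
      have b1 := hKz _ hm'
      have b2 := hKx _ hm
      have b3 : |g (grid s t N (i + 1)) - g (grid s t N i)| ≤ (|Kg| + 1) * ((t - s) / N) := by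
        have hftc := intervalIntegral.integral_eq_sub_of_hasDerivAt
          (a := grid s t N i) (b := grid s t N (i + 1)) (f := g)
          (f' := fun r => -(h r * g r))
          (fun r hr => hg r (hsub (by rwa [uIcc_of_le hle] at hr)))
          (intervalIntegrable_of_subset hhg hm hm')
        rw [← hftc, ← grid_succ_sub s t N i]
        exact abs_intervalIntegral_le hle fun r hr =>
          (hKg r (hsub hr)).trans ((le_abs_self _).trans (by linarith))
      have b4 := hmod _ hm' _ hm
        (abs_sub_le_of_mem_Icc_grid (right_mem_Icc.2 hle) (left_mem_Icc.2 hle))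
      rw [Real.norm_eq_abs] at b1 b2
      simp only [abs_mul]
      gcongr
      · exact b1.trans ((le_abs_self _).trans (by linarith))
      · exact b2.trans ((le_abs_self _).trans (by linarith))
    refine (Finset.abs_sum_le_sum_abs _ _).trans_lt
      ((Finset.sum_le_sum hterm).trans_lt ?_)
    rw [Finset.sum_const, Finset.card_range, nsmul_eq_mul]
    have e : (N : ℝ) * ((|Kz| + 1) * (|σ| * (|Kx| + 1)) * ((|Kg| + 1) * ((t - s) / N)) *
        (ε / 2 / C)) = (ε / 2) * ((C - 1) / C) := by
      rw [hC]; field_simp; ring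
    rw [e]
    calc ε / 2 * ((C - 1) / C) ≤ ε / 2 * 1 := by
          gcongr
          rw [div_le_one hCpos]; linarith
      _ < ε := by linarith

/-- The defect is split into its mean, of order `1 / N²` and hence negligible over `N` cells, and a
centred part whose weighted sum is a martingale transform with increments of variance of order `1 /
N²`. -/
theorem tendsToZeroInProb_sum_defect (hW : IsWienerFrom P 𝓕 t₀ W) (hs : t₀ ≤ s) (hst : s ≤ t)
    {H : ℝ → Ω → ℝ} (hHm : ∀ u ∈ Icc s t, Measurable[𝓕 u] (H u))
    (hHc : ∀ᵐ ω ∂P, ContinuousOn (fun u => H u ω) (Icc s t)) :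
    TendsToZeroInProb P (fun N ω => ∑ i ∈ Finset.range N, H (grid s t N i) ω *
      expDefect σ ((t - s) / N) (W (grid s t N (i + 1)) ω - W (grid s t N i) ω)) := by
  have hd : 0 ≤ t - s := sub_nonneg.2 hst
  have hdN : ∀ N : ℕ, 0 ≤ (t - s) / N := fun N => div_nonneg hd N.cast_nonneg
  set m : ℕ → ℝ := fun N =>
    ∫ x, expDefect σ ((t - s) / N) x ∂gaussianReal 0 ((t - s) / N).toNNReal with hm
  have hmb : ∀ᶠ N : ℕ in atTop, |m N| ≤ 2 * (σ ^ 2 * ((t - s) / N)) ^ 2 := by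
    filter_upwards [eventually_sq_mul_div_le σ (t - s)] with N hN
    have := abs_integral_expDefect_le (σ := σ) (d := ((t - s) / N).toNNReal)
      (by rwa [Real.coe_toNNReal _ (hdN N)])
    rwa [Real.coe_toNNReal _ (hdN N)] at this
  have hHm' : ∀ N, ∀ i < N, Measurable (H (grid s t N i)) := fun N i hi =>
    (hHm _ (grid_mem hst (by omega) hi.le)).mono (𝓕.le _) le_rfl
  have hmean : TendsToZeroInProb P (fun N ω => ∑ i ∈ Finset.range N, H (grid s t N i) ω * m N) := by
    refine .of_ae_tendsto (fun N => Measurable.aemeasurable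
      (Finset.measurable_sum _ fun i hi => (hHm' N i (Finset.mem_range.1 hi)).mul_const _)) ?_
    filter_upwards [hHc] with ω hω
    obtain ⟨K, hK⟩ := isCompact_Icc.exists_bound_of_continuousOn hω
    have hlim : Tendsto (fun N : ℕ => K * (2 * (σ ^ 2 * (t - s)) ^ 2) / (N : ℝ)) atTop (𝓝 0) :=
      tendsto_const_div_atTop_nhds_zero_nat _
    refine squeeze_zero_norm' ?_ hlim
    filter_upwards [hmb, eventually_ne_atTop 0] with N hN hN0
    have hNR : (N : ℝ) ≠ 0 := Nat.cast_ne_zero.2 hN0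
    have hterm : ∀ i ∈ Finset.range N, ‖H (grid s t N i) ω * m N‖
        ≤ K * (2 * (σ ^ 2 * ((t - s) / N)) ^ 2) := fun i hi => by
      have b1 := hK _ (grid_mem hst hN0 (Finset.mem_range.1 hi).le)
      rw [norm_mul]
      exact mul_le_mul b1 hN (norm_nonneg _) ((norm_nonneg _).trans b1)
    refine (norm_sum_le _ _).trans ((Finset.sum_le_sum hterm).trans_eq ?_)
    rw [Finset.sum_const, Finset.card_range, nsmul_eq_mul]
    field_simp
  have hcent : TendsToZeroInProb P (fun N ω => ∑ i ∈ Finset.range N, H (grid s t N i) ω *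
      (expDefect σ ((t - s) / N) (W (grid s t N (i + 1)) ω - W (grid s t N i) ω) - m N)) := by
    refine .of_forall_exists fun c hc => ?_
    set q := 12 * (σ ^ 2 * (t - s)) ^ 2 + 1 with hq
    have hqpos : 0 < q := by positivity
    -- The truncation level tends to infinity, so that each bounded path is eventually untouched,
    -- yet `κ²` times the total variance, of order `1 / N`, stays below `c²`.
    set κ : ℕ → ℝ := fun N => √(c ^ 2 / q * N) with hκ
    set K : ℕ → ℕ → Ω → ℝ := fun N i ω =>
      if |H (grid s t N i) ω| ≤ κ N then H (grid s t N i) ω else 0 with hK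
    have hκlim : Tendsto κ atTop atTop :=
      Real.tendsto_sqrt_atTop.comp
        (tendsto_natCast_atTop_atTop.const_mul_atTop (by positivity))
    refine ⟨fun N => {ω | ∃ i < N, κ N < |H (grid s t N i) ω|}, fun N ω =>
      ∑ i ∈ Finset.range N, K N i ω *
        (expDefect σ ((t - s) / N) (W (grid s t N (i + 1)) ω - W (grid s t N i) ω) - m N),
      ?_, ?_, ?_⟩
    · refine tendsto_measure_zero_of_ae_eventually_notMem
        (fun N => measurableSet_exists_lt_abs (hHm' N) (κ N)) ?_
      filter_upwards [hHc] with ω hω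
      obtain ⟨C, hC⟩ := isCompact_Icc.exists_bound_of_continuousOn hω
      filter_upwards [hκlim.eventually_ge_atTop C] with N hN
      rintro ⟨i, hi, hlt⟩
      have := hC _ (grid_mem hst (by omega : N ≠ 0) hi.le)
      rw [Real.norm_eq_abs] at this
      linarith
    · filter_upwards [eventually_sq_mul_div_le σ (t - s), eventually_ne_atTop 0] with N hσ hN0
      have hNR : (N : ℝ) ≠ 0 := Nat.cast_ne_zero.2 hN0
      have hmom := fun i => hW.expDefect_moments (hs.trans (le_grid hst N i))
        (grid_succ_sub s t N i) (hdN N) hσ (m := m N) rfl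
      have hmo := grid_mono hst N
      have hme := measurable_expDefect σ ((t - s) / N)
      have hmain := integral_sq_sum_mul_le (P := P) (𝓖 := fun i => 𝓕 (grid s t N i))
        (H := K N) (ξ := fun i ω =>
          expDefect σ ((t - s) / N) (W (grid s t N (i + 1)) ω - W (grid s t N i) ω) - m N)
        (C := κ N) (v := fun _ => 12 * (σ ^ 2 * ((t - s) / N)) ^ 2)
        (fun i j hij => 𝓕.mono (hmo hij)) (fun i => 𝓕.le _) N
        (fun i hi => by
          have h1 := hHm _ (grid_mem hst hN0 hi.le)
          let _ := 𝓕 (grid s t N i)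
          exact Measurable.ite (measurableSet_le h1.abs measurable_const) h1 measurable_const)
        (fun i hi ω => by
          simp only [hK]
          split_ifs with h1
          · exact h1
          · rw [abs_zero]; exact Real.sqrt_nonneg _)
        (fun i _ => by
          have h1 := hW.measurable_sub (hs.trans (le_grid hst N i)) (hmo i.le_succ)
          exact (hme.comp h1).sub_const _)
        (fun i _ => (hmom i).1) (fun i _ => (hmom i).2.1) (fun i _ => (hmom i).2.2)
        (fun i _ => hW.indep_comp (hs.trans (le_grid hst N i)) (hmo i.le_succ)
          (f := fun x => expDefect σ ((t - s) / N) x - m N) (hme.sub_const _))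
      refine ⟨hmain.2.1.integrable (by norm_num), ?_⟩
      have hsq : κ N ^ 2 * ∑ _k ∈ Finset.range N, 12 * (σ ^ 2 * ((t - s) / N)) ^ 2 ≤ c ^ 2 * 1 := by
        rw [hκ, Real.sq_sqrt (by positivity), Finset.sum_const, Finset.card_range, nsmul_eq_mul]
        have e : c ^ 2 / q * (N : ℝ) * (N * (12 * (σ ^ 2 * ((t - s) / N)) ^ 2))
            = c ^ 2 * ((q - 1) / q) := by
          rw [hq]; field_simp; ring
        rw [e]
        gcongr
        rw [div_le_one hqpos]; linarith
      exact (integral_abs_le_of_integral_sq_le hmain.2.1 hc (hmain.2.2.trans hsq)).trans_eq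
        (by ring)
    · intro N ω hω
      simp only [mem_ofPred_eq, not_exists, not_and, not_lt] at hω
      refine Finset.sum_congr rfl fun i hi => ?_
      simp only [hK, if_pos (hω i (Finset.mem_range.1 hi))]
  refine (hmean.add hcent).congr fun N => ae_of_all _ fun ω => ?_
  simp only
  rw [← Finset.sum_add_distrib]
  exact Finset.sum_congr rfl fun i _ => by ring

end LinearEquationTerms

/-! ### Closed form of the solution with multiplicative noise -/

section LinearEquationSolution

open Filter Topology

variable {Ω : Type*} {mΩ : MeasurableSpace Ω} {P : Measure Ω} [IsProbabilityMeasure P]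
  {𝓕 : Filtration ℝ mΩ} {t₀ : ℝ} {W : ℝ → Ω → ℝ} {σ s T t y : ℝ} {g h : ℝ → ℝ} {X : ℝ → Ω → ℝ}

theorem tendsToZeroInProb_sum_noise (hW : IsWienerFrom P 𝓕 t₀ W) (hs : t₀ ≤ s)
    (hX : IsItoSolution P 𝓕 W (fun t x => h t * x) (fun _ x => σ * x) s T y X)
    (hg : ContinuousOn g (Icc s T)) (hst : s ≤ t) (htT : t ≤ T) :
    TendsToZeroInProb P (fun N ω => ∑ i ∈ Finset.range N,
      discount σ W s (grid s t N (i + 1)) ω * g (grid s t N (i + 1)) *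
        (noisePart h X s y (grid s t N (i + 1)) ω - noisePart h X s y (grid s t N i) ω
          - σ * X (grid s t N i) ω * (W (grid s t N (i + 1)) ω - W (grid s t N i) ω))) := by
  have hsub : Icc s t ⊆ Icc s T := Icc_subset_Icc le_rfl htT
  have hex : ∀ N : ℕ, ∃ M : ℕ, M ≠ 0 ∧ (N ≠ 0 → ∀ i ∈ Finset.range (N + 1),
      P {ω | 1 / ((N : ℝ) + 1) ^ 3 ≤ |leftSum (fun u ω => σ * X u ω) W (grid s t (N * M)) (i * M) ω
        - noisePart h X s y (grid s t N i) ω|} ≤ ENNReal.ofReal (1 / ((N : ℝ) + 1) ^ 3)) := by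
    intro N
    by_cases hN : N = 0
    · exact ⟨1, one_ne_zero, fun h => absurd hN h⟩
    · obtain ⟨M, hM, h⟩ := exists_refinement hX hst htT hN
        (by positivity : 0 < 1 / ((N : ℝ) + 1) ^ 3)
      exact ⟨M, hM, fun _ => h⟩
  choose M hM hE using hex
  have h1 := tendsToZeroInProb_sum_blocks (σ := σ) hW hs hst (fun u hu => hX.adapted u (hsub hu))
    (hX.continuous.mono fun ω hω => hω.mono hsub) (hg.mono hsub) hM
  have h2 := tendsToZeroInProb_sum_refinement_error hst
    (q := fun u ω => discount σ W s u ω * g u)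
    (fun u hu => ((measurable_discount hW σ hs hu.1 le_rfl).mono (𝓕.le _) le_rfl).mul_const _)
    (by
      filter_upwards [hW.continuousOn] with ω hω
      exact (continuousOn_discount σ (hω.mono fun u (hu : u ∈ Icc s t) => hs.trans hu.1)).mul
        (hg.mono hsub)) hE
  refine (h1.add h2).congr fun N => ae_of_all _ fun ω => ?_
  simp only
  rw [← Finset.sum_add_distrib]
  refine Finset.sum_congr rfl fun i _ => ?_
  rw [noisePart_increment_eq i N (hM N) ω]
  ring

/-- The solution of `dX = h X dt + σ X dW` in closed form. -/
theorem mul_discount_eq_of_linear (hW : IsWienerFrom P 𝓕 t₀ W) (hs : t₀ ≤ s)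
    (hX : IsItoSolution P 𝓕 W (fun t x => h t * x) (fun _ x => σ * x) s T y X)
    (hg : ∀ u ∈ Icc s T, HasDerivAt g (-(h u * g u)) u) (hh : ContinuousOn h (Icc s T))
    (hst : s ≤ t) (htT : t ≤ T) :
    ∀ᵐ ω ∂P, g t * X t ω * discount σ W s t ω = g s * y := by
  have hsub : Icc s t ⊆ Icc s T := Icc_subset_Icc le_rfl htT
  have hgc : ContinuousOn g (Icc s T) := fun u hu => (hg u hu).continuousAt.continuousWithinAt
  have hXm : ∀ u ∈ Icc s T, Measurable (X u) := fun u hu => (hX.adapted u hu).mono (𝓕.le _) le_rfl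
  have hXc : ∀ᵐ ω ∂P, ContinuousOn (fun u => X u ω) (Icc s t) :=
    hX.continuous.mono fun ω hω => hω.mono hsub
  have hZm : ∀ u, s ≤ u → Measurable[𝓕 u] (discount σ W s u) := fun u hu =>
    measurable_discount hW σ hs hu le_rfl
  have hZc : ∀ᵐ ω ∂P, ContinuousOn (fun u => discount σ W s u ω) (Icc s t) := by
    filter_upwards [hW.continuousOn] with ω hω
    exact continuousOn_discount σ (hω.mono fun u (hu : u ∈ Icc s t) => hs.trans hu.1)
  have h1 := tendsToZeroInProb_sum_noise hW hs hX hgc hst htT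
  have h2 := tendsToZeroInProb_sum_coefficient_increment (σ := σ) hW hs hst
    (fun u hu => hXm u (hsub hu)) hXc (fun u hu => hg u (hsub hu)) (hh.mono hsub)
  have h3 := tendsToZeroInProb_sum_defect (σ := σ) hW hs hst
    (H := fun u ω => discount σ W s u ω * (X u ω * g u))
    (fun u hu => by
      have h1 := hX.adapted u (hsub hu)
      have h2 := hZm u hu.1
      let _ := 𝓕 u
      exact h2.mul (h1.mul_const _))
    (by
      filter_upwards [hXc, hZc] with ω h1 h2
      exact h2.mul (h1.mul (hgc.mono hsub)))
  have h4 : TendsToZeroInProb P (fun N ω => ∑ i ∈ Finset.range N,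
      discount σ W s (grid s t N (i + 1)) ω *
        driftDefect g h (fun r => X r ω) (grid s t N i) (grid s t N (i + 1))) := by
    refine .of_ae_tendsto (fun N => Finset.aemeasurable_fun_sum _ fun i hi => ?_) ?_
    · have hi' := Finset.mem_range.1 hi
      have hm := hsub (grid_mem hst (by omega : N ≠ 0) hi'.le)
      have hm' := hsub (grid_mem hst (by omega : N ≠ 0) hi')
      have a1 := ((hZm _ hm'.1).mono (𝓕.le _) le_rfl).aemeasurable (μ := P)
      have a2 := aemeasurable_integral_mul hh hX.continuous hXm hm hm'
        (grid_mono hst N i.le_succ)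
      have a3 := (hXm _ hm).aemeasurable (μ := P)
      have a4 := (a2.const_mul (g (grid s t N (i + 1)))).add
        (a3.const_mul (g (grid s t N (i + 1)) - g (grid s t N i)))
      refine AEMeasurable.congr (a1.mul a4) (ae_of_all _ fun ω => ?_)
      simp only [Pi.mul_apply, Pi.add_apply, driftDefect]
    · filter_upwards [hXc, hZc] with ω hx hz
      exact tendsto_sum_mul_driftDefect hst (fun u hu => hg u (hsub hu)) (hh.mono hsub)
        (x := fun r => X r ω) hx (z := fun u => discount σ W s u ω) hz
  -- On each cell the four summands add up exactly to the increment of `g X` times the discount. The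
  -- telescoped total does not depend on `N`, so its convergence to zero forces it to vanish almost
  -- surely.
  have hconst : TendsToZeroInProb P
      (fun _ ω => g t * X t ω * discount σ W s t ω - g s * X s ω * discount σ W s s ω) := by
    refine (((h1.add h2).add h3).add h4).congr' ?_
    filter_upwards [eventually_ne_atTop 0] with N hN
    filter_upwards [hX.continuous] with ω hω
    rw [← sum_grid_sub (fun r => g r * X r ω * discount σ W s r ω) s t hN,
      ← Finset.sum_add_distrib, ← Finset.sum_add_distrib, ← Finset.sum_add_distrib]
    refine Finset.sum_congr rfl fun i hi => ?_
    have hi' := Finset.mem_range.1 hi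
    have e1 := mul_sub_mul_eq_noisePart (g := g) (y := y) hh hω
      (hsub (grid_mem hst hN hi'.le)) (hsub (grid_mem hst hN hi'))
    have e2 := discount_mul_expFactor σ W s (grid_succ_sub s t N i) ω
    rw [sub_eq_iff_eq_add] at e1
    rw [e1, expDefect, ← e2]
    ring
  filter_upwards [hconst.ae_eq_zero, hX.initial] with ω h1 h2
  have h3 : discount σ W s s ω = 1 := by simp [discount]
  simp only [Pi.zero_apply, h2, h3, mul_one] at h1
  linarith

theorem eq_mul_exp_of_linear (hW : IsWienerFrom P 𝓕 t₀ W) (hs : t₀ ≤ s)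
    (hX : IsItoSolution P 𝓕 W (fun t x => h t * x) (fun _ x => σ * x) s T y X)
    (hg : ∀ u ∈ Icc s T, HasDerivAt g (-(h u * g u)) u) (hh : ContinuousOn h (Icc s T))
    (hgpos : ∀ u ∈ Icc s T, 0 < g u) {τ : ℝ} (hτ : s ≤ τ) (hτt : τ ≤ t) (htT : t ≤ T) :
    ∀ᵐ ω ∂P, X t ω = X τ ω * (g τ / g t) *
      Real.exp (σ * (W t ω - W τ ω) - σ ^ 2 / 2 * (t - τ)) := by
  filter_upwards [mul_discount_eq_of_linear hW hs hX hg hh hτ (hτt.trans htT),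
    mul_discount_eq_of_linear hW hs hX hg hh (hτ.trans hτt) htT] with ω h1 h2
  have hgt := (hgpos t ⟨hτ.trans hτt, htT⟩).ne'
  have hZ : 0 < discount σ W s t ω := Real.exp_pos _
  have e : discount σ W s t ω * Real.exp (σ * (W t ω - W τ ω) - σ ^ 2 / 2 * (t - τ))
      = discount σ W s τ ω := by
    rw [discount, discount, ← Real.exp_add]
    congr 1
    ring
  rw [← e, ← h2] at h1
  have h3 : g τ * X τ ω * Real.exp (σ * (W t ω - W τ ω) - σ ^ 2 / 2 * (t - τ)) = g t * X t ω :=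
    mul_right_cancel₀ hZ.ne' (by linarith)
  calc X t ω = g t * X t ω / g t := by field_simp
    _ = _ := by rw [← h3]; ring

theorem pos_of_linear (hW : IsWienerFrom P 𝓕 t₀ W) (hs : t₀ ≤ s)
    (hX : IsItoSolution P 𝓕 W (fun t x => h t * x) (fun _ x => σ * x) s T y X)
    (hg : ∀ u ∈ Icc s T, HasDerivAt g (-(h u * g u)) u) (hh : ContinuousOn h (Icc s T))
    (hgpos : ∀ u ∈ Icc s T, 0 < g u) (hy : 0 < y) (hst : s ≤ t) (htT : t ≤ T) :
    ∀ᵐ ω ∂P, 0 < X t ω := by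
  filter_upwards [eq_mul_exp_of_linear hW hs hX hg hh hgpos le_rfl hst htT, hX.initial] with ω h1 h2
  rw [h1, h2]
  have := hgpos s ⟨le_rfl, hst.trans htT⟩
  have := hgpos t ⟨hst, htT⟩
  positivity

end LinearEquationSolution

/-! ### Conditional laws and moments of a function of the state and independent noise -/

section Conditioning

variable {Ω : Type*} {mΩ : MeasurableSpace Ω} {P : Measure Ω} [IsProbabilityMeasure P]
  {Y ξ Z : Ω → ℝ}

/-- By independence the law of `(Y, Φ(Y, ξ))` is the image of a product measure, and by Fubini its
section over `y` is the image of `ν` under `Φ y`. -/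
theorem hasCondDistrib_of_indepFun {ν : Measure ℝ} [IsProbabilityMeasure ν] (hY : Measurable Y)
    (hξ : HasLaw ξ ν P) (hind : IndepFun Y ξ P) {Φ : ℝ → ℝ → ℝ}
    (hΦ : Measurable fun q : ℝ × ℝ => Φ q.1 q.2) (hZ : ∀ᵐ ω ∂P, Z ω = Φ (Y ω) (ξ ω))
    {κ : Kernel ℝ ℝ} [IsSFiniteKernel κ] (hκ : ∀ᵐ y ∂P.map Y, κ y = ν.map (Φ y)) :
    HasCondDistrib Z Y κ P := by
  have hYξ : AEMeasurable (fun ω => (Y ω, ξ ω)) P := hY.aemeasurable.prodMk hξ.aemeasurable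
  have hΨ : Measurable fun q : ℝ × ℝ => (q.1, Φ q.1 q.2) := measurable_fst.prodMk hΦ
  have := Measure.isProbabilityMeasure_map hY.aemeasurable (μ := P)
  have hlaw : HasLaw (fun ω => (Y ω, Φ (Y ω) (ξ ω))) ((P.map Y) ⊗ₘ κ) P := by
    refine ⟨hΨ.comp_aemeasurable hYξ, ?_⟩
    have h1 : P.map (fun ω => (Y ω, Φ (Y ω) (ξ ω)))
        = (P.map fun ω => (Y ω, ξ ω)).map (fun q : ℝ × ℝ => (q.1, Φ q.1 q.2)) :=
      (AEMeasurable.map_map_of_aemeasurable hΨ.aemeasurable hYξ).symm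
    rw [h1, (indepFun_iff_map_prod_eq_prod_map_map hY.aemeasurable hξ.aemeasurable).1 hind,
      hξ.map_eq]
    ext A hA
    rw [Measure.map_apply hΨ hA, Measure.prod_apply (hΨ hA), Measure.compProd_apply hA]
    refine lintegral_congr_ae ?_
    filter_upwards [hκ] with y hy
    have hΦy : Measurable (Φ y) := hΦ.comp measurable_prodMk_left
    rw [hy, Measure.map_apply hΦy (measurable_prodMk_left hA)]
    rfl
  refine hlaw.congr ?_
  filter_upwards [hZ] with ω hω
  rw [hω]

theorem condExp_comap_of_indepFun {Y ξ : Ω → ℝ} (hY : Measurable Y) (hξ : Measurable ξ)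
    (hind : IndepFun Y ξ P) :
    P[ξ | MeasurableSpace.comap Y inferInstance] =ᵐ[P] fun _ => ∫ ω, ξ ω ∂P :=
  condExp_indep_eq hξ.comap_le hY.comap_le (comap_measurable ξ).stronglyMeasurable
    ((IndepFun_iff_Indep _ _ _).1 hind.symm)

/-- The known factors `Y` and `Y²` are pulled out of the conditional expectations of `Z` and `Z²`;
conditioning an independent variable gives its mean. -/
theorem condExp_and_condVar_of_eq_mul (hY : Measurable Y) (hξ : Measurable ξ)
    (hind : IndepFun Y ξ P) (hξ2 : MemLp ξ 2 P) (hZ2 : MemLp Z 2 P)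
    (hZ : ∀ᵐ ω ∂P, Z ω = Y ω * ξ ω) :
    P[Z | MeasurableSpace.comap Y inferInstance] =ᵐ[P] (fun ω => Y ω * ∫ ω, ξ ω ∂P) ∧
    Var[Z; P | MeasurableSpace.comap Y inferInstance] =ᵐ[P]
      fun ω => Y ω ^ 2 * (∫ ω, ξ ω ^ 2 ∂P - (∫ ω, ξ ω ∂P) ^ 2) := by
  have hYs : StronglyMeasurable[MeasurableSpace.comap Y inferInstance] Y :=
    (comap_measurable Y).stronglyMeasurable
  have hZ' : Z =ᵐ[P] fun ω => Y ω * ξ ω := hZ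
  have hsq : (Z ^ 2) =ᵐ[P] (Y ^ 2) * (fun ω => ξ ω ^ 2) := by
    filter_upwards [hZ] with ω hω
    simp only [Pi.pow_apply, Pi.mul_apply, hω, mul_pow]
  have h1 : P[Z | MeasurableSpace.comap Y inferInstance]
      =ᵐ[P] (fun ω => Y ω * ∫ ω, ξ ω ∂P) := by
    refine (condExp_congr_ae hZ').trans ((condExp_mul_of_stronglyMeasurable_left hYs
      ((hZ2.integrable (by norm_num)).congr hZ') (hξ2.integrable (by norm_num))).trans ?_)
    filter_upwards [condExp_comap_of_indepFun hY hξ hind] with ω hω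
    rw [Pi.mul_apply, hω]
  have h2 : P[Z ^ 2 | MeasurableSpace.comap Y inferInstance]
      =ᵐ[P] (fun ω => Y ω ^ 2 * ∫ ω, ξ ω ^ 2 ∂P) := by
    refine (condExp_congr_ae hsq).trans ((condExp_mul_of_stronglyMeasurable_left (hYs.pow 2)
      (hZ2.integrable_sq.congr hsq) hξ2.integrable_sq).trans ?_)
    filter_upwards [condExp_comap_of_indepFun hY (hξ.pow_const 2)
      (hind.comp measurable_id (measurable_id.pow_const 2))] with ω hω
    rw [Pi.mul_apply, hω, Pi.pow_apply]
  refine ⟨h1, ?_⟩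
  filter_upwards [condVar_ae_eq_condExp_sq_sub_sq_condExp hY.comap_le hZ2, h1, h2] with ω a b c
  rw [a, Pi.sub_apply, Pi.pow_apply, b, c]
  ring

theorem condExp_and_condVar_of_eq_add (hY : Measurable Y) (hξ : Measurable ξ)
    (hind : IndepFun Y ξ P) (hY2 : MemLp Y 2 P) (hξ2 : MemLp ξ 2 P) (hξ0 : ∫ ω, ξ ω ∂P = 0) {a : ℝ}
    (hZ : ∀ᵐ ω ∂P, Z ω = Y ω * a + ξ ω) :
    P[Z | MeasurableSpace.comap Y inferInstance] =ᵐ[P] (fun ω => Y ω * a) ∧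
    Var[Z; P | MeasurableSpace.comap Y inferInstance] =ᵐ[P] fun _ => ∫ ω, ξ ω ^ 2 ∂P := by
  have hYs : StronglyMeasurable[MeasurableSpace.comap Y inferInstance] (fun ω => Y ω * a) :=
    ((comap_measurable Y).mul_const a).stronglyMeasurable
  have hZ' : Z =ᵐ[P] (fun ω => Y ω * a) + ξ := hZ
  have hYi : Integrable (fun ω => Y ω * a) P := (hY2.integrable (by norm_num)).mul_const a
  have hξi : Integrable ξ P := hξ2.integrable (by norm_num)
  have h1 : P[Z | MeasurableSpace.comap Y inferInstance] =ᵐ[P] (fun ω => Y ω * a) := by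
    refine (condExp_congr_ae hZ').trans ((condExp_add hYi hξi _).trans ?_)
    filter_upwards [condExp_comap_of_indepFun hY hξ hind] with ω hω
    rw [Pi.add_apply, hω, condExp_of_stronglyMeasurable hY.comap_le hYs hYi, hξ0, add_zero]
  refine ⟨h1, ?_⟩
  have h2 : (Z - P[Z | MeasurableSpace.comap Y inferInstance]) ^ 2 =ᵐ[P] fun ω => ξ ω ^ 2 := by
    filter_upwards [h1, hZ] with ω b c
    rw [Pi.pow_apply, Pi.sub_apply, b, c, add_sub_cancel_left]
  exact (condExp_congr_ae h2).trans (condExp_comap_of_indepFun hY (hξ.pow_const 2)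
    (hind.comp measurable_id (measurable_id.pow_const 2)))

end Conditioning

/-! ### Lognormal and Gaussian densities as image laws -/

section Densities

theorem gaussianReal_map_exp (m : ℝ) {v : ℝ≥0} (hv : v ≠ 0) :
    (gaussianReal m v).map Real.exp = volume.withDensity (fun x => ENNReal.ofReal
      (if 0 < x then 1 / (x * √(2 * Real.pi * v)) *
        Real.exp (-(Real.log x - m) ^ 2 / (2 * v)) else 0)) := by
  set f : ℝ → ℝ := fun x => if 0 < x then 1 / (x * √(2 * Real.pi * v)) *
        Real.exp (-(Real.log x - m) ^ 2 / (2 * v)) else 0 with hf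
  ext A hA
  have hpre : MeasurableSet (Real.exp ⁻¹' A) := Real.measurable_exp hA
  -- The density vanishes off the positive half-line, so only `A ∩ Ioi 0` matters, and this is an
  -- injective image under `exp`. The Jacobian `exp x` then cancels the factor `1 / x` of the
  -- lognormal density.
  have himg : Real.exp '' (Real.exp ⁻¹' A) = A ∩ Ioi 0 := by
    rw [image_preimage_eq_inter_range, Real.range_exp]
  rw [Measure.map_apply Real.measurable_exp hA, gaussianReal_apply m hv, withDensity_apply _ hA]
  have h1 : ∫⁻ x in A, ENNReal.ofReal (f x) = ∫⁻ x in A ∩ Ioi 0, ENNReal.ofReal (f x) := by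
    rw [← lintegral_indicator hA, ← lintegral_indicator (hA.inter measurableSet_Ioi)]
    refine lintegral_congr fun x => ?_
    by_cases hx : 0 < x
    · by_cases hxA : x ∈ A <;> simp [indicator, hx, hxA]
    · have : f x = 0 := by simp only [hf, if_neg hx]
      by_cases hxA : x ∈ A <;> simp [indicator, hxA, hx, this]
  rw [h1, ← himg, lintegral_image_eq_lintegral_abs_deriv_mul hpre
    (fun x _ => (Real.hasDerivAt_exp x).hasDerivWithinAt) Real.exp_injective.injOn]
  refine lintegral_congr fun x => ?_
  rw [gaussianPDF, ← ENNReal.ofReal_mul (abs_nonneg _), abs_of_pos (Real.exp_pos x)]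
  simp only [hf, if_pos (Real.exp_pos x), Real.log_exp, gaussianPDFReal]
  congr 1
  have := (Real.exp_pos x).ne'
  field_simp

end Densities

namespace GrowthParams

variable {G : GrowthParams}

theorem withDensity_fG {σ t τ : ℝ} (hV : 0 < G.VG σ t τ) (y : ℝ) :
    volume.withDensity (fun x => ENNReal.ofReal (G.fG σ x t y τ))
      = gaussianReal (G.MG t y τ) (G.VG σ t τ).toNNReal := by
  have hV' : (G.VG σ t τ).toNNReal ≠ 0 := by simpa using hV
  rw [gaussianReal_of_var_ne_zero _ hV']
  congr 1
  ext x
  rw [gaussianPDF, gaussianPDFReal, fG, Real.coe_toNNReal _ hV.le, one_div]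

/-- True for every real `y`: for `y ≤ 0` the value that `Real.log` assigns only fixes some location
parameter. Thus the kernel is an image law everywhere, although the process visits only positive
states. -/
theorem withDensity_fL {σ t τ : ℝ} (hσ : 0 < σ) (hτt : τ < t) (y : ℝ) :
    volume.withDensity (fun x => ENNReal.ofReal (G.fL σ x t y τ))
      = (gaussianReal 0 (t - τ).toNNReal).map (fun w => Real.exp (σ * w + G.ML σ t y τ)) := by
  have hv : 0 < σ ^ 2 * (t - τ) := mul_pos (pow_pos hσ 2) (sub_pos.2 hτt)
  set v : ℝ≥0 := NNReal.mk (σ ^ 2) (sq_nonneg σ) * (t - τ).toNNReal with hvdef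
  have hvc : (v : ℝ) = σ ^ 2 * (t - τ) := by
    rw [hvdef, NNReal.coe_mul, Real.coe_toNNReal _ (sub_nonneg.2 hτt.le)]; rfl
  have hv0 : v ≠ 0 := by
    intro h
    rw [h] at hvc
    exact hv.ne hvc
  have e : (fun w => Real.exp (σ * w + G.ML σ t y τ))
      = Real.exp ∘ (fun w => w + G.ML σ t y τ) ∘ (fun w => σ * w) := rfl
  rw [e, ← Measure.map_map (by fun_prop) (by fun_prop), ← Measure.map_map (by fun_prop) (by fun_prop),
    gaussianReal_map_const_mul, gaussianReal_map_add_const, mul_zero, zero_add, ← hvdef,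
    gaussianReal_map_exp _ hv0, hvc]
  rfl

theorem measurable_fL (σ t τ : ℝ) : Measurable fun q : ℝ × ℝ => G.fL σ q.2 t q.1 τ := by
  unfold fL ML
  refine Measurable.ite (measurableSet_lt measurable_const measurable_snd) ?_ measurable_const
  fun_prop

theorem measurable_fG (σ t τ : ℝ) : Measurable fun q : ℝ × ℝ => G.fG σ q.2 t q.1 τ := by
  unfold fG MG
  fun_prop

end GrowthParams

theorem hasTransitionDensity_of_indepFun {Ω : Type*} {mΩ : MeasurableSpace Ω} {P : Measure Ω}
    [IsProbabilityMeasure P] {X : ℝ → Ω → ℝ} {τ t : ℝ} {f : ℝ → ℝ → ℝ} {ξ : Ω → ℝ}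
    {ν : Measure ℝ} [IsProbabilityMeasure ν]
    (hf : Measurable (fun q : ℝ × ℝ => f q.2 q.1)) (hX : Measurable (X τ)) (hξ : HasLaw ξ ν P)
    (hind : IndepFun (X τ) ξ P) {Φ : ℝ → ℝ → ℝ} (hΦ : Measurable fun q : ℝ × ℝ => Φ q.1 q.2)
    (hXt : ∀ᵐ ω ∂P, X t ω = Φ (X τ ω) (ξ ω))
    (hκ : ∀ y, volume.withDensity (fun x => ENNReal.ofReal (f x y)) = ν.map (Φ y)) :
    HasTransitionDensity P X τ t f := by
  have hsf : IsSFiniteKernel (Kernel.withDensity (Kernel.const ℝ (volume : Measure ℝ))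
      (fun y x => ENNReal.ofReal (f x y))) :=
    Kernel.IsSFiniteKernel.withDensity _ fun _ _ => ENNReal.ofReal_ne_top
  refine ⟨hf, hasCondDistrib_of_indepFun hX hξ hind hΦ hXt (Filter.Eventually.of_forall fun y => ?_)⟩
  have hu : Measurable (Function.uncurry fun y x => ENNReal.ofReal (f x y)) :=
    ENNReal.measurable_ofReal.comp hf
  rw [Kernel.withDensity_apply _ hu, Kernel.const_apply]
  exact hκ y

/-! ### Moments of exponentials of Gaussian increments -/

section ExponentialMoments

variable {Ω : Type*} {mΩ : MeasurableSpace Ω} {P : Measure Ω} {w Z : Ω → ℝ} {d σ m : ℝ}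

theorem integrable_and_integral_pow_of_eq_exp (hw : HasLaw w (gaussianReal 0 d.toNNReal) P)
    (hd : 0 ≤ d) (hZ : ∀ᵐ ω ∂P, Z ω = Real.exp (σ * w ω + m)) (n : ℕ) :
    Integrable (fun ω => Z ω ^ n) P ∧
      ∫ ω, Z ω ^ n ∂P = Real.exp (n * m + (n : ℝ) ^ 2 / 2 * (σ ^ 2 * d)) := by
  have e : (fun ω => Z ω ^ n) =ᵐ[P] fun ω => Real.exp (n * m) * Real.exp (n * σ * w ω) := by
    filter_upwards [hZ] with ω hω
    rw [hω, ← Real.exp_nat_mul, ← Real.exp_add]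
    congr 1
    ring
  have hi := ((integrable_exp_mul_gaussianReal (μ := 0) (v := d.toNNReal) (n * σ))).const_mul
    (Real.exp (n * m))
  refine ⟨?_, ?_⟩
  · rw [← hw.map_eq] at hi
    exact (hi.comp_aemeasurable hw.aemeasurable).congr e.symm
  · rw [integral_congr_ae e,
      hw.integral_fun_comp (f := fun x => Real.exp (n * m) * Real.exp (n * σ * x)) (by fun_prop),
      integral_const_mul, integral_exp_gaussianReal, ← Real.exp_add, Real.coe_toNNReal _ hd]
    congr 1
    ring

theorem memLp_two_of_eq_exp (hw : HasLaw w (gaussianReal 0 d.toNNReal) P) (hd : 0 ≤ d)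
    (hZ : ∀ᵐ ω ∂P, Z ω = Real.exp (σ * w ω + m)) : MemLp Z 2 P := by
  have hm : AEMeasurable Z P := by
    refine AEMeasurable.congr ?_ (Filter.EventuallyEq.symm hZ)
    exact Real.measurable_exp.comp_aemeasurable ((hw.aemeasurable.const_mul σ).add_const m)
  rw [memLp_two_iff_integrable_sq hm.aestronglyMeasurable]
  exact (integrable_and_integral_pow_of_eq_exp hw hd hZ 2).1

end ExponentialMoments

/-! ### Laws and moments of the lognormal and Gaussian growth processes -/

namespace GrowthParams

open Filter

variable {G : GrowthParams} {T σ : ℝ} {Ω : Type*} {mΩ : MeasurableSpace Ω} {P : Measure Ω}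
  {𝓕 : Filtration ℝ mΩ} {W : ℝ → Ω → ℝ} {s y : ℝ} {X : ℝ → Ω → ℝ}

theorem exp_ML_add (hG : ∀ t ∈ Icc G.t₀ T, G.DefinedAt t) {τ t : ℝ} (hy : 0 < y) (hτ : G.t₀ ≤ τ)
    (hτt : τ ≤ t) (htT : t ≤ T) (r : ℝ) :
    Real.exp (G.ML σ t y τ + r)
      = y * (G.g τ / G.g t) * Real.exp (r - σ ^ 2 / 2 * (t - τ)) := by
  have h1 := g_pos (hG τ ⟨hτ, hτt.trans htT⟩)
  have h2 := g_pos (hG t ⟨hτ.trans hτt, htT⟩)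
  have e : G.ML σ t y τ + r
      = Real.log y + (Real.log (G.g τ / G.g t) + (r - σ ^ 2 / 2 * (t - τ))) := by
    rw [ML]; ring
  rw [e, Real.exp_add, Real.exp_add, Real.exp_log hy, Real.exp_log (div_pos h1 h2), mul_assoc]

theorem indepFun_increment {t₀ : ℝ} (hW : IsWienerFrom P 𝓕 t₀ W) {τ t : ℝ} (hτ : t₀ ≤ τ)
    (hτt : τ ≤ t) {Y : Ω → ℝ} (hY : Measurable[𝓕 τ] Y) :
    IndepFun Y (fun ω => W t ω - W τ ω) P := by
  rw [IndepFun_iff_Indep]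
  exact indep_of_indep_of_le_left (hW.indep _ _ hτ hτt) hY.comap_le

section Lognormal

variable [IsProbabilityMeasure P] (hG : G.Valid) (hg : ∀ t ∈ Icc G.t₀ T, G.DefinedAt t)
  (hW : IsWienerFrom P 𝓕 G.t₀ W) (hs : G.t₀ ≤ s) (hX : IsLognormalProcess G σ P 𝓕 W s T y X)

include hG hg hW hs hX

theorem lognormal_eq_mul_exp {τ t : ℝ} (hτ : s ≤ τ) (hτt : τ ≤ t) (htT : t ≤ T) :
    ∀ᵐ ω ∂P, X t ω = X τ ω * (G.g τ / G.g t) *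
      Real.exp (σ * (W t ω - W τ ω) - σ ^ 2 / 2 * (t - τ)) :=
  eq_mul_exp_of_linear hW hs hX
    (fun u hu => hasDerivAt_g hG (hs.trans hu.1) (hg u ⟨hs.trans hu.1, hu.2⟩))
    ((continuousOn_h hG hg).mono (Icc_subset_Icc hs le_rfl))
    (fun u hu => g_pos (hg u ⟨hs.trans hu.1, hu.2⟩)) hτ hτt htT

theorem lognormal_pos (hy : 0 < y) {t : ℝ} (hst : s ≤ t) (htT : t ≤ T) : ∀ᵐ ω ∂P, 0 < X t ω :=
  pos_of_linear hW hs hX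
    (fun u hu => hasDerivAt_g hG (hs.trans hu.1) (hg u ⟨hs.trans hu.1, hu.2⟩))
    ((continuousOn_h hG hg).mono (Icc_subset_Icc hs le_rfl))
    (fun u hu => g_pos (hg u ⟨hs.trans hu.1, hu.2⟩)) hy hst htT

theorem lognormal_eq_exp_ML (hy : 0 < y) {τ t : ℝ} (hτ : s ≤ τ) (hτt : τ ≤ t) (htT : t ≤ T) :
    ∀ᵐ ω ∂P, X t ω = Real.exp (σ * (W t ω - W τ ω) + G.ML σ t (X τ ω) τ) := by
  filter_upwards [lognormal_eq_mul_exp hG hg hW hs hX hτ hτt htT,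
    lognormal_pos hG hg hW hs hX hy hτ (hτt.trans htT)] with ω h1 h2
  rw [h1, add_comm, exp_ML_add hg h2 (hs.trans hτ) hτt htT]

theorem lognormal_eq_exp_ML_initial (hy : 0 < y) {t : ℝ} (hst : s ≤ t) (htT : t ≤ T) :
    ∀ᵐ ω ∂P, X t ω = Real.exp (σ * (W t ω - W s ω) + G.ML σ t y s) := by
  filter_upwards [lognormal_eq_exp_ML hG hg hW hs hX hy le_rfl hst htT, hX.initial] with ω h1 h2
  rw [h1, h2]

theorem lognormal_memLp (hy : 0 < y) {t : ℝ} (hst : s ≤ t) (htT : t ≤ T) : MemLp (X t) 2 P :=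
  memLp_two_of_eq_exp (hW.hasLaw_sub hs hst) (sub_nonneg.2 hst)
    (lognormal_eq_exp_ML_initial hG hg hW hs hX hy hst htT)

theorem lognormal_moments (hy : 0 < y) {t : ℝ} (hst : s ≤ t) (htT : t ≤ T) (m : ℕ) :
    Integrable (fun ω => X t ω ^ m) P ∧ ∫ ω, X t ω ^ m ∂P =
      Real.exp (m * G.ML σ t y s + (m : ℝ) ^ 2 / 2 * (σ ^ 2 * (t - s))) :=
  integrable_and_integral_pow_of_eq_exp (hW.hasLaw_sub hs hst) (sub_nonneg.2 hst)
    (lognormal_eq_exp_ML_initial hG hg hW hs hX hy hst htT) m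

theorem lognormal_mean (hy : 0 < y) {t : ℝ} (hst : s ≤ t) (htT : t ≤ T) :
    ∫ ω, X t ω ∂P = y * (G.g s / G.g t) := by
  have h := (lognormal_moments hG hg hW hs hX hy hst htT 1).2
  simp only [pow_one, Nat.cast_one, one_mul, one_pow] at h
  rw [h, exp_ML_add hg hy hs hst htT]
  ring_nf
  simp

theorem lognormal_variance (hy : 0 < y) {t : ℝ} (hst : s ≤ t) (htT : t ≤ T) :
    Var[X t; P] = (y * (G.g s / G.g t)) ^ 2 * (Real.exp (σ ^ 2 * (t - s)) - 1) := by
  have h := (lognormal_moments hG hg hW hs hX hy hst htT 2).2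
  have e : ((2 : ℕ) : ℝ) * G.ML σ t y s + ((2 : ℕ) : ℝ) ^ 2 / 2 * (σ ^ 2 * (t - s))
      = (2 : ℕ) * (G.ML σ t y s + σ ^ 2 * (t - s)) := by push_cast; ring
  have e' : (2 : ℕ) * (σ ^ 2 * (t - s) - σ ^ 2 / 2 * (t - s)) = σ ^ 2 * (t - s) := by
    push_cast; ring
  rw [e, Real.exp_nat_mul, exp_ML_add hg hy hs hst htT, mul_pow, ← Real.exp_nat_mul, e'] at h
  rw [variance_eq_sub (lognormal_memLp hG hg hW hs hX hy hst htT),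
    lognormal_mean hG hg hW hs hX hy hst htT]
  simp only [Pi.pow_apply]
  rw [h]
  ring

theorem lognormal_hasTransitionDensity (hσ : 0 < σ) (hy : 0 < y) {τ t : ℝ} (hτ : s ≤ τ)
    (hτt : τ < t) (htT : t ≤ T) :
    HasTransitionDensity P X τ t (fun x z => G.fL σ x t z τ) := by
  have hXτ := hX.adapted τ ⟨hτ, hτt.le.trans htT⟩
  refine hasTransitionDensity_of_indepFun (measurable_fL σ t τ) (hXτ.mono (𝓕.le _) le_rfl)
    (hW.hasLaw_sub (hs.trans hτ) hτt.le) (indepFun_increment hW (hs.trans hτ) hτt.le hXτ)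
    (Φ := fun z w => Real.exp (σ * w + G.ML σ t z τ)) ?_
    (lognormal_eq_exp_ML hG hg hW hs hX hy hτ hτt.le htT) fun z => withDensity_fL hσ hτt z
  unfold ML
  fun_prop

theorem lognormal_hasLaw (hσ : 0 < σ) (hy : 0 < y) {t : ℝ} (hst : s < t) (htT : t ≤ T) :
    HasLaw (X t) (volume.withDensity (fun x => ENNReal.ofReal (G.fL σ x t y s))) P := by
  have h := hW.hasLaw_sub hs hst.le
  have hm : Measurable fun w => Real.exp (σ * w + G.ML σ t y s) := by fun_prop
  have h1 : HasLaw (fun w => Real.exp (σ * w + G.ML σ t y s))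
      (volume.withDensity (fun x => ENNReal.ofReal (G.fL σ x t y s)))
      (gaussianReal 0 (t - s).toNNReal) := ⟨hm.aemeasurable, (withDensity_fL hσ hst y).symm⟩
  exact (h1.fun_comp h).congr (lognormal_eq_exp_ML_initial hG hg hW hs hX hy hst.le htT)

theorem lognormal_condExp_and_condVar (hy : 0 < y) {τ t : ℝ} (hτ : s ≤ τ) (hτt : τ < t)
    (htT : t ≤ T) :
    P[X t | MeasurableSpace.comap (X τ) inferInstance]
      =ᵐ[P] (fun ω => X τ ω * (G.g τ / G.g t)) ∧
    Var[X t; P | MeasurableSpace.comap (X τ) inferInstance]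
      =ᵐ[P] (fun ω => (X τ ω * (G.g τ / G.g t)) ^ 2 * (Real.exp (σ ^ 2 * (t - τ)) - 1)) := by
  have hXτ := hX.adapted τ ⟨hτ, hτt.le.trans htT⟩
  have hτ₀ := hs.trans hτ
  have hd : 0 ≤ t - τ := (sub_pos.2 hτt).le
  have hlaw := hW.hasLaw_sub hτ₀ hτt.le
  have hwm : Measurable (fun ω => W t ω - W τ ω) :=
    (hW.measurable_sub hτ₀ hτt.le).mono (𝓕.le _) le_rfl
  -- Starting value `1` has logarithm zero, so this is the random factor that carries `X τ` to `X
  -- t`.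
  set ξ : Ω → ℝ := fun ω => Real.exp (σ * (W t ω - W τ ω) + G.ML σ t 1 τ) with hξ
  have hφ : Measurable fun w => Real.exp (σ * w + G.ML σ t 1 τ) := by fun_prop
  have hξm : Measurable ξ := hφ.comp hwm
  have hind : IndepFun (X τ) ξ P :=
    (indepFun_increment hW hτ₀ hτt.le hXτ).comp measurable_id hφ
  have hmom := integrable_and_integral_pow_of_eq_exp (σ := σ) (m := G.ML σ t 1 τ) hlaw hd
    (Z := ξ) (ae_of_all _ fun ω => rfl)
  have hc : G.g τ / G.g t = Real.exp (G.ML σ t 1 τ + σ ^ 2 / 2 * (t - τ)) := by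
    rw [exp_ML_add hg one_pos hτ₀ hτt.le htT]
    simp
  have hE1 : ∫ ω, ξ ω ∂P = G.g τ / G.g t := by
    have := (hmom 1).2
    simp only [pow_one, Nat.cast_one, one_mul, one_pow] at this
    rw [this, hc]
    ring_nf
  have hE2 : ∫ ω, ξ ω ^ 2 ∂P = (G.g τ / G.g t) ^ 2 * Real.exp (σ ^ 2 * (t - τ)) := by
    rw [(hmom 2).2, hc, ← Real.exp_nat_mul, ← Real.exp_add]
    congr 1
    push_cast
    ring
  have h := condExp_and_condVar_of_eq_mul (hXτ.mono (𝓕.le _) le_rfl) hξm hind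
    (memLp_two_of_eq_exp hlaw hd (ae_of_all _ fun ω => rfl))
    (lognormal_memLp hG hg hW hs hX hy (hτ.trans hτt.le) htT) (by
      filter_upwards [lognormal_eq_mul_exp hG hg hW hs hX hτ hτt.le htT] with ω hω
      rw [hω, hξ]
      simp only
      rw [add_comm, exp_ML_add hg one_pos hτ₀ hτt.le htT]
      ring)
  rw [hE1, hE2] at h
  refine ⟨h.1, h.2.trans (Eventually.of_forall fun ω => ?_)⟩
  simp only
  ring

end Lognormal

section Gaussian

theorem VG_pos (hG : G.Valid) (hg : ∀ t ∈ Icc G.t₀ T, G.DefinedAt t) (hσ : 0 < σ) {τ t : ℝ}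
    (hτ : G.t₀ ≤ τ) (hτt : τ < t) (htT : t ≤ T) : 0 < G.VG σ t τ := by
  have hsub : Icc τ t ⊆ Icc G.t₀ T := Icc_subset_Icc hτ htT
  have hc : ContinuousOn (fun θ => (G.g θ / G.g t) ^ 2) (Icc τ t) := fun θ hθ =>
    ((((hasDerivAt_g hG (hsub hθ).1 (hg θ (hsub hθ))).continuousAt).div_const _).pow
      2).continuousWithinAt
  refine mul_pos (pow_pos hσ 2) (intervalIntegral.intervalIntegral_pos_of_pos_on
    (intervalIntegrable_of_subset hc (left_mem_Icc.2 hτt.le) (right_mem_Icc.2 hτt.le))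
    (fun θ hθ => ?_) hτt)
  have h1 := g_pos (hg θ (hsub (Ioo_subset_Icc_self hθ)))
  have h2 := g_pos (hg t (hsub (right_mem_Icc.2 hτt.le)))
  positivity

/-- The additive noise of the Gaussian process between the times `τ` and `t`. -/
noncomputable def gaussianNoise (G : GrowthParams) (X : ℝ → Ω → ℝ) (τ t : ℝ) (ω : Ω) : ℝ :=
  X t ω - X τ ω * (G.g τ / G.g t)

variable [IsProbabilityMeasure P] (hG : G.Valid) (hg : ∀ t ∈ Icc G.t₀ T, G.DefinedAt t)
  (hW : IsWienerFrom P 𝓕 G.t₀ W) (hs : G.t₀ ≤ s) (hX : IsGaussianProcessOU G σ P 𝓕 W s T y X)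

include hG hg hW hs hX

/-- Dividing `g(t) X(t) - g(τ) X(τ)` by `g(t)` gives the noise as a limit of Riemann sums with
integrand `σ g / g(t)`, whose squared integral is the variance `VG`. -/
theorem gaussianNoise_hasLaw_and_indepFun {τ t : ℝ} (hτ : s ≤ τ) (hτt : τ ≤ t) (htT : t ≤ T) :
    Measurable (gaussianNoise G X τ t) ∧
      HasLaw (gaussianNoise G X τ t) (gaussianReal 0 (G.VG σ t τ).toNNReal) P ∧
      IndepFun (X τ) (gaussianNoise G X τ t) P := by
  have hXτ := hX.adapted τ ⟨hτ, hτt.trans htT⟩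
  have hXτm : Measurable (X τ) := hXτ.mono (𝓕.le _) le_rfl
  have hXtm : Measurable (X t) := (hX.adapted t ⟨hτ.trans hτt, htT⟩).mono (𝓕.le _) le_rfl
  have hsub : Icc τ t ⊆ Icc G.t₀ T := Icc_subset_Icc (hs.trans hτ) htT
  have hgt := g_pos (hg t (hsub (right_mem_Icc.2 hτt)))
  have hlim := tendsto_sum_increments_of_additive hX
    (fun u hu => hasDerivAt_g hG (hs.trans hu.1) (hg u ⟨hs.trans hu.1, hu.2⟩))
    ((continuousOn_h hG hg).mono (Icc_subset_Icc hs le_rfl)) hτ hτt htT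
  have hgc : ContinuousOn (fun u => σ * G.g u / G.g t) (Icc τ t) := fun u hu =>
    (((hasDerivAt_g hG (hsub hu).1 (hg u (hsub hu))).continuousAt.const_mul σ).div_const
      _).continuousWithinAt
  have hm : Measurable (gaussianNoise G X τ t) := hXtm.sub (hXτm.mul_const _)
  have hV : ∫ u in τ..t, (σ * G.g u / G.g t) ^ 2 = G.VG σ t τ := by
    rw [VG, ← intervalIntegral.integral_const_mul]
    refine intervalIntegral.integral_congr fun u _ => ?_
    ring
  have h := hasLaw_and_indepFun_of_tendsto_sum_increments hW (hs.trans hτ) hτt hgc hXτ hm (by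
    filter_upwards [hlim] with ω hω
    have e : gaussianNoise G X τ t ω = (G.g t * X t ω - G.g τ * X τ ω) / G.g t := by
      rw [gaussianNoise]; field_simp
    rw [e]
    refine (hω.div_const (G.g t)).congr fun n => ?_
    rw [Finset.sum_div]
    exact Finset.sum_congr rfl fun i _ => by ring)
  rw [hV] at h
  exact ⟨hm, h⟩

theorem gaussian_memLp {t : ℝ} (hst : s ≤ t) (htT : t ≤ T) : MemLp (X t) 2 P := by
  obtain ⟨-, hlaw, -⟩ := gaussianNoise_hasLaw_and_indepFun hG hg hW hs hX le_rfl hst htT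
  refine ((hlaw.memLp_comp (memLp_id_gaussianReal' 2 (by simp))).add
    (memLp_const (y * (G.g s / G.g t)))).ae_eq ?_
  filter_upwards [hX.initial] with ω hω
  simp only [Pi.add_apply, gaussianNoise, hω, id]
  ring

theorem gaussian_hasLaw_gaussianReal {t : ℝ} (hst : s ≤ t) (htT : t ≤ T) :
    HasLaw (X t) (gaussianReal (G.MG t y s) (G.VG σ t s).toNNReal) P := by
  obtain ⟨-, hlaw, -⟩ := gaussianNoise_hasLaw_and_indepFun hG hg hW hs hX le_rfl hst htT
  have h := gaussianReal_add_const hlaw (G.MG t y s)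
  rw [zero_add] at h
  refine h.congr ?_
  filter_upwards [hX.initial] with ω hω
  simp only [gaussianNoise, hω, MG]
  ring

theorem gaussian_mean {t : ℝ} (hst : s ≤ t) (htT : t ≤ T) : ∫ ω, X t ω ∂P = G.MG t y s := by
  rw [(gaussian_hasLaw_gaussianReal hG hg hW hs hX hst htT).integral_fun_comp (f := fun x => x)
    measurable_id, integral_id_gaussianReal]

theorem gaussian_variance (hσ : 0 < σ) {t : ℝ} (hst : s < t) (htT : t ≤ T) :
    Var[X t; P] = G.VG σ t s := by
  rw [(gaussian_hasLaw_gaussianReal hG hg hW hs hX hst.le htT).variance_eq,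
    variance_id_gaussianReal, Real.coe_toNNReal _ (VG_pos hG hg hσ hs hst htT).le]

theorem gaussian_hasTransitionDensity (hσ : 0 < σ) {τ t : ℝ} (hτ : s ≤ τ) (hτt : τ < t)
    (htT : t ≤ T) : HasTransitionDensity P X τ t (fun x z => G.fG σ x t z τ) := by
  obtain ⟨-, hlaw, hind⟩ := gaussianNoise_hasLaw_and_indepFun hG hg hW hs hX hτ hτt.le htT
  have hXτ := (hX.adapted τ ⟨hτ, hτt.le.trans htT⟩).mono (𝓕.le _) le_rfl
  refine hasTransitionDensity_of_indepFun (measurable_fG σ t τ) hXτ hlaw hind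
    (Φ := fun z w => w + G.MG t z τ) (by unfold MG; fun_prop)
    (ae_of_all _ fun ω => by simp [gaussianNoise, MG]) fun z => ?_
  rw [withDensity_fG (VG_pos hG hg hσ (hs.trans hτ) hτt htT), gaussianReal_map_add_const, zero_add]

theorem gaussian_condExp_and_condVar (hσ : 0 < σ) {τ t : ℝ} (hτ : s ≤ τ) (hτt : τ < t)
    (htT : t ≤ T) :
    P[X t | MeasurableSpace.comap (X τ) inferInstance] =ᵐ[P] (fun ω => G.MG t (X τ ω) τ) ∧
    Var[X t; P | MeasurableSpace.comap (X τ) inferInstance] =ᵐ[P] (fun _ => G.VG σ t τ) := by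
  obtain ⟨hm, hlaw, hind⟩ := gaussianNoise_hasLaw_and_indepFun hG hg hW hs hX hτ hτt.le htT
  have hXτ := (hX.adapted τ ⟨hτ, hτt.le.trans htT⟩).mono (𝓕.le _) le_rfl
  have h0 : ∫ ω, gaussianNoise G X τ t ω ∂P = 0 := by
    rw [hlaw.integral_fun_comp (f := fun x => x) measurable_id, integral_id_gaussianReal]
  have h2 : ∫ ω, gaussianNoise G X τ t ω ^ 2 ∂P = G.VG σ t τ := by
    rw [← variance_of_integral_eq_zero hm.aemeasurable h0, hlaw.variance_eq,
      variance_id_gaussianReal, Real.coe_toNNReal _ (VG_pos hG hg hσ (hs.trans hτ) hτt htT).le]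
  have h := condExp_and_condVar_of_eq_add hXτ hm hind
    (gaussian_memLp hG hg hW hs hX hτ (hτt.le.trans htT))
    (hlaw.memLp_comp (memLp_id_gaussianReal' 2 (by simp))) h0 (Z := X t) (a := G.g τ / G.g t)
    (ae_of_all _ fun ω => by simp [gaussianNoise])
  rw [h2] at h
  exact h

end Gaussian

end GrowthParams

/-! ### Assembly of the main theorem -/

open GrowthParams in
theorem mainTheorem5 (G : GrowthParams) (hG : G.Valid) (T : ℝ) (hT : G.t₀ < T)
    (hg : ∀ t ∈ Icc G.t₀ T, G.DefinedAt t) (σ : ℝ) (hσ : 0 < σ)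
    {Ω : Type*} {mΩ : MeasurableSpace Ω} (P : Measure Ω) [IsProbabilityMeasure P]
    (𝓕 : Filtration ℝ mΩ) (W : ℝ → Ω → ℝ) (hW : IsWienerFrom P 𝓕 G.t₀ W) :
    -- the two forms of the growth factor, and the deterministic growth curve
    (∀ τ t : ℝ, G.t₀ ≤ τ → τ ≤ t → t ≤ T →
      IntervalIntegrable G.h volume τ t ∧
      ∫ u in τ..t, G.h u = Real.log (G.g τ / G.g t)) ∧
    (∀ t ∈ Icc G.t₀ T, G.curve t = G.x₀ * (G.g G.t₀ / G.g t)) ∧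
    -- the lognormal process, started from any `y > 0` at any time `s`
    (∀ (s y : ℝ) (X : ℝ → Ω → ℝ), G.t₀ ≤ s → 0 < y →
      IsLognormalProcess G σ P 𝓕 W s T y X →
      -- conditioning on the state at time `τ`
      (∀ τ t : ℝ, s ≤ τ → τ < t → t ≤ T →
        (∀ᵐ ω ∂P, 0 < X τ ω) ∧
        HasTransitionDensity P X τ t (fun x z => G.fL σ x t z τ) ∧
        MemLp (X t) 2 P ∧
        P[X t | MeasurableSpace.comap (X τ) inferInstance]
          =ᵐ[P] (fun ω => X τ ω * (G.g τ / G.g t)) ∧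
        Var[X t; P | MeasurableSpace.comap (X τ) inferInstance]
          =ᵐ[P] (fun ω => (X τ ω * (G.g τ / G.g t)) ^ 2 *
            (Real.exp (σ ^ 2 * (t - τ)) - 1))) ∧
      -- law and moments at time `t` from the state `y` at time `s`
      (∀ t : ℝ, s < t → t ≤ T →
        HasLaw (X t) (volume.withDensity (fun x => ENNReal.ofReal (G.fL σ x t y s))) P ∧
        (∀ m : ℕ, Integrable (fun ω => X t ω ^ m) P ∧
          ∫ ω, X t ω ^ m ∂P =
            Real.exp (m * G.ML σ t y s + (m : ℝ) ^ 2 / 2 * (σ ^ 2 * (t - s)))) ∧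
        ∫ ω, X t ω ∂P = y * (G.g s / G.g t) ∧
        Var[X t; P] = (y * (G.g s / G.g t)) ^ 2 * (Real.exp (σ ^ 2 * (t - s)) - 1)) ∧
      -- the mean of the process started from `x₀` at time `t₀`
      (s = G.t₀ → y = G.x₀ → ∀ t ∈ Icc G.t₀ T, ∫ ω, X t ω ∂P = G.curve t)) ∧
    -- the Gaussian process, started from any real `y` at any time `s`
    (∀ (s y : ℝ) (X : ℝ → Ω → ℝ), G.t₀ ≤ s →
      IsGaussianProcessOU G σ P 𝓕 W s T y X →
      -- conditioning on the state at time `τ`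
      (∀ τ t : ℝ, s ≤ τ → τ < t → t ≤ T →
        0 < G.VG σ t τ ∧
        HasTransitionDensity P X τ t (fun x z => G.fG σ x t z τ) ∧
        MemLp (X t) 2 P ∧
        P[X t | MeasurableSpace.comap (X τ) inferInstance]
          =ᵐ[P] (fun ω => G.MG t (X τ ω) τ) ∧
        Var[X t; P | MeasurableSpace.comap (X τ) inferInstance]
          =ᵐ[P] (fun _ => G.VG σ t τ)) ∧
      -- law and moments at time `t` from the state `y` at time `s`
      (∀ t : ℝ, s < t → t ≤ T →
        HasLaw (X t) (volume.withDensity (fun x => ENNReal.ofReal (G.fG σ x t y s))) P ∧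
        ∫ ω, X t ω ∂P = G.MG t y s ∧
        Var[X t; P] = G.VG σ t s) ∧
      -- the mean of the process started from `x₀` at time `t₀`
      (s = G.t₀ → y = G.x₀ → ∀ t ∈ Icc G.t₀ T, ∫ ω, X t ω ∂P = G.curve t)) := by
  refine ⟨fun τ t hτ hτt ht => integral_h hG hg hτ hτt ht,
    fun t ht => curve_eq hG (hg G.t₀ ⟨le_rfl, hT.le⟩) (hg t ht), ?_, ?_⟩
  · intro s y X hs hy hX
    refine ⟨fun τ t hτ hτt ht => ?_, fun t hst ht => ?_, ?_⟩
    · have h := lognormal_condExp_and_condVar hG hg hW hs hX hy hτ hτt ht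
      exact ⟨lognormal_pos hG hg hW hs hX hy hτ (hτt.le.trans ht),
        lognormal_hasTransitionDensity hG hg hW hs hX hσ hy hτ hτt ht,
        lognormal_memLp hG hg hW hs hX hy (hτ.trans hτt.le) ht, h.1, h.2⟩
    · exact ⟨lognormal_hasLaw hG hg hW hs hX hσ hy hst ht,
        lognormal_moments hG hg hW hs hX hy hst.le ht,
        lognormal_mean hG hg hW hs hX hy hst.le ht,
        lognormal_variance hG hg hW hs hX hy hst.le ht⟩
    · rintro rfl rfl t ht
      rw [lognormal_mean hG hg hW hs hX hy ht.1 ht.2,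
        curve_eq hG (hg G.t₀ ⟨le_rfl, hT.le⟩) (hg t ht)]
  · intro s y X hs hX
    refine ⟨fun τ t hτ hτt ht => ?_, fun t hst ht => ?_, ?_⟩
    · have h := gaussian_condExp_and_condVar hG hg hW hs hX hσ hτ hτt ht
      exact ⟨VG_pos hG hg hσ (hs.trans hτ) hτt ht,
        gaussian_hasTransitionDensity hG hg hW hs hX hσ hτ hτt ht,
        gaussian_memLp hG hg hW hs hX (hτ.trans hτt.le) ht, h.1, h.2⟩
    · refine ⟨?_, gaussian_mean hG hg hW hs hX hst.le ht,
        gaussian_variance hG hg hW hs hX hσ hst ht⟩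
      rw [withDensity_fG (VG_pos hG hg hσ hs hst ht)]
      exact gaussian_hasLaw_gaussianReal hG hg hW hs hX hst.le ht
    · rintro rfl rfl t ht
      rw [gaussian_mean hG hg hW hs hX ht.1 ht.2, MG,
        curve_eq hG (hg G.t₀ ⟨le_rfl, hT.le⟩) (hg t ht)]
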